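/- **Setting.** On $\mathbb R^{2n}$ with canonical coordinates $(q,p)$ let $\{f,g\}=\sum_i(\partial_{q_i}f\,\partial_{p_i}g-\partial_{p_i}f\,\partial_{q_i}g)$. Given $F=\sum_n\frac{\epsilon^n}{n!}F_n$ and a generating function $W=\sum_n\frac{\epsilon^n}{n!}W_{n+1}$, the *Lie transform* of $F$ is $\sum_n\frac{\epsilon^n}{n!}F_{0,n}$, where $F_{n,0}=F_n$ and $F_{n,m+1}=F_{n+1,m}+\sum_{k=0}^n\binom nk\{F_{n-k,m},W_{k+1}\}$. It represents $F$ in the variables obtained through the canonical transformation generated by the Hamiltonian flow, in the "time" $\epsilon$, of $W$. Let $$\mathcal J=\tfrac12(P_x^2+P_y^2+P_z^2)+P_xp_y-p_xP_y-\frac1R+\tfrac12(R^2-3p_x^2),\qquad R^2=p_x^2+p_y^2+p_z^2,$$ be the Hill Hamiltonian, and $\rho=3^{-1/3}$, $\lambda=(2\sqrt7+1)^{1/2}$, $\omega=(2\sqrt7-1)^{1/2}$, $\nu=2$, $\delta=1-(\nu/\omega)^2$, $\delta^*=\frac12\delta(1+\frac14\delta)$, $\sigma=(2\lambda(16\lambda^2-72))^{1/2}$,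 $\tau=(16\omega^2+72)^{1/2}$, $$k_0=\tfrac{(\omega^2+2)\rho}{6733104},\quad k_1=\tfrac1{16}(6829135-609646\omega^2)k_0,\quad k_2=(126184-9583\omega^2)k_0,$$ $$k_3=-\tfrac34(439957-103954\omega^2)k_0,\quad k_4=\tfrac34(7293079-1280862\omega^2)k_0 .$$ Let $P_m$ be the Legendre polynomials, $r^2=x^2+y^2+z^2$, $$H_0=\tfrac12(X^2+Y^2)-(xY-yX)+2(y^2-2x^2)+\tfrac12(Z^2+4z^2),\qquad H_n=-\frac{(-1)^n n!}{\rho}\,\frac{r^{n+2}}{\rho^{n+2}}\,P_{n+2}(x/r)\quad(n\ge1).$$ **Result.** 1. *(Translation.)* The point $(\rho,0,0,0,\rho,0)$ is an equilibrium of $\mathcal J$, the translation $\mathcal T_1$: $p_x=\rho+x$, $p_y=y$, $p_z=z$, $P_x=X$, $P_y=\rho+Y$, $P_z=Z$ is canonical and, for every $\zeta=(x,y,z,X,Y,Z)$, $$\mathcal J(\mathcal T_1(\epsilon\zeta))=-\tfrac92\rho^2+\epsilon^2\sum_{n=0}^2\tfrac{\epsilon^n}{n!}H_n(\zeta)+O(\epsilon^5)\qquad(\epsilon\to0).$$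 2. *(Linear decoupling.)* The linear map $\mathcal T_2$ given by $z=z_1$, $Z=Z_1$ and $(x,y,X,Y)^T=A(x_1,y_1,X_1,Y_1)^T$, $$A=\begin{pmatrix}2\lambda/\sigma&0&-2\lambda/\sigma&2/\tau\\(\lambda^2-9)/\sigma&-(\omega^2+9)/\tau&(\lambda^2-9)/\sigma&0\\(\lambda^2+9)/\sigma&(9-\omega^2)/\tau&(\lambda^2+9)/\sigma&0\\\lambda(\lambda^2-7)/\sigma&0&\lambda(7-\lambda^2)/\sigma&-(\omega^2+7)/\tau\end{pmatrix},$$ is canonical, and the polynomials $K_n=H_n\circ\mathcal T_2$ satisfy $K_0=\lambda x_1X_1+\frac12(Y_1^2+\omega^2y_1^2)+\frac12(Z_1^2+\nu^2z_1^2)$. 3. *(Center manifold.)* There are polynomials $W_1,W_2$, all of whose monomials have different exponents of $x_2$ and $X_2$, such that the terms $N_0,N_1,N_2$ of the Lie transform of $\sum_n\frac{\epsilon^n}{n!}K_n$ contain only monomials with equal exponents of $x_2$ and $X_2$, so that $\{x_2X_2,N_n\}=0$. For every such choice and every $\zeta$ the orbit $\gamma$ of $W_1+\epsilon W_2$ with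 $\gamma(0)=\zeta$ exists for small $|\epsilon|$, and $$\mathcal J(\mathcal T_1\mathcal T_2(\epsilon\gamma(\epsilon)))=-\tfrac92\rho^2+\epsilon^2\sum_{n=0}^2\tfrac{\epsilon^n}{n!}N_n(\zeta)+O(\epsilon^5).$$ Put $C_n(y_2,z_2,Y_2,Z_2)=N_n|_{x_2=X_2=0}$ (with $N$ any such normal form). 4. *(Detuning and Lissajous variables.)* $\delta=(23-8\sqrt7)/27$. On $|G|<L$, with $s=\sqrt{(L+G)/(2\omega)}$ and $d=\sqrt{(L-G)/(2\omega)}$, the map $\mathcal T_4:(\ell,g,L,G)\mapsto(y_2,z_2,Y_2,Z_2)$, $$y_2=s\cos(g+\ell)-d\cos(g-\ell),\quad z_2=s\sin(g+\ell)-d\sin(g-\ell),$$ $$Y_2=-\omega[s\sin(g+\ell)+d\sin(g-\ell)],\quad Z_2=\omega[s\cos(g+\ell)+d\cos(g-\ell)],$$ is canonical. Let $\mathcal A_0=(C_0+\frac12\omega^2\delta z_2^2)\circ\mathcal T_4$, $\mathcal A_1=(C_1-\frac12\omega^2\delta z_2^2)\circ\mathcal T_4$, $\mathcal A_2=C_2\circ\mathcal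 T_4$. 5. *(Averaging.)* There are smooth functions $V_1,V_2$ on $\{|G|<L\}$, $2\pi$-periodic in $\ell$ with zero mean over $\ell$, such that the terms $B_0,B_1,B_2$ of the Lie transform of $\sum_n\frac{\epsilon^n}{n!}\mathcal A_n$ with the generating function $V_1+\epsilon V_2$ do not depend on $\ell'$. For every such choice, through every point $v$ of the domain there is, for small $|\epsilon|$, an orbit $\gamma$ of $V_1+\epsilon V_2$ with $\gamma(0)=v$, and $\sum_{n\le2}\frac{\epsilon^n}{n!}\mathcal A_n(\gamma(\epsilon))=\sum_{n\le2}\frac{\epsilon^n}{n!}B_n(v)+O(\epsilon^3)$; moreover $L'$ is an integral, $\{L',B_n\}=0$ for $n\le2$, and, with $s',d'$ the functions $s,d$ at $(L',G')$, $$B_0=\omega L',\qquad B_1=-\tfrac14\delta\omega(L'+2\omega d's'\cos2g'),$$ $$B_2=2\Big(\tfrac\delta4B_1-k_1L'^2+k_2L'\omega s'd'\cos2g'-k_3\omega^2s'^2d'^2\cos4g'+\tfrac{k_4}4G'^2\Big).$$ The numbers $k_0,\dots,k_4$ are positive and irrational. 6. *(Hopf variables.)* For $|G'|\le L'$ let $I_1=\omega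 s'd'\cos2g'$, $I_2=\omega s'd'\sin2g'$, $I_3=\frac12G'$. Then $I_1^2+I_2^2+I_3^2=\frac14L'^2$; for each $L'\ge0$ every point of this sphere is obtained from some $g'$ and $G'$ with $|G'|\le L'$; and, with $B_0,B_1,B_2$ given by the above formulas, $\mathcal I=B_0+B_1+\frac12B_2$ (the value at $\epsilon=1$) is $$\mathcal I=\omega(1-\tfrac12\delta^*)L'-k_1L'^2+(k_2L'-\omega\delta^*)I_1+k_3(I_2^2-I_1^2)+k_4I_3^2 .$$ -/

import Mathlib

open Real Filter Topology Asymptotics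

noncomputable section

namespace Hill

/-! ### Canonical phase space, Poisson brackets, canonical maps, Lie transforms -/

/-- Phase space of `n` degrees of freedom: `Sum.inl i` indexes the coordinate `q i` and
`Sum.inr i` its conjugate momentum `p i`. -/
abbrev Phase (n : ℕ) : Type := Fin n ⊕ Fin n → ℝ

/-- Polynomials on the phase space of three degrees of freedom. -/
abbrev Poly : Type := MvPolynomial (Fin 3 ⊕ Fin 3) ℝ

/-- Partial derivative of `f` with respect to the phase variable `v`. -/
def partialD {n : ℕ} (f : Phase n → ℝ) (v : Fin n ⊕ Fin n) (ζ : Phase n) : ℝ :=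
  fderiv ℝ f ζ (Pi.single v 1)

/-- Poisson bracket `∑ (∂f/∂q ∂g/∂p - ∂f/∂p ∂g/∂q)`. -/
def poisson {n : ℕ} (f g : Phase n → ℝ) : Phase n → ℝ := fun ζ =>
  ∑ i, (partialD f (Sum.inl i) ζ * partialD g (Sum.inr i) ζ
      - partialD f (Sum.inr i) ζ * partialD g (Sum.inl i) ζ)

/-- The same bracket on polynomials. -/
def polyPoisson (f g : Poly) : Poly :=
  ∑ i, (MvPolynomial.pderiv (Sum.inl i) f * MvPolynomial.pderiv (Sum.inr i) g
      - MvPolynomial.pderiv (Sum.inr i) f * MvPolynomial.pderiv (Sum.inl i) g)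

/-- A canonical map: differentiable, with the canonical fundamental Poisson brackets. -/
def IsCanonicalOn {n : ℕ} (Φ : Phase n → Phase n) (D : Set (Phase n)) : Prop :=
  ∀ ζ ∈ D, DifferentiableAt ℝ Φ ζ ∧ ∀ i j : Fin n,
    poisson (fun z => Φ z (Sum.inl i)) (fun z => Φ z (Sum.inl j)) ζ = 0 ∧
    poisson (fun z => Φ z (Sum.inr i)) (fun z => Φ z (Sum.inr j)) ζ = 0 ∧
    poisson (fun z => Φ z (Sum.inl i)) (fun z => Φ z (Sum.inr j)) ζ = if i = j then 1 else 0

/-- Deprit's triangle for the Lie transform with generating function `∑ εⁿ/n! W (n+1)` applied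
to `∑ εⁿ/n! F n`; the rows are indexed by the first argument. -/
def depritTriangle {M : Type*} [AddCommGroup M] (br : M → M → M) (W F : ℕ → M) : ℕ → ℕ → M
  | 0 => F
  | m + 1 => fun n =>
      depritTriangle br W F m (n + 1)
        + ∑ k ∈ Finset.range (n + 1), n.choose k • br (depritTriangle br W F m (n - k)) (W (k + 1))

/-- The `n`-th term of the Lie-transformed Hamiltonian `∑ εⁿ/n! (lieTransform br W F n)`. -/
def lieTransform {M : Type*} [AddCommGroup M] (br : M → M → M) (W F : ℕ → M) (n : ℕ) : M :=
  depritTriangle br W F n 0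

/-- Hamiltonian vector field `(∂f/∂p, -∂f/∂q)`. -/
def hamField {n : ℕ} (f : Phase n → ℝ) (ζ : Phase n) : Phase n :=
  Sum.elim (fun i => partialD f (Sum.inr i) ζ) (fun i => -partialD f (Sum.inl i) ζ)

/-- `γ ε` is the image of `ζ` under the near-identity canonical transformation generated by
`W 1 + ε W 2`, i.e. under the flow of this `ε`-dependent Hamiltonian. -/
def IsLieOrbit {n : ℕ} (W : ℕ → Phase n → ℝ) (ζ : Phase n) (γ : ℝ → Phase n) : Prop :=
  γ 0 = ζ ∧ ∀ᶠ ε in 𝓝 (0 : ℝ), HasDerivAt γ (hamField (fun z => W 1 z + ε * W 2 z) (γ ε)) ε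

/-- Sum of the terms up to the second order of `∑ εⁿ/n! a n`. -/
def truncated (a : ℕ → ℝ) (ε : ℝ) : ℝ := ∑ n ∈ Finset.range 3, ε ^ n / (n.factorial : ℝ) * a n

/-! ### The Hill problem about the libration point -/

/-- Hill Hamiltonian in units in which it has no parameter. -/
def hillHam (ζ : Phase 3) : ℝ :=
  let px := ζ (Sum.inl 0); let py := ζ (Sum.inl 1); let pz := ζ (Sum.inl 2)
  let Px := ζ (Sum.inr 0); let Py := ζ (Sum.inr 1); let Pz := ζ (Sum.inr 2)
  (Px ^ 2 + Py ^ 2 + Pz ^ 2) / 2 + Px * py - px * Py - 1 / √(px ^ 2 + py ^ 2 + pz ^ 2)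
    + (px ^ 2 + py ^ 2 + pz ^ 2 - 3 * px ^ 2) / 2

/-- Hill radius. -/
def ρ : ℝ := (3 : ℝ) ^ (-(1 / 3) : ℝ)

/-- Characteristic exponents of the linearized motion: `±lam`, `±ω i`, `±ν i`. -/
def lam : ℝ := √(2 * √7 + 1)
def ω : ℝ := √(2 * √7 - 1)
def ν : ℝ := 2

/-- Translation `p = L₁ + (x, y, z)`, `P = P(L₁) + (X, Y, Z)`. -/
def translation (ζ : Phase 3) : Phase 3 := Sum.elim ![ρ, 0, 0] ![0, ρ, 0] + ζ

def x : Poly := MvPolynomial.X (Sum.inl 0)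
def y : Poly := MvPolynomial.X (Sum.inl 1)
def z : Poly := MvPolynomial.X (Sum.inl 2)
def px : Poly := MvPolynomial.X (Sum.inr 0)
def py : Poly := MvPolynomial.X (Sum.inr 1)
def pz : Poly := MvPolynomial.X (Sum.inr 2)

/-- The solid harmonic `r ^ m * P_m (x / r)`, with `P_m` the Legendre polynomial and
`r² = x² + y² + z²`, through Bonnet's recursion
`(m + 2) P_{m+2} (u) = (2 m + 3) u P_{m+1} (u) - (m + 1) P_m (u)`. -/
def zonal : ℕ → Poly
  | 0 => 1
  | 1 => x
  | m + 2 => MvPolynomial.C (1 / ((m : ℝ) + 2)) *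
      (MvPolynomial.C (2 * (m : ℝ) + 3) * x * zonal (m + 1)
        - MvPolynomial.C ((m : ℝ) + 1) * (x ^ 2 + y ^ 2 + z ^ 2) * zonal m)

/-- The terms `H n` of the expansion `∑ εⁿ/n! H n` of the Hill Hamiltonian at the libration
point; `H n` is homogeneous of degree `n + 2`. -/
def H : ℕ → Poly
  | 0 => MvPolynomial.C (1 / 2) * (px ^ 2 + py ^ 2) - (x * py - px * y)
      + MvPolynomial.C 2 * (y ^ 2 - MvPolynomial.C 2 * x ^ 2)
      + MvPolynomial.C (1 / 2) * (pz ^ 2 + MvPolynomial.C 4 * z ^ 2)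
  | n + 1 => MvPolynomial.C
      (-((-1 : ℝ) ^ (n + 1) * ((n + 1).factorial : ℝ) / ρ * (1 / ρ ^ (n + 3)))) * zonal (n + 3)

/-! ### Linear decoupling -/

/-- The normalizing constants which make the decoupling matrix symplectic. -/
def σ : ℝ := √(2 * lam * (16 * lam ^ 2 - 72))
def τ : ℝ := √(16 * ω ^ 2 + 72)

/-- The decoupling matrix `A`, with `(x, y, z, X, Y, Z) = A (x₁, y₁, z₁, X₁, Y₁, Z₁)`; it does not
act on the pair `(z, Z)`. -/
def A : Matrix (Fin 3 ⊕ Fin 3) (Fin 3 ⊕ Fin 3) ℝ :=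
  Matrix.fromBlocks
    !![2 * lam / σ, 0, 0;
       (lam ^ 2 - 9) / σ, -(ω ^ 2 + 9) / τ, 0;
       0, 0, 1]
    !![-2 * lam / σ, 2 / τ, 0;
       (lam ^ 2 - 9) / σ, 0, 0;
       0, 0, 0]
    !![(lam ^ 2 + 9) / σ, (9 - ω ^ 2) / τ, 0;
       lam * (lam ^ 2 - 7) / σ, 0, 0;
       0, 0, 0]
    !![(lam ^ 2 + 9) / σ, 0, 0;
       lam * (7 - lam ^ 2) / σ, -(ω ^ 2 + 7) / τ, 0;
       0, 0, 1]

/-- The linear decoupling as a map of phase space. -/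
def decoupling (ζ : Phase 3) : Phase 3 := A.mulVec ζ

/-- The terms `K n = H n ∘ A` of the Hamiltonian in the decoupled variables. -/
def K (n : ℕ) : Poly :=
  MvPolynomial.bind₁ (fun i => ∑ j, MvPolynomial.C (A i j) * MvPolynomial.X j) (H n)

/-! ### Center manifold -/

/-- `∑ εⁿ/n! N n` is the normal form up to the second order of `∑ εⁿ/n! K n` by the Lie transform
generated by `W`: `N` contains only monomials `x ^ m * X ^ m * (…)`, and `W` contains only monomials
with different exponents of `x` and `X` (those which have to be removed). -/
structure IsCenterNormalForm (W N : ℕ → Poly) : Prop where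
  generator : ∀ n, 1 ≤ n → n ≤ 2 → ∀ m ∈ (W n).support, m (Sum.inl 0) ≠ m (Sum.inr 0)
  transformed : ∀ n ≤ 2, N n = lieTransform polyPoisson W K n
  normal : ∀ n ≤ 2, ∀ m ∈ (N n).support, m (Sum.inl 0) = m (Sum.inr 0)

/-- The point of the center manifold `x₂ = X₂ = 0` with coordinates `(y₂, z₂, Y₂, Z₂)`. -/
def centerPoint (v : Phase 2) : Phase 3 :=
  Sum.elim ![0, v (Sum.inl 0), v (Sum.inl 1)] ![0, v (Sum.inr 0), v (Sum.inr 1)]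

/-- Center manifold Hamiltonian `C n (y₂, z₂, Y₂, Z₂)`. -/
def centerHam (N : ℕ → Poly) (n : ℕ) (v : Phase 2) : ℝ := MvPolynomial.eval (centerPoint v) (N n)

/-! ### Detuning and Lissajous variables -/

/-- Detuning parameter. -/
def δ : ℝ := 1 - (ν / ω) ^ 2

/-- The center manifold Hamiltonian with the detuning term `ω² δ z₂² / 2` moved from the zeroth
order to the first order. -/
def detunedHam (N : ℕ → Poly) : ℕ → Phase 2 → ℝ
  | 0 => fun v => centerHam N 0 v + ω ^ 2 * δ * v (Sum.inl 1) ^ 2 / 2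
  | 1 => fun v => centerHam N 1 v - ω ^ 2 * δ * v (Sum.inl 1) ^ 2 / 2
  | n + 2 => centerHam N (n + 2)

/-- State functions of the Lissajous variables. -/
def s (L G : ℝ) : ℝ := √((L + G) / (2 * ω))
def d (L G : ℝ) : ℝ := √((L - G) / (2 * ω))

/-- The Lissajous transformation `(ℓ, g, L, G) ↦ (y₂, z₂, Y₂, Z₂)`. -/
def lissajous (v : Phase 2) : Phase 2 :=
  let ℓ := v (Sum.inl 0); let g := v (Sum.inl 1); let L := v (Sum.inr 0); let G := v (Sum.inr 1)
  Sum.elim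
    ![s L G * cos (g + ℓ) - d L G * cos (g - ℓ),
      s L G * sin (g + ℓ) - d L G * sin (g - ℓ)]
    ![-ω * (s L G * sin (g + ℓ) + d L G * sin (g - ℓ)),
      ω * (s L G * cos (g + ℓ) + d L G * cos (g - ℓ))]

/-- Domain of the Lissajous variables `(ℓ, g, L, G)`. -/
def lissajousDomain : Set (Phase 2) := {v | |v (Sum.inr 1)| < v (Sum.inr 0)}

/-- The Hamiltonian in Lissajous variables. -/
def lissajousHam (N : ℕ → Poly) (n : ℕ) (v : Phase 2) : ℝ := detunedHam N n (lissajous v)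

/-! ### Elimination of the elliptic anomaly -/

/-- `∑ εⁿ/n! B n` is obtained up to the second order from `∑ εⁿ/n! F n` by averaging over the
elliptic anomaly `ℓ`: it does not depend on `ℓ`, and it is the Lie transform with a smooth
generating function `V` that is periodic in `ℓ` with zero mean. -/
structure IsAveraged (F V B : ℕ → Phase 2 → ℝ) : Prop where
  smooth : ∀ n, 1 ≤ n → n ≤ 2 → ContDiffOn ℝ (⊤ : ℕ∞) (V n) lissajousDomain
  periodic : ∀ n, 1 ≤ n → n ≤ 2 → ∀ v ∈ lissajousDomain,
    V n (Function.update v (Sum.inl 0) (v (Sum.inl 0) + 2 * π)) = V n v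
  mean_zero : ∀ n, 1 ≤ n → n ≤ 2 → ∀ v ∈ lissajousDomain,
    ∫ t in (0 : ℝ)..(2 * π), V n (Function.update v (Sum.inl 0) t) = 0
  transformed : ∀ n ≤ 2, ∀ v ∈ lissajousDomain, B n v = lieTransform poisson V F n v
  averaged : ∀ n ≤ 2, ∀ v ∈ lissajousDomain, ∀ t : ℝ, B n (Function.update v (Sum.inl 0) t) = B n v

/-! ### The reduced Hamiltonian -/

def k₀ : ℝ := 1 / 6733104 * (ω ^ 2 + 2) * ρ
def k₁ : ℝ := 1 / 16 * (6829135 - 609646 * ω ^ 2) * k₀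
def k₂ : ℝ := (126184 - 9583 * ω ^ 2) * k₀
def k₃ : ℝ := -(3 / 4) * (439957 - 103954 * ω ^ 2) * k₀
def k₄ : ℝ := 3 / 4 * (7293079 - 1280862 * ω ^ 2) * k₀

def B₀ (L : ℝ) : ℝ := ω * L

def B₁ (g L G : ℝ) : ℝ := -(1 / 4) * δ * ω * (L + 2 * ω * d L G * s L G * cos (2 * g))

def B₂ (g L G : ℝ) : ℝ :=
  2 * (δ / 4 * B₁ g L G - k₁ * L ^ 2 + k₂ * L * ω * s L G * d L G * cos (2 * g)
    - k₃ * ω ^ 2 * s L G ^ 2 * d L G ^ 2 * cos (4 * g) + k₄ / 4 * G ^ 2)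

/-- Hopf variables. -/
def I₁ (g L G : ℝ) : ℝ := ω * s L G * d L G * cos (2 * g)
def I₂ (g L G : ℝ) : ℝ := ω * s L G * d L G * sin (2 * g)
def I₃ (G : ℝ) : ℝ := G / 2

def δstar : ℝ := δ / 2 * (1 + δ / 4)

/-- The reduced Hamiltonian in Hopf variables. -/
def hopfHam (L a b c : ℝ) : ℝ :=
  ω * (1 - δstar / 2) * L - k₁ * L ^ 2 + (k₂ * L - ω * δstar) * a + k₃ * (b ^ 2 - a ^ 2)
    + k₄ * c ^ 2

end Hill

end

noncomputable section

namespace Hill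

/-! ### Derivatives and brackets -/

/-! The remainder estimates rest on one fact: along an orbit of the generating function,
differentiation in `ε` is the Poisson bracket with it. Differentiating the truncated series
therefore reproduces the entries of Deprit's triangle, and integration from `0` turns `O(ε²)` into
`O(ε³)` (`IsLieOrbit.isBigO_truncated`). The orbits come from Picard–Lindelöf (`exists_isLieOrbit`).
The expansion of the Hill Hamiltonian is an algebraic identity for the square of the Legendre sum
(`isBigO_inv_sqrt`).

The center normal form exists because `{K₀, ·}` is diagonalizable over `ℂ`, with eigenvalues `-λe +
iμ`, where `e` is the difference of the exponents of `x` and `X`. For `e ≠ 0` such an eigenvalue is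
nonzero, so exactly the unwanted monomials can be removed (`exists_adK_eq`). The restriction to the
center manifold is the same for every normal form: the generating function enters there only through
its derivatives in the saddle directions. These satisfy an equation with a unique solution, since
`{K₀, ·}` generates a bounded flow on the center manifold and has no nonzero real eigenvalue there
(`eval_centerPoint_eq_zero_of_adK`). An explicit solution then gives the quartic terms
(`centerHam_two`).

After detuning, the zeroth order in Lissajous variables is `ωL`, so the bracket with it is `∓ω
∂/∂ℓ`. The homological equations are solved by explicit polynomials in the Cartesian variables,
carried over by the canonical map. Periodicity and zero mean make the solution unique
(`homological_unique`). The averages are polynomials in the two oscillator energies and the angular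
momentum, which are functions of `L`, `G` and `I₁` (`pull_energy`). Most coefficient identities are
polynomial identities modulo the quadratic relations for `λ`, `ω`, `√7`, `σ⁻¹`, `τ⁻¹` and the
relation `ρ³ = 1/3`. -/

theorem fderiv_eq_sum_partialD {n : ℕ} (f : Phase n → ℝ) (ζ u : Phase n) :
    fderiv ℝ f ζ u = ∑ v, u v * partialD f v ζ := by
  conv_lhs => rw [pi_eq_sum_univ' u]
  simp [partialD, map_sum]

theorem fderiv_hamField {n : ℕ} (f g : Phase n → ℝ) (ζ : Phase n) :
    fderiv ℝ f ζ (hamField g ζ) = poisson f g ζ := by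
  rw [fderiv_eq_sum_partialD, Fintype.sum_sum_type, poisson, ← Finset.sum_add_distrib]
  refine Finset.sum_congr rfl fun i _ => ?_
  simp only [hamField, Sum.elim_inl, Sum.elim_inr]
  ring

theorem poisson_eq_sub {n : ℕ} (f g : Phase n → ℝ) (ζ : Phase n) :
    poisson f g ζ = ∑ i, partialD f (Sum.inl i) ζ * partialD g (Sum.inr i) ζ
      - ∑ i, partialD f (Sum.inr i) ζ * partialD g (Sum.inl i) ζ := by
  rw [poisson, Finset.sum_sub_distrib]

theorem poisson_antisymm {n : ℕ} (f g : Phase n → ℝ) (ζ : Phase n) :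
    poisson f g ζ = -poisson g f ζ := by
  rw [poisson, poisson, ← Finset.sum_neg_distrib]
  exact Finset.sum_congr rfl fun i _ => by ring

theorem partialD_congr {n : ℕ} {f g : Phase n → ℝ} {ζ : Phase n} (h : f =ᶠ[𝓝 ζ] g)
    (v : Fin n ⊕ Fin n) : partialD f v ζ = partialD g v ζ := by
  rw [partialD, partialD, h.fderiv_eq]

theorem poisson_congr {n : ℕ} {f g f' g' : Phase n → ℝ} {ζ : Phase n} (hf : f =ᶠ[𝓝 ζ] f')
    (hg : g =ᶠ[𝓝 ζ] g') : poisson f g ζ = poisson f' g' ζ := by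
  simp only [poisson, partialD_congr hf, partialD_congr hg]

theorem poisson_add_right {n : ℕ} (f : Phase n → ℝ) {g h : Phase n → ℝ} {ζ : Phase n}
    (hg : DifferentiableAt ℝ g ζ) (hh : DifferentiableAt ℝ h ζ) :
    poisson f (fun z => g z + h z) ζ = poisson f g ζ + poisson f h ζ := by
  simp only [poisson, partialD, fderiv_fun_add hg hh, add_apply,
    ← Finset.sum_add_distrib]
  exact Finset.sum_congr rfl fun i _ => by ring

theorem poisson_const_mul_right {n : ℕ} (f : Phase n → ℝ) (c : ℝ) {g : Phase n → ℝ} {ζ : Phase n}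
    (hg : DifferentiableAt ℝ g ζ) :
    poisson f (fun z => c * g z) ζ = c * poisson f g ζ := by
  simp only [poisson, partialD, fderiv_const_mul hg, smul_apply, smul_eq_mul,
    Finset.mul_sum]
  exact Finset.sum_congr rfl fun i _ => by ring

/-- Derivative of a function along a coordinate line. -/
theorem hasDerivAt_coord_line {n : ℕ} {f : Phase n → ℝ} {ζ : Phase n} (v : Fin n ⊕ Fin n) (t : ℝ)
    (hf : DifferentiableAt ℝ f (Function.update ζ v t)) :
    HasDerivAt (fun τ => f (Function.update ζ v τ)) (partialD f v (Function.update ζ v t)) t :=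
  hf.hasFDerivAt.comp_hasDerivAt t (hasDerivAt_update ζ v t)

theorem contDiffOn_partialD {n : ℕ} {f : Phase n → ℝ} {D : Set (Phase n)} (hD : IsOpen D)
    (hf : ContDiffOn ℝ (⊤ : ℕ∞) f D) (v : Fin n ⊕ Fin n) :
    ContDiffOn ℝ (⊤ : ℕ∞) (partialD f v) D :=
  (hf.fderiv_of_isOpen hD (m := ((⊤ : ℕ∞) : WithTop ℕ∞)) (by simp)).clm_apply contDiffOn_const

theorem contDiffOn_poisson {n : ℕ} {f g : Phase n → ℝ} {D : Set (Phase n)} (hD : IsOpen D)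
    (hf : ContDiffOn ℝ (⊤ : ℕ∞) f D) (hg : ContDiffOn ℝ (⊤ : ℕ∞) g D) :
    ContDiffOn ℝ (⊤ : ℕ∞) (poisson f g) D := by
  unfold poisson
  exact ContDiffOn.sum fun i _ =>
    ((contDiffOn_partialD hD hf _).mul (contDiffOn_partialD hD hg _)).sub
      ((contDiffOn_partialD hD hf _).mul (contDiffOn_partialD hD hg _))

theorem contDiffOn_hamField {n : ℕ} {f : Phase n → ℝ} {D : Set (Phase n)} (hD : IsOpen D)
    (hf : ContDiffOn ℝ (⊤ : ℕ∞) f D) : ContDiffOn ℝ (⊤ : ℕ∞) (hamField f) D := by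
  rw [contDiffOn_pi]
  rintro (i | i)
  · exact contDiffOn_partialD hD hf _
  · exact (contDiffOn_partialD hD hf _).neg

theorem differentiableAt_of_contDiffOn {n : ℕ} {E : Type*} [NormedAddCommGroup E] [NormedSpace ℝ E]
    {f : Phase n → E} {D : Set (Phase n)} (hD : IsOpen D)
    (hf : ContDiffOn ℝ (⊤ : ℕ∞) f D) {ζ : Phase n} (hζ : ζ ∈ D) : DifferentiableAt ℝ f ζ :=
  (hf.contDiffAt (hD.mem_nhds hζ)).differentiableAt (by simp)

theorem hamField_add_mul {n : ℕ} {f g : Phase n → ℝ} {ζ : Phase n}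
    (hf : DifferentiableAt ℝ f ζ) (hg : DifferentiableAt ℝ g ζ) (c : ℝ) :
    hamField (fun z => f z + c * g z) ζ = hamField f ζ + c • hamField g ζ := by
  have : ∀ v, partialD (fun z => f z + c * g z) v ζ = partialD f v ζ + c * partialD g v ζ := by
    intro v
    simp [partialD, fderiv_fun_add hf (hg.const_mul c), fderiv_const_mul hg]
  ext (i | i)
  · simp [hamField, this]
  · simp [hamField, this]; ring

/-! ### Bracket of compositions with a canonical map -/

theorem partialD_comp {n : ℕ} {f : Phase n → ℝ} {Φ : Phase n → Phase n} {ζ : Phase n}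
    (hf : DifferentiableAt ℝ f (Φ ζ)) (hΦ : DifferentiableAt ℝ Φ ζ) (v : Fin n ⊕ Fin n) :
    partialD (fun z => f (Φ z)) v ζ
      = ∑ w, partialD (fun z => Φ z w) v ζ * partialD f w (Φ ζ) := by
  have h : fderiv ℝ (fun z => f (Φ z)) ζ = (fderiv ℝ f (Φ ζ)).comp (fderiv ℝ Φ ζ) :=
    fderiv_comp ζ hf hΦ
  rw [partialD, h, ContinuousLinearMap.comp_apply, fderiv_eq_sum_partialD]
  refine Finset.sum_congr rfl fun w _ => ?_
  have h2 : fderiv ℝ (fun z => Φ z w) ζ = (ContinuousLinearMap.proj w).comp (fderiv ℝ Φ ζ) :=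
    (((ContinuousLinearMap.proj w : Phase n →L[ℝ] ℝ).hasFDerivAt).comp ζ hΦ.hasFDerivAt).fderiv
  rw [partialD, partialD, h2]
  rfl

/-- By the chain rule the bracket is bilinear in the gradients of `f` and `g`, with the brackets of
the components of `Φ` as coefficients; canonicity makes these the standard symplectic matrix. -/
theorem poisson_comp {n : ℕ} {f g : Phase n → ℝ} {Φ : Phase n → Phase n} {D : Set (Phase n)}
    (hΦ : IsCanonicalOn Φ D) {ζ : Phase n} (hζ : ζ ∈ D)
    (hf : DifferentiableAt ℝ f (Φ ζ)) (hg : DifferentiableAt ℝ g (Φ ζ)) :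
    poisson (fun z => f (Φ z)) (fun z => g (Φ z)) ζ = poisson f g (Φ ζ) := by
  obtain ⟨hd, hc⟩ := hΦ ζ hζ
  have key : poisson (fun z => f (Φ z)) (fun z => g (Φ z)) ζ
      = ∑ w, ∑ u, partialD f w (Φ ζ) * partialD g u (Φ ζ)
          * poisson (fun z => Φ z w) (fun z => Φ z u) ζ := by
    simp only [poisson, partialD_comp hf hd, partialD_comp hg hd, Finset.sum_mul_sum,
      ← Finset.sum_sub_distrib]
    simp only [Finset.mul_sum]
    rw [Finset.sum_comm]
    refine Finset.sum_congr rfl fun w _ => ?_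
    rw [Finset.sum_comm]
    exact Finset.sum_congr rfl fun u _ => Finset.sum_congr rfl fun i _ => by ring
  rw [key]
  have hpq : ∀ i j, poisson (fun z => Φ z (Sum.inr i)) (fun z => Φ z (Sum.inl j)) ζ
      = if i = j then -1 else 0 := by
    intro i j
    rw [poisson_antisymm, (hc j i).2.2]
    split_ifs with h1 h2 h2 <;> simp_all
  have hqq := fun i j => (hc i j).1
  have hpp := fun i j => (hc i j).2.1
  have hqp := fun i j => (hc i j).2.2
  simp only [Fintype.sum_sum_type, hqq, hpp, hqp, hpq]
  rw [poisson_eq_sub]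
  simp [sub_eq_add_neg]

/-! ### The Lie transform along orbits of the generating function -/

/-- Mean value inequality on the closed ball of radius `‖ε‖`: integration from a zero at the origin
gains one order. -/
theorem isBigO_of_hasDerivAt {h h' : ℝ → ℝ} {k : ℕ} (h0 : h 0 = 0)
    (hd : ∀ᶠ ε in 𝓝 (0 : ℝ), HasDerivAt h (h' ε) ε) (hO : h' =O[𝓝 0] fun ε => ε ^ k) :
    h =O[𝓝 0] fun ε => ε ^ (k + 1) := by
  obtain ⟨C, hC⟩ := hO.bound
  obtain ⟨r, hr, hball⟩ := Metric.eventually_nhds_iff_ball.1 (hd.and hC)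
  refine IsBigO.of_bound C ?_
  filter_upwards [Metric.ball_mem_nhds (0 : ℝ) hr] with ε hε
  have hsub : Metric.closedBall (0 : ℝ) ‖ε‖ ⊆ Metric.ball 0 r :=
    Metric.closedBall_subset_ball (by simpa using hε)
  have hC0 : 0 ≤ C * ‖ε‖ ^ k := by
    have := (hball ε hε).2
    rw [norm_pow] at this
    exact (norm_nonneg _).trans this
  have := (convex_closedBall (0 : ℝ) ‖ε‖).norm_image_sub_le_of_norm_hasDerivWithin_le
    (f := h) (f' := h') (C := C * ‖ε‖ ^ k) (x := 0) (y := ε)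
    (fun t ht => (hball t (hsub ht)).1.hasDerivWithinAt) (fun t ht => ?_) (by simp) (by simp)
  · rw [h0, sub_zero, sub_zero] at this
    rw [norm_pow, pow_succ, ← mul_assoc]
    exact this
  · have h1 := (hball t (hsub ht)).2
    rw [norm_pow] at h1
    have ht' : ‖t‖ ≤ ‖ε‖ := by simpa using ht
    rcases eq_or_ne k 0 with rfl | hk
    · simpa using h1
    rcases le_or_gt 0 C with hC' | hC'
    · exact h1.trans (by gcongr)
    -- The constant of the Landau bound may be negative; the bound then forces `‖t‖ ^ k` to vanish.
    · have h2 : ‖t‖ ^ k = 0 := by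
        have : 0 ≤ ‖t‖ ^ k := by positivity
        nlinarith [norm_nonneg (h' t)]
      rw [h2, mul_zero] at h1
      exact h1.trans hC0

theorem IsLieOrbit.differentiableAt {n : ℕ} {W : ℕ → Phase n → ℝ} {ζ : Phase n} {γ : ℝ → Phase n}
    (h : IsLieOrbit W ζ γ) : DifferentiableAt ℝ γ 0 :=
  h.2.self_of_nhds.differentiableAt

/-- The quantifier over `f` stands inside the filter, so that one neighbourhood of `0` serves all
terms of the Hamiltonian at once. -/
theorem IsLieOrbit.hasDerivAt_comp {n : ℕ} {W : ℕ → Phase n → ℝ} {ζ : Phase n} {γ : ℝ → Phase n}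
    {D : Set (Phase n)} (hD : IsOpen D) (hζ : ζ ∈ D)
    (hW1 : ContDiffOn ℝ (⊤ : ℕ∞) (W 1) D) (hW2 : ContDiffOn ℝ (⊤ : ℕ∞) (W 2) D)
    (h : IsLieOrbit W ζ γ) :
    ∀ᶠ ε in 𝓝 (0 : ℝ), ∀ f : Phase n → ℝ, ContDiffOn ℝ (⊤ : ℕ∞) f D →
      HasDerivAt (fun t => f (γ t)) (poisson f (W 1) (γ ε) + ε * poisson f (W 2) (γ ε)) ε := by
  have hcont := h.differentiableAt.continuousAt
  have hmem : ∀ᶠ ε in 𝓝 (0 : ℝ), γ ε ∈ D := hcont (hD.mem_nhds (by rwa [h.1]))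
  filter_upwards [hmem, h.2] with ε hε hγ f hf
  have h1 := (differentiableAt_of_contDiffOn hD hf hε).hasFDerivAt.comp_hasDerivAt ε hγ
  have d2 := differentiableAt_of_contDiffOn hD hW2 hε
  rw [fderiv_hamField, poisson_add_right f (differentiableAt_of_contDiffOn hD hW1 hε)
    (d2.const_mul ε), poisson_const_mul_right f ε d2] at h1
  exact h1

theorem truncated_eq (a : ℕ → ℝ) (ε : ℝ) : truncated a ε = a 0 + ε * a 1 + ε ^ 2 / 2 * a 2 := by
  simp [truncated, Finset.sum_range_succ, Nat.factorial]

theorem lieTransform_zero {M : Type*} [AddCommGroup M] (br : M → M → M) (W F : ℕ → M) :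
    lieTransform br W F 0 = F 0 := rfl

theorem lieTransform_one {M : Type*} [AddCommGroup M] (br : M → M → M) (W F : ℕ → M) :
    lieTransform br W F 1 = F 1 + br (F 0) (W 1) := by
  simp [lieTransform, depritTriangle]

theorem lieTransform_two {M : Type*} [AddCommGroup M] (br : M → M → M) (W F : ℕ → M) :
    lieTransform br W F 2 = F 2 + (br (F 1) (W 1) + br (F 0) (W 2))
      + br (F 1 + br (F 0) (W 1)) (W 1) := by
  simp [lieTransform, depritTriangle, Finset.sum_range_succ]

/-- Along the orbit the truncated series has derivative `T + ε S + O(ε²)`, with `T` and `S` the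
entries of the second row of Deprit's triangle. The transformed series has derivative `T(ζ) + ε (S +
{T, W₁})(ζ)`. The two differ by `O(ε²)`, because `T` along the orbit agrees with `T(ζ) + ε {T,
W₁}(ζ)` to that order. -/
theorem IsLieOrbit.isBigO_truncated {n : ℕ} {W F : ℕ → Phase n → ℝ} {ζ : Phase n}
    {γ : ℝ → Phase n} {D : Set (Phase n)} (hD : IsOpen D) (hζ : ζ ∈ D)
    (hW1 : ContDiffOn ℝ (⊤ : ℕ∞) (W 1) D) (hW2 : ContDiffOn ℝ (⊤ : ℕ∞) (W 2) D)
    (hF : ∀ m ≤ 2, ContDiffOn ℝ (⊤ : ℕ∞) (F m) D) (h : IsLieOrbit W ζ γ) :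
    (fun ε : ℝ => truncated (fun m => F m (γ ε)) ε
      - truncated (fun m => lieTransform poisson W F m ζ) ε) =O[𝓝 0] fun ε : ℝ => ε ^ 3 := by
  have hF0 := hF 0 (by norm_num)
  have hF1 := hF 1 (by norm_num)
  have hF2 := hF 2 (by norm_num)
  have hder := h.hasDerivAt_comp hD hζ hW1 hW2
  have hlin : ∀ f : Phase n → ℝ, ContDiffOn ℝ (⊤ : ℕ∞) f D →
      (fun ε => f (γ ε) - f ζ) =O[𝓝 0] fun ε : ℝ => ε := by
    intro f hf
    have := (hder.self_of_nhds f hf).differentiableAt.isBigO_sub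
    simpa [h.1] using this
  have hbd : ∀ f : Phase n → ℝ, ContDiffOn ℝ (⊤ : ℕ∞) f D →
      (fun ε => f (γ ε)) =O[𝓝 0] fun _ : ℝ => (1 : ℝ) := by
    intro f hf
    exact (hder.self_of_nhds f hf).differentiableAt.continuousAt.isBigO_one ℝ
  have hid : (fun ε : ℝ => ε) =O[𝓝 0] fun _ : ℝ => (1 : ℝ) :=
    (continuousAt_id (x := (0 : ℝ))).isBigO_one ℝ
  set T := F 1 + poisson (F 0) (W 1) with hT
  have hTs : ContDiffOn ℝ (⊤ : ℕ∞) T D := hF1.add (contDiffOn_poisson hD hF0 hW1)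
  set S := F 2 + (poisson (F 1) (W 1) + poisson (F 0) (W 2)) with hS
  have hSs : ContDiffOn ℝ (⊤ : ℕ∞) S D :=
    hF2.add ((contDiffOn_poisson hD hF1 hW1).add (contDiffOn_poisson hD hF0 hW2))
  have hTW := contDiffOn_poisson hD hTs hW1
  have hT2 : (fun ε => T (γ ε) - T ζ - ε * poisson T (W 1) ζ) =O[𝓝 0] fun ε : ℝ => ε ^ (1 + 1) := by
    refine isBigO_of_hasDerivAt (h' := fun ε => poisson T (W 1) (γ ε) + ε * poisson T (W 2) (γ ε)
      - 1 * poisson T (W 1) ζ) (by simp [h.1]) ?_ ?_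
    · filter_upwards [hder] with ε hε
      exact ((hε T hTs).sub_const _).sub ((hasDerivAt_id ε).mul_const _)
    · have h1 := hlin _ hTW
      have h2 := (isBigO_refl (fun ε : ℝ => ε) (𝓝 0)).mul
        (hbd _ (contDiffOn_poisson hD hTs hW2))
      refine ((h1.add (by simpa using h2)).congr_left ?_).congr_right (by simp)
      intro ε; ring
  have hR : (fun ε => poisson (F 1) (W 2) (γ ε) + 1 / 2 * poisson (F 2) (W 1) (γ ε)
      + ε * (1 / 2 * poisson (F 2) (W 2) (γ ε))) =O[𝓝 0] fun _ : ℝ => (1 : ℝ) := by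
    have h3 := hid.mul ((hbd _ (contDiffOn_poisson hD hF2 hW2)).const_mul_left (1 / 2))
    simp only [mul_one] at h3
    exact ((hbd _ (contDiffOn_poisson hD hF1 hW2)).add
      ((hbd _ (contDiffOn_poisson hD hF2 hW1)).const_mul_left _)).add h3
  simp only [truncated_eq, lieTransform_zero, lieTransform_one, lieTransform_two]
  refine isBigO_of_hasDerivAt (k := 2) (h' := fun ε => (T (γ ε) - T ζ - ε * poisson T (W 1) ζ)
    + ε * (S (γ ε) - S ζ) + ε ^ 2 * (poisson (F 1) (W 2) (γ ε) + 1 / 2 * poisson (F 2) (W 1) (γ ε)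
      + ε * (1 / 2 * poisson (F 2) (W 2) (γ ε)))) (by simp [h.1]) ?_ ?_
  · filter_upwards [hder] with ε hε
    have e0 := hε _ hF0
    have e1 := (hasDerivAt_id ε).mul (hε _ hF1)
    have e2 := (((hasDerivAt_id ε).pow 2).div_const 2).mul (hε _ hF2)
    have e3 := ((hasDerivAt_id ε).mul_const (T ζ)).const_add (F 0 ζ)
    have e4 := (((hasDerivAt_id ε).pow 2).div_const 2).mul_const (S ζ + poisson T (W 1) ζ)
    refine (((e0.add e1).add e2).sub (e3.add e4)).congr_deriv ?_
    simp only [hT, hS, id, Pi.add_apply, Pi.pow_apply]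
    push_cast
    ring
  · refine (hT2.add ?_).add ?_
    · exact ((isBigO_refl (fun ε : ℝ => ε) (𝓝 0)).mul (hlin _ hSs)).congr_right
        fun ε => by ring
    · simpa using (isBigO_refl (fun ε : ℝ => ε ^ 2) (𝓝 0)).mul hR

/-- Picard–Lindelöf for the autonomous system obtained by adjoining `ε` as an additional variable
with derivative `1`. -/
theorem exists_isLieOrbit {n : ℕ} {W : ℕ → Phase n → ℝ} {ζ : Phase n} {D : Set (Phase n)}
    (hD : IsOpen D) (hζ : ζ ∈ D)
    (hW1 : ContDiffOn ℝ (⊤ : ℕ∞) (W 1) D) (hW2 : ContDiffOn ℝ (⊤ : ℕ∞) (W 2) D) :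
    ∃ γ : ℝ → Phase n, IsLieOrbit W ζ γ := by
  set v : Phase n × ℝ → Phase n × ℝ :=
    fun p => (hamField (W 1) p.1 + p.2 • hamField (W 2) p.1, 1) with hv
  have hc : ContDiffAt ℝ 1 v (ζ, 0) := by
    have hW : ∀ f : Phase n → ℝ, ContDiffOn ℝ (⊤ : ℕ∞) f D →
        ContDiffAt ℝ 1 (fun p : Phase n × ℝ => hamField f p.1) (ζ, 0) := by
      intro f hf
      have h1 : ContDiffAt ℝ 1 (hamField f) ζ :=
        ((contDiffOn_hamField hD hf).contDiffAt (hD.mem_nhds hζ)).of_le (by simp)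
      exact ContDiffAt.comp (x := ((ζ, 0) : Phase n × ℝ)) (g := hamField f) (f := Prod.fst) h1 contDiffAt_fst
    exact ((hW _ hW1).add (contDiffAt_snd.smul (hW _ hW2))).prodMk contDiffAt_const
  obtain ⟨α, hα0, e, he, hα⟩ := hc.exists_forall_mem_closedBall_exists_eq_forall_mem_Ioo_hasDerivAt₀ 0
  have hI : Set.Ioo (0 - e) (0 + e) ∈ 𝓝 (0 : ℝ) := Ioo_mem_nhds (by linarith) (by linarith)
  -- The adjoined variable starts at `0` and has derivative `1`, hence it is the time itself.
  have hsnd : ∀ t ∈ Set.Ioo (0 - e) (0 + e), (α t).2 = t := by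
    have hd : ∀ t ∈ Set.Ioo (0 - e) (0 + e), HasDerivAt (fun t => (α t).2 - t) 0 t := by
      intro t ht
      exact ((hasFDerivAt_snd.comp_hasDerivAt t (hα t ht)).sub (hasDerivAt_id t)).congr_deriv
        (by simp [hv])
    intro t ht
    have := isOpen_Ioo.is_const_of_deriv_eq_zero isPreconnected_Ioo
      (fun t ht => (hd t ht).differentiableAt.differentiableWithinAt)
      (fun t ht => (hd t ht).deriv) ht (mem_of_mem_nhds hI)
    simp only [hα0] at this
    linarith
  have hfst : ∀ t ∈ Set.Ioo (0 - e) (0 + e),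
      HasDerivAt (fun t => (α t).1) (hamField (W 1) (α t).1 + t • hamField (W 2) (α t).1) t := by
    intro t ht
    refine (hasFDerivAt_fst.comp_hasDerivAt t (hα t ht)).congr_deriv ?_
    simp [hv, hsnd t ht]
  have h0 : (α 0).1 = ζ := by rw [hα0]
  have hmem : ∀ᶠ t in 𝓝 (0 : ℝ), (α t).1 ∈ D :=
    (hfst 0 (mem_of_mem_nhds hI)).continuousAt (hD.mem_nhds (by rwa [h0]))
  refine ⟨fun t => (α t).1, h0, ?_⟩
  filter_upwards [hI, hmem] with t ht htD
  rw [hamField_add_mul (differentiableAt_of_contDiffOn hD hW1 htD)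
    (differentiableAt_of_contDiffOn hD hW2 htD)]
  exact hfst t ht

/-! ### Polynomial functions on phase space -/

theorem hasFDerivAt_eval {ι : Type*} [Fintype ι] (p : MvPolynomial ι ℝ) (v : ι → ℝ) :
    HasFDerivAt (fun u : ι → ℝ => MvPolynomial.eval u p)
      (∑ i, MvPolynomial.eval v (MvPolynomial.pderiv i p) •
        (ContinuousLinearMap.proj i : (ι → ℝ) →L[ℝ] ℝ)) v := by
  classical
  induction p using MvPolynomial.induction_on with
  | C a => simpa using hasFDerivAt_const a v
  | add p q hp hq =>
    simp only [map_add, add_smul, Finset.sum_add_distrib]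
    exact hp.add hq
  | mul_X p j hp =>
    have h := hp.mul (ContinuousLinearMap.proj (R := ℝ) (φ := fun _ : ι => ℝ) j).hasFDerivAt
    simp only [map_mul, MvPolynomial.eval_X]
    refine h.congr_fderiv ?_
    ext u
    simp [MvPolynomial.pderiv_X, Pi.single_apply, Finset.sum_add_distrib, Finset.mul_sum,
      apply_ite, mul_comm, mul_add, mul_left_comm]

theorem contDiff_eval {ι : Type*} [Fintype ι] (p : MvPolynomial ι ℝ) {m : WithTop ℕ∞} :
    ContDiff ℝ m (fun u : ι → ℝ => MvPolynomial.eval u p) := by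
  induction p using MvPolynomial.induction_on with
  | C a => simpa using contDiff_const
  | add p q hp hq => simpa using hp.add hq
  | mul_X p j hp => simpa using hp.mul (contDiff_apply ℝ ℝ j)

theorem differentiableAt_eval {ι : Type*} [Fintype ι] (p : MvPolynomial ι ℝ) (v : ι → ℝ) :
    DifferentiableAt ℝ (fun u : ι → ℝ => MvPolynomial.eval u p) v :=
  (hasFDerivAt_eval p v).differentiableAt

theorem partialD_eval {n : ℕ} (p : MvPolynomial (Fin n ⊕ Fin n) ℝ) (i : Fin n ⊕ Fin n)
    (v : Phase n) :
    partialD (fun u => MvPolynomial.eval u p) i v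
      = MvPolynomial.eval v (MvPolynomial.pderiv i p) := by
  rw [partialD, (hasFDerivAt_eval p v).fderiv, sum_apply]
  rw [Finset.sum_eq_single i]
  · simp
  · intro j _ hj
    simp [hj]
  · simp

/-- The Poisson bracket of polynomials in any number of degrees of freedom. -/
def mvPoisson {n : ℕ} (f g : MvPolynomial (Fin n ⊕ Fin n) ℝ) : MvPolynomial (Fin n ⊕ Fin n) ℝ :=
  ∑ i, (MvPolynomial.pderiv (Sum.inl i) f * MvPolynomial.pderiv (Sum.inr i) g
      - MvPolynomial.pderiv (Sum.inr i) f * MvPolynomial.pderiv (Sum.inl i) g)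

theorem poisson_eval {n : ℕ} (f g : MvPolynomial (Fin n ⊕ Fin n) ℝ) :
    poisson (fun u => MvPolynomial.eval u f) (fun u => MvPolynomial.eval u g)
      = fun u => MvPolynomial.eval u (mvPoisson f g) := by
  ext v
  simp [poisson, partialD_eval, mvPoisson]

/-! ### The constants -/

theorem ρ_pos : 0 < ρ := by unfold ρ; positivity

theorem ρ_pow_three : ρ ^ 3 = 1 / 3 := by
  rw [ρ, ← Real.rpow_natCast, ← Real.rpow_mul (by norm_num)]
  norm_num [Real.rpow_neg_one]

theorem inv_ρ : ρ⁻¹ = 3 * ρ ^ 2 := by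
  have := ρ_pos
  field_simp
  linarith [ρ_pow_three]

theorem sqrt_seven_sq : √7 ^ 2 = 7 := Real.sq_sqrt (by norm_num)

theorem lt_sqrt_seven : (26457513 / 10000000 : ℝ) < √7 :=
  Real.lt_sqrt_of_sq_lt (by norm_num)

theorem sqrt_seven_lt : √7 < (26457514 / 10000000 : ℝ) := by
  rw [Real.sqrt_lt' (by norm_num)]
  norm_num

theorem lam_sq : lam ^ 2 = 2 * √7 + 1 := Real.sq_sqrt (by positivity)

theorem ω_sq : ω ^ 2 = 2 * √7 - 1 := Real.sq_sqrt (by linarith [lt_sqrt_seven])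

theorem lam_pos : 0 < lam := Real.sqrt_pos.2 (by positivity)

theorem ω_pos : 0 < ω := Real.sqrt_pos.2 (by linarith [lt_sqrt_seven])

theorem σ_sq : σ ^ 2 = 2 * lam * (16 * lam ^ 2 - 72) := by
  refine Real.sq_sqrt ?_
  rw [lam_sq]
  have := lam_pos
  have h2 : (0 : ℝ) ≤ 16 * (2 * √7 + 1) - 72 := by linarith [lt_sqrt_seven]
  positivity

theorem τ_sq : τ ^ 2 = 16 * ω ^ 2 + 72 := Real.sq_sqrt (by positivity)

theorem δ_eq : δ = (23 - 8 * √7) / 27 := by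
  have h := lt_sqrt_seven
  rw [δ, ν, div_pow, ω_sq]
  have h2 : (2 * √7 - 1) ≠ 0 := by linarith
  field_simp
  linarith [sqrt_seven_sq]

/-- A number `(a + b √7) ρ` with `b ≠ 0` is irrational, as its cube is not rational. -/
theorem irrational_mul_ρ {a b : ℚ} (hb : b ≠ 0) : Irrational ((a + b * √7) * ρ) := by
  rintro ⟨r, hr⟩
  have h7 : Irrational √7 := by
    simpa using (show Nat.Prime 7 by norm_num).irrational_sqrt
  have hcube : (r : ℝ) ^ 3 = ((a : ℝ) + b * √7) ^ 3 / 3 := by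
    rw [hr, mul_pow, ρ_pow_three]
    ring
  -- In the cube of `a + b √7` the coefficient of `√7` is `b (3a² + 7b²)`; as it is nonzero, a
  -- rational cube would make `√7` rational.
  have hpos : (0 : ℚ) < 3 * a ^ 2 + 7 * b ^ 2 := by positivity
  have hc : ((3 * a ^ 2 + 7 * b ^ 2) * b : ℚ) ≠ 0 := mul_ne_zero hpos.ne' hb
  refine h7 ⟨(3 * r ^ 3 - a ^ 3 - 21 * a * b ^ 2) / ((3 * a ^ 2 + 7 * b ^ 2) * b), ?_⟩
  have hc' : (((3 * a ^ 2 + 7 * b ^ 2) * b : ℚ) : ℝ) ≠ 0 := by exact_mod_cast hc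
  push_cast at hc' ⊢
  rw [div_eq_iff hc', hcube]
  linear_combination (3 * (a : ℝ) * b ^ 2 + b ^ 3 * √7) * sqrt_seven_sq

/-- The constants are brought to the form `(a + b √7) ρ` with rational `a`, `b`, to which the
irrationality criterion and the numerical bounds on `√7` apply. -/
theorem k₀_eq : k₀ = (1 / 6733104 + 2 / 6733104 * √7) * ρ := by
  rw [k₀, ω_sq]; ring

theorem k₁_eq : k₁ = (-9631307 / 107729664 + 13658270 / 107729664 * √7) * ρ := by
  rw [k₁, k₀_eq, ω_sq]
  linear_combination (-2438584 / 107729664 * ρ) * sqrt_seven_sq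

theorem k₂_eq : k₂ = (-132557 / 6733104 + 252368 / 6733104 * √7) * ρ := by
  rw [k₂, k₀_eq, ω_sq]
  linear_combination (-38332 / 6733104 * ρ) * sqrt_seven_sq

theorem k₃_eq : k₃ = (3 / 4) * ((2366801 - 879914 * √7) / 6733104) * ρ := by
  rw [k₃, k₀_eq, ω_sq]
  linear_combination (311862 / 6733104 * ρ) * sqrt_seven_sq

theorem k₄_eq : k₄ = (3 / 4) * ((-27290195 + 14586158 * √7) / 6733104) * ρ := by
  rw [k₄, k₀_eq, ω_sq]
  linear_combination (-3842586 / 6733104 * ρ) * sqrt_seven_sq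

theorem k_pos : 0 < k₀ ∧ 0 < k₁ ∧ 0 < k₂ ∧ 0 < k₃ ∧ 0 < k₄ := by
  have h1 := lt_sqrt_seven
  have h2 := sqrt_seven_lt
  have h3 := ρ_pos
  rw [k₀_eq, k₁_eq, k₂_eq, k₃_eq, k₄_eq]
  refine ⟨?_, ?_, ?_, ?_, ?_⟩ <;> refine mul_pos ?_ h3 <;> linarith

theorem k_irrational : Irrational k₀ ∧ Irrational k₁ ∧ Irrational k₂ ∧ Irrational k₃ ∧
    Irrational k₄ := by
  refine ⟨?_, ?_, ?_, ?_, ?_⟩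
  · have := irrational_mul_ρ (a := 1 / 6733104) (b := 2 / 6733104) (by norm_num)
    rw [k₀_eq]; push_cast at this; exact this
  · have := irrational_mul_ρ (a := -9631307 / 107729664) (b := 13658270 / 107729664) (by norm_num)
    rw [k₁_eq]; push_cast at this; exact this
  · have := irrational_mul_ρ (a := -132557 / 6733104) (b := 252368 / 6733104) (by norm_num)
    rw [k₂_eq]; push_cast at this; exact this
  · have := irrational_mul_ρ (a := 3 / 4 * (2366801 / 6733104)) (b := -(3 / 4) * (879914 / 6733104))
      (by norm_num)
    rw [k₃_eq]; push_cast at this; convert this using 1; ring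
  · have := irrational_mul_ρ (a := -(3 / 4) * (27290195 / 6733104))
      (b := 3 / 4 * (14586158 / 6733104)) (by norm_num)
    rw [k₄_eq]; push_cast at this; convert this using 1; ring

/-! ### Hopf variables -/

theorem s_sq {L G : ℝ} (h : |G| ≤ L) : s L G ^ 2 = (L + G) / (2 * ω) :=
  Real.sq_sqrt (div_nonneg (by linarith [neg_le_of_abs_le h]) (by linarith [ω_pos]))

theorem d_sq {L G : ℝ} (h : |G| ≤ L) : d L G ^ 2 = (L - G) / (2 * ω) :=
  Real.sq_sqrt (div_nonneg (by linarith [le_of_abs_le h]) (by linarith [ω_pos]))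

theorem ω_mul_s_mul_d_sq {L G : ℝ} (h : |G| ≤ L) :
    (ω * s L G * d L G) ^ 2 = (L ^ 2 - G ^ 2) / 4 := by
  rw [mul_pow, mul_pow, s_sq h, d_sq h]
  have := ω_pos
  field_simp
  ring

theorem hopf_sphere {g L G : ℝ} (h : |G| ≤ L) :
    I₁ g L G ^ 2 + I₂ g L G ^ 2 + I₃ G ^ 2 = L ^ 2 / 4 := by
  rw [I₁, I₂, I₃]
  linear_combination (ω * s L G * d L G) ^ 2 * Real.sin_sq_add_cos_sq (2 * g) + ω_mul_s_mul_d_sq h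

theorem B₂_eq {g L G : ℝ} :
    B₂ g L G = 2 * (δ / 4 * B₁ g L G - k₁ * L ^ 2 + k₂ * L * I₁ g L G
      - k₃ * (I₁ g L G ^ 2 - I₂ g L G ^ 2) + k₄ / 4 * G ^ 2) := by
  have : cos (4 * g) = cos (2 * g) ^ 2 - sin (2 * g) ^ 2 := by
    rw [← Real.cos_two_mul']; ring_nf
  rw [B₂, this, I₁, I₂]
  ring

theorem hopfHam_eq (g L G : ℝ) :
    B₀ L + B₁ g L G + B₂ g L G / 2 = hopfHam L (I₁ g L G) (I₂ g L G) (I₃ G) := by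
  rw [B₂_eq, B₀, B₁, hopfHam, δstar, I₃, I₁, I₂]
  ring

/-- Polar coordinates: `(I₁, I₂)` has radius `ω s d` and angle `2g`, so `G = 2c` and `g` is half the
argument of `a + ib`. The equation of the sphere makes the radii agree. -/
theorem exists_hopf {L a b c : ℝ} (hL : 0 ≤ L) (h : a ^ 2 + b ^ 2 + c ^ 2 = L ^ 2 / 4) :
    ∃ g G : ℝ, |G| ≤ L ∧ I₁ g L G = a ∧ I₂ g L G = b ∧ I₃ G = c := by
  have hG : |2 * c| ≤ L := abs_le_of_sq_le_sq (by nlinarith [sq_nonneg a, sq_nonneg b]) hL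
  have hr : ω * s L (2 * c) * d L (2 * c) = ‖(⟨a, b⟩ : ℂ)‖ := by
    have h0 : 0 ≤ ω * s L (2 * c) * d L (2 * c) :=
      mul_nonneg (mul_nonneg ω_pos.le (Real.sqrt_nonneg _)) (Real.sqrt_nonneg _)
    refine (sq_eq_sq₀ h0 (norm_nonneg _)).1 ?_
    rw [ω_mul_s_mul_d_sq hG, Complex.sq_norm, Complex.normSq_mk]
    linarith
  refine ⟨Complex.arg ⟨a, b⟩ / 2, 2 * c, hG, ?_, ?_, ?_⟩
  · rw [I₁, hr, mul_div_cancel₀ _ (by norm_num), Complex.norm_mul_cos_arg]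
  · rw [I₂, hr, mul_div_cancel₀ _ (by norm_num), Complex.norm_mul_sin_arg]
  · rw [I₃]; ring

/-! ### Translation to the libration point -/

theorem isCanonicalOn_translation : IsCanonicalOn translation Set.univ := by
  have hp : ∀ (w v : Fin 3 ⊕ Fin 3) (ζ : Phase 3),
      partialD (fun u => translation u w) v ζ = (Pi.single v 1 : Phase 3) w := by
    intro w v ζ
    have h : HasFDerivAt (fun u => translation u w)
        (ContinuousLinearMap.proj (R := ℝ) (φ := fun _ : Fin 3 ⊕ Fin 3 => ℝ) w) ζ :=
      (ContinuousLinearMap.proj (R := ℝ) (φ := fun _ : Fin 3 ⊕ Fin 3 => ℝ) w).hasFDerivAt.const_add _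
    rw [partialD, h.fderiv]
    rfl
  intro ζ _
  refine ⟨(differentiableAt_id).const_add _, fun i j => ?_⟩
  simp only [poisson, hp]
  fin_cases i <;> fin_cases j <;> simp [Pi.single_apply]

theorem eval_H_zero (ζ : Phase 3) :
    MvPolynomial.eval ζ (H 0) = 1 / 2 * (ζ (Sum.inr 0) ^ 2 + ζ (Sum.inr 1) ^ 2)
      - (ζ (Sum.inl 0) * ζ (Sum.inr 1) - ζ (Sum.inr 0) * ζ (Sum.inl 1))
      + 2 * (ζ (Sum.inl 1) ^ 2 - 2 * ζ (Sum.inl 0) ^ 2)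
      + 1 / 2 * (ζ (Sum.inr 2) ^ 2 + 4 * ζ (Sum.inl 2) ^ 2) := by
  simp [H, x, y, z, px, py, pz]

theorem eval_H_one (ζ : Phase 3) :
    MvPolynomial.eval ζ (H 1) = 9 * ρ ^ 2 * (ζ (Sum.inl 0) ^ 3
      - 3 / 2 * ζ (Sum.inl 0) * (ζ (Sum.inl 1) ^ 2 + ζ (Sum.inl 2) ^ 2)) := by
  have h : (1 / ρ * (1 / ρ ^ 3)) = 9 * ρ ^ 2 := by
    rw [ρ_pow_three, one_div, inv_ρ]; ring
  simp [H, zonal, x, y, z]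
  linear_combination (ζ (Sum.inl 0) ^ 3
      - 3 / 2 * ζ (Sum.inl 0) * (ζ (Sum.inl 1) ^ 2 + ζ (Sum.inl 2) ^ 2)) * h

theorem eval_H_two (ζ : Phase 3) :
    MvPolynomial.eval ζ (H 2) = -18 * ρ * (ζ (Sum.inl 0) ^ 4
      - 3 * ζ (Sum.inl 0) ^ 2 * (ζ (Sum.inl 1) ^ 2 + ζ (Sum.inl 2) ^ 2)
      + 3 / 8 * (ζ (Sum.inl 1) ^ 2 + ζ (Sum.inl 2) ^ 2) ^ 2) := by
  have h : (1 / ρ * (1 / ρ ^ 4)) = 9 * ρ := by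
    have : ρ⁻¹ ^ 5 = 9 * ρ := by
      rw [inv_ρ]
      linear_combination (243 * ρ ^ 7 + 81 * ρ ^ 4 + 27 * ρ) * ρ_pow_three
    rw [← this, one_div, one_div, ← inv_pow]; ring
  simp [H, zonal, x, y, z, Nat.factorial]
  linear_combination 2 * (ζ (Sum.inl 0) ^ 4
      - 3 * ζ (Sum.inl 0) ^ 2 * (ζ (Sum.inl 1) ^ 2 + ζ (Sum.inl 2) ^ 2)
      + 3 / 8 * (ζ (Sum.inl 1) ^ 2 + ζ (Sum.inl 2) ^ 2) ^ 2) * h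

/-- Legendre expansion of the inverse distance up to the fourth degree. -/
theorem legendre_sq_mul (t x w : ℝ) :
    (1 - t * x + t ^ 2 * (x ^ 2 - 1 / 2 * w) - t ^ 3 * (x ^ 3 - 3 / 2 * x * w)
        + t ^ 4 * (x ^ 4 - 3 * x ^ 2 * w + 3 / 8 * w ^ 2)) ^ 2 * (1 + 2 * t * x + t ^ 2 * (x ^ 2 + w))
      = 1 + t ^ 5 * ((15/4)*x*w^2 + (-10)*x^3*w + (2)*x^5 + (5/8)*t*w^3 + (-15/2)*t*x^2*w^2
        + (5)*t*x^4*w + (-15/8)*t^2*x*w^3 + (10)*t^2*x^3*w^2 + (-5)*t^2*x^5*w + (-15/64)*t^3*w^4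
        + (45/8)*t^3*x^2*w^3 + (-55/4)*t^3*x^4*w^2 + (5)*t^3*x^6*w + (45/32)*t^4*x*w^4
        + (-105/8)*t^4*x^3*w^3 + (75/4)*t^4*x^5*w^2 + (-5)*t^4*x^7*w + (9/64)*t^5*w^5
        + (-135/64)*t^5*x^2*w^4 + (15/2)*t^5*x^4*w^3 + (15/4)*t^5*x^6*w^2 + (-5)*t^5*x^8*w
        + t^5*x^10) := by
  ring

/-- With `P` the Legendre sum and `S` the root, `1/S - P = (1 - P²S²) / (S (1 + PS))`. The numerator
is divisible by `ε⁵` by `legendre_sq_mul`, and the denominator tends to `2`. -/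
theorem isBigO_inv_sqrt {x w : ℝ → ℝ} (hx : ContinuousAt x 0) (hw : ContinuousAt w 0) :
    (fun ε : ℝ => 1 / √(1 + 2 * ε * x ε + ε ^ 2 * (x ε ^ 2 + w ε))
      - (1 - ε * x ε + ε ^ 2 * (x ε ^ 2 - 1 / 2 * w ε) - ε ^ 3 * (x ε ^ 3 - 3 / 2 * x ε * w ε)
        + ε ^ 4 * (x ε ^ 4 - 3 * x ε ^ 2 * w ε + 3 / 8 * w ε ^ 2))) =O[𝓝 0] fun ε : ℝ => ε ^ 5 := by
  set P : ℝ → ℝ := fun ε => 1 - ε * x ε + ε ^ 2 * (x ε ^ 2 - 1 / 2 * w ε)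
    - ε ^ 3 * (x ε ^ 3 - 3 / 2 * x ε * w ε)
    + ε ^ 4 * (x ε ^ 4 - 3 * x ε ^ 2 * w ε + 3 / 8 * w ε ^ 2) with hP
  set S : ℝ → ℝ := fun ε => √(1 + 2 * ε * x ε + ε ^ 2 * (x ε ^ 2 + w ε)) with hS
  have hPc : ContinuousAt P 0 := by simp only [hP]; fun_prop
  have hSc : ContinuousAt S 0 := by simp only [hS]; fun_prop
  have hS0 : S 0 = 1 := by simp [hS]
  have hP0 : P 0 = 1 := by simp [hP]
  -- Only the continuity of the cofactor of `ε⁵` matters; its expression is supplied by unification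
  -- with the identity.
  obtain ⟨Q, hQc, hQ⟩ : ∃ Q : ℝ → ℝ, ContinuousAt Q 0 ∧ ∀ ε,
      P ε ^ 2 * (1 + 2 * ε * x ε + ε ^ 2 * (x ε ^ 2 + w ε)) = 1 + ε ^ 5 * Q ε :=
    ⟨_, by fun_prop, fun ε => legendre_sq_mul ε (x ε) (w ε)⟩
  have hden : ContinuousAt (fun ε => S ε * (1 + P ε * S ε)) 0 := by fun_prop
  have hden0 : S 0 * (1 + P 0 * S 0) ≠ 0 := by rw [hS0, hP0]; norm_num
  have hquot : (fun ε => -Q ε / (S ε * (1 + P ε * S ε))) =O[𝓝 0] fun _ : ℝ => (1 : ℝ) :=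
    (hQc.neg.div hden hden0).isBigO_one ℝ
  have hpos : ∀ᶠ ε in 𝓝 (0 : ℝ), 0 < S ε :=
    hSc.eventually (lt_mem_nhds (by rw [hS0]; norm_num))
  have hprod := (isBigO_refl (fun ε : ℝ => ε ^ 5) (𝓝 0)).mul hquot
  simp only [mul_one] at hprod
  refine hprod.congr' ?_ EventuallyEq.rfl
  filter_upwards [hpos, hden.eventually_ne hden0] with ε h1 h2
  have hS2 : S ε ^ 2 = 1 + 2 * ε * x ε + ε ^ 2 * (x ε ^ 2 + w ε) :=
    Real.sq_sqrt (Real.sqrt_pos.1 h1).le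
  have h3 : 1 + P ε * S ε ≠ 0 := right_ne_zero_of_mul h2
  have h4 := hQ ε
  rw [← hS2] at h4
  change ε ^ 5 * (-Q ε / (S ε * (1 + P ε * S ε))) = 1 / S ε - P ε
  generalize P ε = p at *
  have h5 : 1 / S ε - p = (1 - p ^ 2 * S ε ^ 2) / (S ε * (1 + p * S ε)) := by
    rw [eq_div_iff h2]
    field_simp
    ring
  rw [h5, h4]
  ring

/-- A moving point `γ ε` is allowed, since the expansion is needed along the orbits of the
generating function as well as at a fixed point. The factor `ρ` is taken out of the distance and
`1/ρ` is written as `3ρ²`, which leaves only powers of `ρ` to reduce by `ρ³ = 1/3`. -/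
theorem isBigO_hillHam {γ : ℝ → Phase 3} (hγ : ContinuousAt γ 0) :
    (fun ε : ℝ => hillHam (translation (ε • γ ε))
          - (-(9 / 2) * ρ ^ 2 + ε ^ 2 * truncated (fun n => MvPolynomial.eval (γ ε) (H n)) ε))
        =O[𝓝 0] fun ε : ℝ => ε ^ 5 := by
  have hc : ∀ i, ContinuousAt (fun ε => γ ε i) 0 := fun i => (continuousAt_pi.1 hγ) i
  have hρ := ρ_pos
  have h := isBigO_inv_sqrt (x := fun ε => 3 * ρ ^ 2 * γ ε (Sum.inl 0))
    (w := fun ε => (3 * ρ ^ 2) ^ 2 * (γ ε (Sum.inl 1) ^ 2 + γ ε (Sum.inl 2) ^ 2))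
    (by have := hc (Sum.inl 0); fun_prop)
    (by have h1 := hc (Sum.inl 1); have h2 := hc (Sum.inl 2); fun_prop)
  refine (h.const_mul_left (-(3 * ρ ^ 2))).congr_left fun ε => ?_
  have hsq : √((ρ + ε * γ ε (Sum.inl 0)) ^ 2 + (ε * γ ε (Sum.inl 1)) ^ 2
        + (ε * γ ε (Sum.inl 2)) ^ 2)
      = ρ * √(1 + 2 * ε * (3 * ρ ^ 2 * γ ε (Sum.inl 0)) + ε ^ 2 * ((3 * ρ ^ 2 * γ ε (Sum.inl 0)) ^ 2
        + (3 * ρ ^ 2) ^ 2 * (γ ε (Sum.inl 1) ^ 2 + γ ε (Sum.inl 2) ^ 2))) := by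
    rw [← Real.sqrt_sq hρ.le, ← Real.sqrt_mul (sq_nonneg _), Real.sqrt_sq hρ.le]
    congr 1
    linear_combination (-(6 * ε * γ ε (Sum.inl 0) * ρ) - ε ^ 2 * (9 * ρ ^ 3 + 3) *
      (γ ε (Sum.inl 0) ^ 2 + γ ε (Sum.inl 1) ^ 2 + γ ε (Sum.inl 2) ^ 2)) * ρ_pow_three
  have hill : hillHam (translation (ε • γ ε))
      = ((ε * γ ε (Sum.inr 0)) ^ 2 + (ρ + ε * γ ε (Sum.inr 1)) ^ 2 + (ε * γ ε (Sum.inr 2)) ^ 2) / 2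
        + ε * γ ε (Sum.inr 0) * (ε * γ ε (Sum.inl 1))
        - (ρ + ε * γ ε (Sum.inl 0)) * (ρ + ε * γ ε (Sum.inr 1))
        - 3 * ρ ^ 2 * (1 / √(1 + 2 * ε * (3 * ρ ^ 2 * γ ε (Sum.inl 0))
          + ε ^ 2 * ((3 * ρ ^ 2 * γ ε (Sum.inl 0)) ^ 2
            + (3 * ρ ^ 2) ^ 2 * (γ ε (Sum.inl 1) ^ 2 + γ ε (Sum.inl 2) ^ 2))))
        + ((ρ + ε * γ ε (Sum.inl 0)) ^ 2 + (ε * γ ε (Sum.inl 1)) ^ 2 + (ε * γ ε (Sum.inl 2)) ^ 2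
          - 3 * (ρ + ε * γ ε (Sum.inl 0)) ^ 2) / 2 := by
    rw [← inv_ρ, ← one_div ρ, div_mul_div_comm, one_mul, one_div ρ, inv_ρ, ← hsq]
    simp [hillHam, translation]
  rw [hill, truncated_eq, eval_H_zero, eval_H_one, eval_H_two]
  generalize 1 / √(1 + 2 * ε * (3 * ρ ^ 2 * γ ε (Sum.inl 0))
          + ε ^ 2 * ((3 * ρ ^ 2 * γ ε (Sum.inl 0)) ^ 2
            + (3 * ρ ^ 2) ^ 2 * (γ ε (Sum.inl 1) ^ 2 + γ ε (Sum.inl 2) ^ 2))) = q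
  generalize γ ε (Sum.inl 0) = x
  generalize γ ε (Sum.inl 1) = y
  generalize γ ε (Sum.inl 2) = z
  have h4 : ρ ^ 4 = ρ / 3 := by linear_combination ρ * ρ_pow_three
  have h6 : ρ ^ 6 = 1 / 9 := by linear_combination (ρ ^ 3 + 1 / 3) * ρ_pow_three
  have h8 : ρ ^ 8 = ρ ^ 2 / 9 := by linear_combination ρ ^ 2 * h6
  have h10 : ρ ^ 10 = ρ / 27 := by linear_combination ρ ^ 4 * h6 + h4 / 9
  ring_nf
  rw [h4, h6, h8, h10]
  ring

theorem differentiableAt_hillHam : DifferentiableAt ℝ hillHam (translation 0) := by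
  have h : (translation 0) (Sum.inl 0) ^ 2 + (translation 0) (Sum.inl 1) ^ 2
      + (translation 0) (Sum.inl 2) ^ 2 ≠ 0 := by
    have := ρ_pos
    simp [translation, this.ne']
  have h2 : √((translation 0) (Sum.inl 0) ^ 2 + (translation 0) (Sum.inl 1) ^ 2
      + (translation 0) (Sum.inl 2) ^ 2) ≠ 0 :=
    (Real.sqrt_pos.2 (lt_of_le_of_ne (by positivity) h.symm)).ne'
  unfold hillHam
  fun_prop (disch := assumption)

/-- The expansion has no term linear in `ε`, so the derivative along every line through the point
vanishes. -/
theorem hamField_hillHam_libration : hamField hillHam (translation 0) = 0 := by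
  have key : ∀ ζ : Phase 3, fderiv ℝ hillHam (translation 0) ζ = 0 := by
    intro ζ
    have h1 : HasDerivAt (fun ε : ℝ => translation (ε • ζ)) ζ 0 := by
      exact (((hasDerivAt_id (0 : ℝ)).smul_const ζ).const_add
        (Sum.elim ![ρ, 0, 0] ![0, ρ, 0] : Phase 3)).congr_deriv (one_smul ℝ ζ)
    have h2 : HasDerivAt (fun ε : ℝ => hillHam (translation (ε • ζ)))
        (fderiv ℝ hillHam (translation 0) ζ) 0 := by
      have h := differentiableAt_hillHam.hasFDerivAt
      rw [← zero_smul ℝ ζ] at h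
      have h' := h.comp_hasDerivAt (0 : ℝ) h1
      rwa [zero_smul] at h'
    refine h2.unique ?_
    have h3 := isBigO_hillHam (γ := fun _ => ζ) continuousAt_const
    have h4 : HasDerivAt (fun ε : ℝ => hillHam (translation (ε • ζ))
        - (-(9 / 2) * ρ ^ 2
          + ε ^ 2 * truncated (fun n => MvPolynomial.eval ζ (H n)) ε)) 0 0 := by
      have h5 := (h3.congr_right (g₂ := fun ε => (ε - 0) ^ 5) (by simp)).norm_right
      simp only [norm_pow] at h5
      simpa using (h5.hasFDerivAt (by norm_num)).hasDerivAt
    have h6 : HasDerivAt (fun ε : ℝ => -(9 / 2) * ρ ^ 2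
          + ε ^ 2 * truncated (fun n => MvPolynomial.eval ζ (H n)) ε) 0 0 := by
      simp only [truncated_eq]
      have h7 : DifferentiableAt ℝ (fun ε : ℝ => MvPolynomial.eval ζ (H 0)
        + ε * MvPolynomial.eval ζ (H 1) + ε ^ 2 / 2 * MvPolynomial.eval ζ (H 2)) 0 := by fun_prop
      exact ((((hasDerivAt_id (0 : ℝ)).pow 2).mul h7.hasDerivAt).const_add
        (-(9 / 2) * ρ ^ 2)).congr_deriv (by simp)
    refine ((h4.add h6).congr_deriv (add_zero 0)).congr_of_eventuallyEq ?_
    exact Eventually.of_forall fun ε => by simp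
  ext (i | i) <;> simp [hamField, partialD, key]

/-! ### Linear decoupling -/

/-- As `16λ² - 72` and `16ω² + 72` lie in `ℚ(√7)`, the inverse squares of `σ` and `τ` lie in `λ
ℚ(√7)` and `ℚ(√7)`. Symplecticity and the diagonal form of `K₀` thereby become polynomial identities
modulo quadratic relations. -/
theorem inv_σ_sq : σ⁻¹ ^ 2 = lam * (49 + 10 * √7) / 27216 := by
  have h1 : (2 * lam * (16 * lam ^ 2 - 72)) * (lam * (49 + 10 * √7) / 27216) = 1 := by
    linear_combination ((16 * lam ^ 2 + 32 * √7 - 56) * (49 + 10 * √7) / 13608) * lam_sq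
      + (1 / 13608) * (640 * √7 + 2336) * sqrt_seven_sq
  rw [← σ_sq] at h1
  rw [inv_pow]
  exact inv_eq_of_mul_eq_one_right h1

theorem inv_τ_sq : τ⁻¹ ^ 2 = (4 * √7 - 7) / 504 := by
  have h1 : τ ^ 2 * ((4 * √7 - 7) / 504) = 1 := by
    rw [τ_sq]
    linear_combination (16 * (4 * √7 - 7) / 504) * ω_sq + 128 / 504 * sqrt_seven_sq
  rw [inv_pow]
  exact inv_eq_of_mul_eq_one_right h1

theorem isCanonicalOn_decoupling : IsCanonicalOn decoupling Set.univ := by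
  have hdec : ∀ w, (fun u => decoupling u w) =
      (ContinuousLinearMap.proj w).comp (Matrix.mulVecLin A).toContinuousLinearMap := by
    intro w; rfl
  have hp : ∀ (w v : Fin 3 ⊕ Fin 3) (ζ : Phase 3),
      partialD (fun u => decoupling u w) v ζ = A w v := by
    intro w v ζ
    rw [partialD, hdec, ContinuousLinearMap.fderiv]
    simp
  intro ζ _
  refine ⟨(Matrix.mulVecLin A).toContinuousLinearMap.differentiableAt, ?_⟩
  have h1 := inv_σ_sq
  have h2 := inv_τ_sq
  have h3 := lam_sq
  have h4 := ω_sq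
  have h5 := sqrt_seven_sq
  simp only [poisson, hp, A, Fin.sum_univ_three, div_eq_mul_inv]
  generalize σ⁻¹ = S at *
  generalize τ⁻¹ = T at *
  generalize √7 = q at *
  generalize lam = l at *
  generalize ω = w at *
  intro i j
  fin_cases i <;> fin_cases j <;> simp <;> grind

theorem eval_K (ζ : Phase 3) (n : ℕ) :
    MvPolynomial.eval ζ (K n) = MvPolynomial.eval (decoupling ζ) (H n) := by
  rw [K, MvPolynomial.hom_bind₁]
  have h1 : (MvPolynomial.eval ζ).comp MvPolynomial.C = RingHom.id ℝ := by ext; simp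
  have h2 : (fun i => MvPolynomial.eval ζ (∑ j, MvPolynomial.C (A i j) * MvPolynomial.X j))
      = decoupling ζ := by
    ext i
    simp [decoupling, Matrix.mulVec, dotProduct]
  rw [h1, h2]
  rfl

theorem decoupling_inl (ζ : Phase 3) :
    decoupling ζ (Sum.inl 0)
      = 2 * lam / σ * (ζ (Sum.inl 0) - ζ (Sum.inr 0)) + 2 / τ * ζ (Sum.inr 1) ∧
    decoupling ζ (Sum.inl 1) = (lam ^ 2 - 9) / σ * (ζ (Sum.inl 0) + ζ (Sum.inr 0))
      - (ω ^ 2 + 9) / τ * ζ (Sum.inl 1) ∧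
    decoupling ζ (Sum.inl 2) = ζ (Sum.inl 2) := by
  simp only [decoupling, Matrix.mulVec, dotProduct, Fintype.sum_sum_type, Fin.sum_univ_three, A]
  refine ⟨?_, ?_, ?_⟩ <;> simp <;> ring

theorem decoupling_inr (ζ : Phase 3) :
    decoupling ζ (Sum.inr 0) = (lam ^ 2 + 9) / σ * (ζ (Sum.inl 0) + ζ (Sum.inr 0))
      + (9 - ω ^ 2) / τ * ζ (Sum.inl 1) ∧
    decoupling ζ (Sum.inr 1) = lam * (lam ^ 2 - 7) / σ * (ζ (Sum.inl 0) - ζ (Sum.inr 0))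
      - (ω ^ 2 + 7) / τ * ζ (Sum.inr 1) ∧
    decoupling ζ (Sum.inr 2) = ζ (Sum.inr 2) := by
  simp only [decoupling, Matrix.mulVec, dotProduct, Fintype.sum_sum_type, Fin.sum_univ_three, A]
  refine ⟨?_, ?_, ?_⟩ <;> simp <;> ring

theorem K_zero :
    K 0 = MvPolynomial.C lam * x * px
        + MvPolynomial.C (1 / 2) * (py ^ 2 + MvPolynomial.C (ω ^ 2) * y ^ 2)
        + MvPolynomial.C (1 / 2) * (pz ^ 2 + MvPolynomial.C (ν ^ 2) * z ^ 2) := by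
  refine MvPolynomial.funext fun ζ => ?_
  obtain ⟨e1, e2, e3⟩ := decoupling_inl ζ
  obtain ⟨e4, e5, e6⟩ := decoupling_inr ζ
  rw [eval_K, eval_H_zero, e1, e2, e3, e4, e5, e6]
  have h1 := inv_σ_sq
  have h2 := inv_τ_sq
  have h3 := lam_sq
  have h4 := ω_sq
  have h5 := sqrt_seven_sq
  simp only [x, y, z, px, py, pz, ν, div_eq_mul_inv, map_add, map_mul, map_pow,
    MvPolynomial.eval_X, MvPolynomial.eval_C]
  generalize σ⁻¹ = S at *
  generalize τ⁻¹ = T at *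
  generalize √7 = q at *
  generalize lam = l at *
  generalize ω = w at *
  generalize ζ (Sum.inl 0) = x
  generalize ζ (Sum.inl 1) = y
  generalize ζ (Sum.inl 2) = z
  generalize ζ (Sum.inr 0) = px
  generalize ζ (Sum.inr 1) = py
  generalize ζ (Sum.inr 2) = pz
  grind

/-! ### Existence of the center normal form -/

/-- The weight of a monomial is the difference of its exponents of `x` and `X`. -/
def saddleWeight : Fin 3 ⊕ Fin 3 → ℤ := Sum.elim ![1, 0, 0] ![-1, 0, 0]

theorem weight_saddleWeight (m : Fin 3 ⊕ Fin 3 →₀ ℕ) :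
    Finsupp.weight saddleWeight m = (m (Sum.inl 0) : ℤ) - m (Sum.inr 0) := by
  rw [Finsupp.weight_apply, Finsupp.sum_fintype _ _ (by simp)]
  simp [saddleWeight, Fin.sum_univ_three]
  ring

theorem saddleWeight_ne_zero_iff (m : Fin 3 ⊕ Fin 3 →₀ ℕ) :
    Finsupp.weight saddleWeight m ≠ 0 ↔ m (Sum.inl 0) ≠ m (Sum.inr 0) := by
  rw [weight_saddleWeight]
  omega

/-- Polynomials without monomials of equal exponents of `x` and `X`. -/
def offDiagonal : Submodule ℝ Poly where
  carrier := {f | ∀ m, m (Sum.inl 0) = m (Sum.inr 0) → MvPolynomial.coeff m f = 0}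
  add_mem' hf hg m hm := by simp [hf m hm, hg m hm]
  zero_mem' := by simp
  smul_mem' c f hf m hm := by simp [hf m hm]

theorem mem_offDiagonal {f : Poly} :
    f ∈ offDiagonal ↔ ∀ m ∈ f.support, m (Sum.inl 0) ≠ m (Sum.inr 0) := by
  simp only [MvPolynomial.mem_support_iff]
  exact forall_congr' fun m => not_imp_not.symm

/-- The derivation `f ↦ {K₀, f}`. -/
def adK : Derivation ℝ Poly Poly :=
  (MvPolynomial.C lam * px) • MvPolynomial.pderiv (Sum.inr 0)
    - (MvPolynomial.C lam * x) • MvPolynomial.pderiv (Sum.inl 0)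
    + (MvPolynomial.C (ω ^ 2) * y) • MvPolynomial.pderiv (Sum.inr 1)
    - py • MvPolynomial.pderiv (Sum.inl 1)
    + (MvPolynomial.C (ν ^ 2) * z) • MvPolynomial.pderiv (Sum.inr 2)
    - pz • MvPolynomial.pderiv (Sum.inl 2)

theorem polyPoisson_K_zero (f : Poly) : polyPoisson (K 0) f = adK f := by
  have h2 : (MvPolynomial.C 2⁻¹ : Poly) * 2 = 1 := by
    rw [← map_ofNat (MvPolynomial.C (R := ℝ) (σ := Fin 3 ⊕ Fin 3)) 2, ← map_mul]
    norm_num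
  rw [K_zero, polyPoisson]
  simp only [Fin.sum_univ_three, adK, x, y, z, px, py, pz, map_add, Derivation.leibniz,
    Derivation.leibniz_pow, MvPolynomial.pderiv_C, MvPolynomial.pderiv_X, Derivation.coe_sub,
    Derivation.coe_add, Derivation.coe_smul, Pi.add_apply, Pi.sub_apply, Pi.smul_apply, smul_eq_mul]
  simp
  linear_combination
    (MvPolynomial.C ω ^ 2 * MvPolynomial.X (Sum.inl 1) * MvPolynomial.pderiv (Sum.inr 1) f
    - MvPolynomial.X (Sum.inr 1) * MvPolynomial.pderiv (Sum.inl 1) f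
    + MvPolynomial.C ν ^ 2 * MvPolynomial.X (Sum.inl 2) * MvPolynomial.pderiv (Sum.inr 2) f
    - MvPolynomial.X (Sum.inr 2) * MvPolynomial.pderiv (Sum.inl 2) f) * h2

/-- `u + i v` is an eigenvector of `{K₀, ·}` with eigenvalue `-λ e + i μ`, of weight `e`. -/
structure IsEigenpair (e : ℤ) (μ : ℝ) (u v : Poly) : Prop where
  left_weight : u.IsWeightedHomogeneous saddleWeight e
  right_weight : v.IsWeightedHomogeneous saddleWeight e
  left : adK u = (-(lam * e)) • u - μ • v
  right : adK v = (-(lam * e)) • v + μ • u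

/-- Complex conjugation of the eigenvector `u + iv` of a real operator. -/
theorem IsEigenpair.conj {e : ℤ} {μ : ℝ} {u v : Poly} (h : IsEigenpair e μ u v) :
    IsEigenpair e (-μ) u (-v) where
  left_weight := h.left_weight
  right_weight := by simpa using h.right_weight.neg
  left := by rw [h.left]; module
  right := by rw [map_neg, h.right]; module

/-- Since `adK` is a derivation, eigenvectors multiply and their eigenvalues add. -/
theorem IsEigenpair.mul {e e' : ℤ} {μ μ' : ℝ} {u v u' v' : Poly} (h : IsEigenpair e μ u v)
    (h' : IsEigenpair e' μ' u' v') :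
    IsEigenpair (e + e') (μ + μ') (u * u' - v * v') (u * v' + v * u') where
  left_weight := (h.left_weight.mul h'.left_weight).sub (h.right_weight.mul h'.right_weight)
  right_weight := (h.left_weight.mul h'.right_weight).add (h.right_weight.mul h'.left_weight)
  left := by
    simp only [map_sub, Derivation.leibniz, h.left, h.right, h'.left, h'.right,
      MvPolynomial.smul_eq_C_mul, smul_eq_mul]
    push_cast
    simp only [map_neg, map_mul, map_add]
    ring
  right := by
    simp only [map_add, Derivation.leibniz, h.left, h.right, h'.left, h'.right,
      MvPolynomial.smul_eq_C_mul, smul_eq_mul]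
    push_cast
    simp only [map_neg, map_mul, map_add]
    ring

/-- The preimage is the real part of `(u + iv) / (-λe + iμ)`; the divisor is nonzero because its
real part is. -/
theorem IsEigenpair.exists_adK_eq {e : ℤ} {μ : ℝ} {u v : Poly} (h : IsEigenpair e μ u v)
    (he : e ≠ 0) : ∃ f ∈ offDiagonal, adK f = u := by
  have hoff : ∀ {p : Poly}, p.IsWeightedHomogeneous saddleWeight e → p ∈ offDiagonal := by
    intro p hp
    refine mem_offDiagonal.2 fun m hm => (saddleWeight_ne_zero_iff m).1 ?_
    rw [hp (MvPolynomial.mem_support_iff.1 hm)]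
    exact he
  have hc : (lam * e) ^ 2 + μ ^ 2 ≠ 0 := by
    have : lam * e ≠ 0 := mul_ne_zero lam_pos.ne' (by exact_mod_cast he)
    positivity
  refine ⟨((lam * e) ^ 2 + μ ^ 2)⁻¹ • ((-(lam * e)) • u + μ • v),
    offDiagonal.smul_mem _ (offDiagonal.add_mem (offDiagonal.smul_mem _ (hoff h.left_weight))
      (offDiagonal.smul_mem _ (hoff h.right_weight))), ?_⟩
  have : (-(lam * e)) • ((-(lam * e)) • u - μ • v) + μ • ((-(lam * e)) • v + μ • u)
      = ((lam * e) ^ 2 + μ ^ 2) • u := by module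
  rw [Derivation.map_smul, map_add, Derivation.map_smul, Derivation.map_smul, h.left, h.right, this, inv_smul_smul₀ hc]

/-- Span of the real parts of the eigenvectors of weight `e`. -/
def eigenSpan (e : ℤ) : Submodule ℝ Poly :=
  Submodule.span ℝ {u | ∃ v μ, IsEigenpair e μ u v}

theorem adK_X :
    adK x = -(lam • x) ∧ adK px = lam • px ∧ adK y = -py ∧ adK py = (ω ^ 2) • y ∧
      adK z = -pz ∧ adK pz = (ν ^ 2) • z := by
  simp only [adK, x, y, z, px, py, pz, MvPolynomial.pderiv_X, Derivation.coe_sub,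
    Derivation.coe_add, Derivation.coe_smul, Pi.add_apply, Pi.sub_apply, Pi.smul_apply, smul_eq_mul,
    MvPolynomial.smul_eq_C_mul]
  refine ⟨?_, ?_, ?_, ?_, ?_, ?_⟩ <;> simp

/-- The saddle variables are eigenvectors themselves. Each other coordinate is the real part of an
oscillator mode, with the conjugate variable scaled by the frequency as imaginary part. -/
theorem exists_isEigenpair_X (i : Fin 3 ⊕ Fin 3) :
    ∃ v μ, IsEigenpair (saddleWeight i) μ (MvPolynomial.X i) v := by
  have hX : ∀ i, (MvPolynomial.X i : Poly).IsWeightedHomogeneous saddleWeight (saddleWeight i) :=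
    fun i => MvPolynomial.isWeightedHomogeneous_X ℝ _ i
  have hs : ∀ (c : ℝ) (p : Poly) (e : ℤ), p.IsWeightedHomogeneous saddleWeight e →
      (c • p).IsWeightedHomogeneous saddleWeight e := fun c p e hp =>
    (MvPolynomial.weightedHomogeneousSubmodule ℝ saddleWeight e).smul_mem c hp
  have h0 : ∀ e, (0 : Poly).IsWeightedHomogeneous saddleWeight e :=
    fun e => MvPolynomial.isWeightedHomogeneous_zero _ _ e
  obtain ⟨a1, a2, a3, a4, a5, a6⟩ := adK_X
  unfold x y z px py pz at *
  have hω : ω ≠ 0 := ω_pos.ne'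
  have hν : ν ≠ 0 := by norm_num [ν]
  rcases i with i | i <;> fin_cases i
  · exact ⟨0, 0, hX _, h0 _, by simp [a1, saddleWeight], by simp⟩
  · exact ⟨ω⁻¹ • MvPolynomial.X (Sum.inr 1), ω, hX _, hs _ _ _ (hX (Sum.inr 1)), by
      simp [a3, saddleWeight, hω], by
      simp [a4, saddleWeight, smul_smul]; field_simp⟩
  · exact ⟨ν⁻¹ • MvPolynomial.X (Sum.inr 2), ν, hX _, hs _ _ _ (hX (Sum.inr 2)), by
      simp [a5, saddleWeight, hν], by
      simp [a6, saddleWeight, smul_smul]; field_simp⟩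
  · exact ⟨0, 0, hX _, h0 _, by simp [a2, saddleWeight], by simp⟩
  · exact ⟨(-ω) • MvPolynomial.X (Sum.inl 1), ω, hX _, hs _ _ _ (hX (Sum.inl 1)), by
      simp [a4, saddleWeight, smul_smul, sq], by
      simp [a3, saddleWeight]⟩
  · exact ⟨(-ν) • MvPolynomial.X (Sum.inl 2), ν, hX _, hs _ _ _ (hX (Sum.inl 2)), by
      simp [a6, saddleWeight, smul_smul, sq], by
      simp [a5, saddleWeight]⟩

/-- `Re a · Re b` is half the sum of `Re (ab)` and `Re (a b̄)`, and the product with the conjugate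
is again an eigenvector of the same weight. -/
theorem X_mul_mem_eigenSpan (i : Fin 3 ⊕ Fin 3) {e : ℤ} {f : Poly} (hf : f ∈ eigenSpan e) :
    MvPolynomial.X i * f ∈ eigenSpan (saddleWeight i + e) := by
  obtain ⟨v, μ, hv⟩ := exists_isEigenpair_X i
  induction hf using Submodule.span_induction with
  | mem f hf =>
    obtain ⟨g, κ, hg⟩ := hf
    have h1 : MvPolynomial.X i * f - v * g ∈ eigenSpan (saddleWeight i + e) :=
      Submodule.subset_span ⟨_, _, hv.mul hg⟩
    have h2 : MvPolynomial.X i * f - v * -g ∈ eigenSpan (saddleWeight i + e) :=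
      Submodule.subset_span ⟨_, _, hv.mul hg.conj⟩
    have h3 : MvPolynomial.X i * f = (1 / 2 : ℝ) • ((MvPolynomial.X i * f - v * g)
        + (MvPolynomial.X i * f - v * -g)) := by
      rw [show (MvPolynomial.X i * f - v * g) + (MvPolynomial.X i * f - v * -g)
        = (2 : ℝ) • (MvPolynomial.X i * f) by rw [two_smul]; ring, smul_smul]
      norm_num
    rw [h3]
    exact Submodule.smul_mem _ _ (Submodule.add_mem _ h1 h2)
  | zero => simp
  | add f g _ _ hf hg => rw [mul_add]; exact Submodule.add_mem _ hf hg
  | smul c f _ hf => rw [mul_smul_comm]; exact Submodule.smul_mem _ _ hf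

theorem monomial_mem_eigenSpan (m : Fin 3 ⊕ Fin 3 →₀ ℕ) :
    MvPolynomial.monomial m (1 : ℝ) ∈ eigenSpan (Finsupp.weight saddleWeight m) := by
  have hadd : ∀ (i : Fin 3 ⊕ Fin 3) (m : Fin 3 ⊕ Fin 3 →₀ ℕ),
      MvPolynomial.monomial m (1 : ℝ) ∈ eigenSpan (Finsupp.weight saddleWeight m) →
      MvPolynomial.monomial (Finsupp.single i 1 + m) (1 : ℝ)
        ∈ eigenSpan (Finsupp.weight saddleWeight (Finsupp.single i 1 + m)) := by
    intro i m hm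
    have := X_mul_mem_eigenSpan i hm
    rwa [MvPolynomial.X, MvPolynomial.monomial_mul, one_mul,
      show saddleWeight i + Finsupp.weight saddleWeight m
        = Finsupp.weight saddleWeight (Finsupp.single i 1 + m) by
        rw [map_add, Finsupp.weight_single, one_smul]] at this
  induction m using Finsupp.induction with
  | zero =>
    refine Submodule.subset_span ⟨0, 0, ?_, MvPolynomial.isWeightedHomogeneous_zero _ _ _, ?_, ?_⟩
    · exact MvPolynomial.isWeightedHomogeneous_monomial _ _ _ rfl
    · have : (MvPolynomial.monomial 0 (1 : ℝ) : Poly) = 1 := rfl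
      simp [this]
    · simp
  | single_add i b m _ _ ih =>
    clear * - hadd ih
    induction b with
    | zero => simpa using ih
    | succ b hb =>
      have := hadd i _ hb
      rwa [← add_assoc, ← Finsupp.single_add, add_comm 1 b] at this

theorem exists_adK_eq {f : Poly} (hf : f ∈ offDiagonal) : ∃ g ∈ offDiagonal, adK g = f := by
  change f ∈ offDiagonal.map adK.toLinearMap
  rw [f.as_sum]
  refine Submodule.sum_mem _ fun m hm => ?_
  have he := (saddleWeight_ne_zero_iff m).2 (mem_offDiagonal.1 hf m hm)
  rw [← mul_one (MvPolynomial.coeff m f), ← smul_eq_mul, ← MvPolynomial.smul_monomial]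
  refine Submodule.smul_mem _ _ ((Submodule.span_le.2 ?_) (monomial_mem_eigenSpan m))
  rintro u ⟨v, μ, h⟩
  exact h.exists_adK_eq he

/-- The homological equation of one order: the part of weight zero is kept and the rest is removed
by a generator. -/
theorem exists_add_adK_weight_zero (f : Poly) :
    ∃ g ∈ offDiagonal, (f + adK g).IsWeightedHomogeneous saddleWeight 0 := by
  set f₀ := MvPolynomial.weightedHomogeneousComponent saddleWeight 0 f with hf₀
  have hoff : f₀ - f ∈ offDiagonal := by
    intro m hm
    have : Finsupp.weight saddleWeight m = 0 := by
      rw [weight_saddleWeight, hm, sub_self]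
    rw [MvPolynomial.coeff_sub, hf₀, MvPolynomial.coeff_weightedHomogeneousComponent, if_pos this,
      sub_self]
  obtain ⟨g, hg, hgf⟩ := exists_adK_eq hoff
  refine ⟨g, hg, ?_⟩
  rw [hgf, add_sub_cancel]
  exact MvPolynomial.weightedHomogeneousComponent_isWeightedHomogeneous _ _

theorem eq_of_weight_zero {f : Poly} (hf : f.IsWeightedHomogeneous saddleWeight 0) :
    ∀ m ∈ f.support, m (Sum.inl 0) = m (Sum.inr 0) := by
  intro m hm
  have := hf (MvPolynomial.mem_support_iff.1 hm)
  by_contra h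
  exact (saddleWeight_ne_zero_iff m).2 h this

theorem K_zero_weight : (K 0).IsWeightedHomogeneous saddleWeight 0 := by
  have hX : ∀ i, (MvPolynomial.X i : Poly).IsWeightedHomogeneous saddleWeight (saddleWeight i) :=
    fun i => MvPolynomial.isWeightedHomogeneous_X ℝ _ i
  have hC : ∀ c : ℝ, (MvPolynomial.C c : Poly).IsWeightedHomogeneous saddleWeight 0 :=
    fun c => MvPolynomial.isWeightedHomogeneous_C _ c
  have hq : ∀ (i j : Fin 3 ⊕ Fin 3) (c : ℝ), saddleWeight i = 0 → saddleWeight j = 0 →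
      (MvPolynomial.C (1 / 2) * (MvPolynomial.X j ^ 2
        + MvPolynomial.C c * MvPolynomial.X i ^ 2) : Poly).IsWeightedHomogeneous saddleWeight 0 := by
    intro i j c hi hj
    have h1 := hX i
    have h2 := hX j
    rw [hi] at h1
    rw [hj] at h2
    simpa using (hC (1 / 2)).mul ((h2.pow 2).add ((hC c).mul (h1.pow 2)))
  rw [K_zero]
  refine MvPolynomial.IsWeightedHomogeneous.add (MvPolynomial.IsWeightedHomogeneous.add ?_
    (hq _ _ _ rfl rfl)) (hq _ _ _ rfl rfl)
  simpa [saddleWeight, x, px] using ((hC lam).mul (hX (Sum.inl 0))).mul (hX (Sum.inr 0))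

theorem exists_isCenterNormalForm : ∃ W N : ℕ → Poly, IsCenterNormalForm W N := by
  obtain ⟨W₁, hW₁, hN₁⟩ := exists_add_adK_weight_zero (K 1)
  obtain ⟨W₂, hW₂, hN₂⟩ := exists_add_adK_weight_zero
    (K 2 + polyPoisson (K 1) W₁ + polyPoisson (K 1 + polyPoisson (K 0) W₁) W₁)
  -- Only the indices 1 and 2 are read up to the second order. There `W₂` enters solely through `adK
  -- W₂`, so it can be chosen after `W₁`.
  set W : ℕ → Poly := fun n => if n = 1 then W₁ else W₂ with hW
  have e1 : W 1 = W₁ := rfl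
  have e2 : W 2 = W₂ := rfl
  refine ⟨W, lieTransform polyPoisson W K, ⟨?_, fun n _ => rfl, ?_⟩⟩
  · intro n h1 h2
    interval_cases n
    · exact mem_offDiagonal.1 hW₁
    · exact mem_offDiagonal.1 hW₂
  · intro n hn
    refine eq_of_weight_zero ?_
    interval_cases n
    · exact K_zero_weight
    · rw [lieTransform_one, e1, polyPoisson_K_zero]
      exact hN₁
    · rw [lieTransform_two, e1, e2, polyPoisson_K_zero W₂]
      convert hN₂ using 1
      ring

/-- The bracket with `xX` multiplies each monomial by the difference of its exponents of `X` and
`x`. -/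
theorem polyPoisson_x_mul_px {f : Poly} (hf : ∀ m ∈ f.support, m (Sum.inl 0) = m (Sum.inr 0)) :
    polyPoisson (x * px) f = 0 := by
  have h : polyPoisson (x * px) f
      = px * MvPolynomial.pderiv (Sum.inr 0) f - x * MvPolynomial.pderiv (Sum.inl 0) f := by
    simp [polyPoisson, Fin.sum_univ_three, x, px]
  rw [h, f.as_sum]
  simp only [map_sum, Finset.mul_sum, ← Finset.sum_sub_distrib]
  refine Finset.sum_eq_zero fun m hm => ?_
  rw [x, px, MvPolynomial.X_mul_pderiv_monomial, MvPolynomial.X_mul_pderiv_monomial, hf m hm,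
    sub_self]

/-! ### Restriction to the center manifold -/

theorem eval_centerPoint_eq_zero {f : Poly} (hf : f ∈ offDiagonal) (v : Phase 2) :
    MvPolynomial.eval (centerPoint v) f = 0 := by
  rw [MvPolynomial.eval_eq']
  refine Finset.sum_eq_zero fun m hm => ?_
  have hne := mem_offDiagonal.1 hf m hm
  have : m (Sum.inl 0) ≠ 0 ∨ m (Sum.inr 0) ≠ 0 := by omega
  rcases this with h | h
  · rw [Finset.prod_eq_zero (Finset.mem_univ (Sum.inl 0)), mul_zero]
    simp [centerPoint, h]
  · rw [Finset.prod_eq_zero (Finset.mem_univ (Sum.inr 0)), mul_zero]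
    simp [centerPoint, h]

theorem pderiv_mem_offDiagonal {f : Poly} (hf : f ∈ offDiagonal) {i : Fin 3 ⊕ Fin 3}
    (h1 : i ≠ Sum.inl 0) (h2 : i ≠ Sum.inr 0) : MvPolynomial.pderiv i f ∈ offDiagonal := by
  rw [f.as_sum, map_sum]
  refine Submodule.sum_mem _ fun m hm k hk => ?_
  rw [MvPolynomial.pderiv_monomial, MvPolynomial.coeff_monomial, if_neg]
  rintro rfl
  refine mem_offDiagonal.1 hf m hm ?_
  simpa [Finsupp.single_eq_of_ne h1.symm, Finsupp.single_eq_of_ne h2.symm] using hk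

theorem pderiv_mem_offDiagonal_of_diagonal {f : Poly}
    (hf : ∀ m ∈ f.support, m (Sum.inl 0) = m (Sum.inr 0)) {i : Fin 3 ⊕ Fin 3}
    (hi : i = Sum.inl 0 ∨ i = Sum.inr 0) : MvPolynomial.pderiv i f ∈ offDiagonal := by
  rw [f.as_sum, map_sum]
  refine Submodule.sum_mem _ fun m hm k hk => ?_
  have h := hf m hm
  rw [MvPolynomial.pderiv_monomial, MvPolynomial.coeff_monomial]
  split_ifs with hmk
  -- If lowering one of two equal exponents leaves them equal, the subtraction was truncated at
  -- zero; then the factor produced by the derivative vanishes.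
  · have h0 : m i = 0 := by
      subst hmk
      rcases hi with rfl | rfl <;> simp [Finsupp.tsub_apply] at hk <;> omega
    rw [h0]
    simp
  · rfl

theorem eval_centerPoint_adK (g : Poly) (v : Phase 2) :
    MvPolynomial.eval (centerPoint v) (adK g)
      = ω ^ 2 * v (Sum.inl 0) * MvPolynomial.eval (centerPoint v) (MvPolynomial.pderiv (Sum.inr 1) g)
      - v (Sum.inr 0) * MvPolynomial.eval (centerPoint v) (MvPolynomial.pderiv (Sum.inl 1) g)
      + ν ^ 2 * v (Sum.inl 1) * MvPolynomial.eval (centerPoint v) (MvPolynomial.pderiv (Sum.inr 2) g)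
      - v (Sum.inr 1)
        * MvPolynomial.eval (centerPoint v) (MvPolynomial.pderiv (Sum.inl 2) g) := by
  simp [adK, x, y, z, px, py, pz, centerPoint]

theorem eval_centerPoint_adK_eq_zero {f : Poly} (hf : f ∈ offDiagonal) (v : Phase 2) :
    MvPolynomial.eval (centerPoint v) (adK f) = 0 := by
  rw [eval_centerPoint_adK]
  simp only [eval_centerPoint_eq_zero (pderiv_mem_offDiagonal hf (i := Sum.inr 1) (by simp) (by simp)),
    eval_centerPoint_eq_zero (pderiv_mem_offDiagonal hf (i := Sum.inl 1) (by simp) (by simp)),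
    eval_centerPoint_eq_zero (pderiv_mem_offDiagonal hf (i := Sum.inr 2) (by simp) (by simp)),
    eval_centerPoint_eq_zero (pderiv_mem_offDiagonal hf (i := Sum.inl 2) (by simp) (by simp))]
  ring

theorem eval_centerPoint_polyPoisson_offDiagonal (f : Poly) {g : Poly} (hg : g ∈ offDiagonal)
    (v : Phase 2) :
    MvPolynomial.eval (centerPoint v) (polyPoisson f g)
      = MvPolynomial.eval (centerPoint v) (MvPolynomial.pderiv (Sum.inl 0) f)
        * MvPolynomial.eval (centerPoint v) (MvPolynomial.pderiv (Sum.inr 0) g)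
      - MvPolynomial.eval (centerPoint v) (MvPolynomial.pderiv (Sum.inr 0) f)
        * MvPolynomial.eval (centerPoint v) (MvPolynomial.pderiv (Sum.inl 0) g) := by
  rw [polyPoisson, Fin.sum_univ_three]
  simp only [map_add, map_sub, map_mul,
    eval_centerPoint_eq_zero (pderiv_mem_offDiagonal hg (i := Sum.inr 1) (by simp) (by simp)),
    eval_centerPoint_eq_zero (pderiv_mem_offDiagonal hg (i := Sum.inl 1) (by simp) (by simp)),
    eval_centerPoint_eq_zero (pderiv_mem_offDiagonal hg (i := Sum.inr 2) (by simp) (by simp)),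
    eval_centerPoint_eq_zero (pderiv_mem_offDiagonal hg (i := Sum.inl 2) (by simp) (by simp))]
  ring

/-- The commutator of two derivations is a derivation, hence it is determined on the variables. The
relation yields an equation on the center manifold for the saddle derivatives of `W₁`. -/
theorem pderiv_adK_inl (f : Poly) :
    MvPolynomial.pderiv (Sum.inl 0) (adK f)
      = adK (MvPolynomial.pderiv (Sum.inl 0) f)
        - MvPolynomial.C lam * MvPolynomial.pderiv (Sum.inl 0) f := by
  have h : ⁅(MvPolynomial.pderiv (Sum.inl 0) : Derivation ℝ Poly Poly), adK⁆
      = (-MvPolynomial.C lam : Poly) • MvPolynomial.pderiv (Sum.inl 0) := by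
    refine MvPolynomial.derivation_ext fun j => ?_
    rcases j with j | j <;> fin_cases j <;>
      simp [Derivation.commutator_apply, adK, x, y, z, px, py, pz]
  have h2 := DFunLike.congr_fun h f
  rw [Derivation.commutator_apply, Derivation.smul_apply, smul_eq_mul] at h2
  linear_combination h2

theorem pderiv_adK_inr (f : Poly) :
    MvPolynomial.pderiv (Sum.inr 0) (adK f)
      = adK (MvPolynomial.pderiv (Sum.inr 0) f)
        + MvPolynomial.C lam * MvPolynomial.pderiv (Sum.inr 0) f := by
  have h : ⁅(MvPolynomial.pderiv (Sum.inr 0) : Derivation ℝ Poly Poly), adK⁆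
      = (MvPolynomial.C lam : Poly) • MvPolynomial.pderiv (Sum.inr 0) := by
    refine MvPolynomial.derivation_ext fun j => ?_
    rcases j with j | j <;> fin_cases j <;>
      simp [Derivation.commutator_apply, adK, x, y, z, px, py, pz]
  have h2 := DFunLike.congr_fun h f
  rw [Derivation.commutator_apply, Derivation.smul_apply, smul_eq_mul] at h2
  linear_combination h2

/-- The oscillatory flow of `K₀` on the center manifold. -/
def centerFlow (v : Phase 2) (t : ℝ) : Phase 2 :=
  Sum.elim
    ![v (Sum.inl 0) * cos (ω * t) + v (Sum.inr 0) * (ω⁻¹ * sin (ω * t)),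
      v (Sum.inl 1) * cos (ν * t) + v (Sum.inr 1) * (ν⁻¹ * sin (ν * t))]
    ![-v (Sum.inl 0) * (ω * sin (ω * t)) + v (Sum.inr 0) * cos (ω * t),
      -v (Sum.inl 1) * (ν * sin (ν * t)) + v (Sum.inr 1) * cos (ν * t)]

/-- The sign is negative because `adK` is `{K₀, ·}`, while the flow of `K₀` differentiates by `{·,
K₀}`. -/
theorem hasDerivAt_eval_centerFlow (g : Poly) (v : Phase 2) (t : ℝ) :
    HasDerivAt (fun t => MvPolynomial.eval (centerPoint (centerFlow v t)) g)
      (-MvPolynomial.eval (centerPoint (centerFlow v t)) (adK g)) t := by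
  have hω : ω ≠ 0 := ω_pos.ne'
  have hν : ν ≠ 0 := by norm_num [ν]
  have hcos : ∀ c : ℝ, HasDerivAt (fun t => cos (c * t)) (-(c * sin (c * t))) t := fun c => by
    simpa [mul_comm] using ((hasDerivAt_id t).const_mul c).cos
  have hsin : ∀ c : ℝ, HasDerivAt (fun t => sin (c * t)) (c * cos (c * t)) t := fun c => by
    simpa [mul_comm] using ((hasDerivAt_id t).const_mul c).sin
  have hγ : HasDerivAt (fun t => centerPoint (centerFlow v t))
      (Sum.elim ![0, centerFlow v t (Sum.inr 0), centerFlow v t (Sum.inr 1)]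
        ![0, -(ω ^ 2 * centerFlow v t (Sum.inl 0)), -(ν ^ 2 * centerFlow v t (Sum.inl 1))]) t := by
    rw [hasDerivAt_pi]
    rintro (i | i) <;> fin_cases i
    · exact hasDerivAt_const t (0 : ℝ)
    · refine (((hcos ω).const_mul (v (Sum.inl 0))).add
        (((hsin ω).const_mul ω⁻¹).const_mul (v (Sum.inr 0)))).congr_deriv ?_
      simp [centerFlow, hω]
    · refine (((hcos ν).const_mul (v (Sum.inl 1))).add
        (((hsin ν).const_mul ν⁻¹).const_mul (v (Sum.inr 1)))).congr_deriv ?_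
      simp [centerFlow, hν]
    · exact hasDerivAt_const t (0 : ℝ)
    · refine ((((hsin ω).const_mul ω).const_mul (-v (Sum.inl 0))).add
        ((hcos ω).const_mul (v (Sum.inr 0)))).congr_deriv ?_
      simp [centerFlow]
      field_simp
      ring
    · refine ((((hsin ν).const_mul ν).const_mul (-v (Sum.inl 1))).add
        ((hcos ν).const_mul (v (Sum.inr 1)))).congr_deriv ?_
      simp [centerFlow]
      field_simp
      ring
  refine ((hasFDerivAt_eval g _).comp_hasDerivAt t hγ).congr_deriv ?_
  rw [eval_centerPoint_adK]
  simp [Fin.sum_univ_three]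
  ring

theorem exists_bound_eval_centerFlow (g : Poly) (v : Phase 2) :
    ∃ M, ∀ t, |MvPolynomial.eval (centerPoint (centerFlow v t)) g| ≤ M := by
  set φ : ℝ × ℝ × ℝ × ℝ → ℝ := fun p => MvPolynomial.eval (centerPoint (Sum.elim
    ![v (Sum.inl 0) * p.1 + v (Sum.inr 0) * (ω⁻¹ * p.2.1),
      v (Sum.inl 1) * p.2.2.1 + v (Sum.inr 1) * (ν⁻¹ * p.2.2.2)]
    ![-v (Sum.inl 0) * (ω * p.2.1) + v (Sum.inr 0) * p.1,
      -v (Sum.inl 1) * (ν * p.2.2.2) + v (Sum.inr 1) * p.2.2.1])) g with hφ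
  have hc : Continuous φ := by
    refine (contDiff_eval g (m := 0)).continuous.comp (continuous_pi ?_)
    rintro (i | i) <;> fin_cases i <;> simp [centerPoint] <;> fun_prop
  obtain ⟨M, hM⟩ := (isCompact_Icc (a := ((-1, -1, -1, -1) : ℝ × ℝ × ℝ × ℝ))
    (b := (1, 1, 1, 1))).exists_bound_of_continuousOn hc.continuousOn
  exact ⟨M, fun t => hM (cos (ω * t), sin (ω * t), cos (ν * t), sin (ν * t))
    ⟨⟨neg_one_le_cos _, neg_one_le_sin _, neg_one_le_cos _, neg_one_le_sin _⟩,
      ⟨cos_le_one _, sin_le_one _, cos_le_one _, sin_le_one _⟩⟩⟩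

/-- Along the oscillatory flow the value `F` of `h` satisfies `F' = -cF`, so `exp(ct) F` is
constant. As `F` is bounded, letting `ct → -∞` shows that this constant is zero. -/
theorem eval_centerPoint_eq_zero_of_adK {c : ℝ} (hc : c ≠ 0) {h : Poly}
    (hh : ∀ v, MvPolynomial.eval (centerPoint v) (adK h) = c * MvPolynomial.eval (centerPoint v) h)
    (v : Phase 2) : MvPolynomial.eval (centerPoint v) h = 0 := by
  obtain ⟨M, hM⟩ := exists_bound_eval_centerFlow h v
  set F : ℝ → ℝ := fun t => MvPolynomial.eval (centerPoint (centerFlow v t)) h with hF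
  have h0 : centerFlow v 0 = v := by
    ext (i | i) <;> fin_cases i <;> simp [centerFlow]
  have hexp : ∀ t, HasDerivAt (fun t => exp (c * t) * F t) 0 t := by
    intro t
    have e1 := ((hasDerivAt_id t).const_mul c).exp
    refine (e1.mul (hasDerivAt_eval_centerFlow h v t)).congr_deriv ?_
    rw [hh]
    simp only [id]
    ring
  have hconst : ∀ t, exp (c * t) * F t = F 0 := by
    intro t
    have := is_const_of_deriv_eq_zero (fun t => (hexp t).differentiableAt)
      (fun t => (hexp t).deriv) t 0
    simpa using this
  have hF0 : F 0 = MvPolynomial.eval (centerPoint v) h := by simp [hF, h0]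
  rw [← hF0]
  have hlim : Tendsto (fun s : ℝ => exp (-s) * M) atTop (𝓝 0) := by
    simpa using (Real.tendsto_exp_neg_atTop_nhds_zero).mul_const M
  have hle : ∀ s : ℝ, |F 0| ≤ exp (-s) * M := by
    intro s
    -- The time `-s/c` makes the exponent `-s` for either sign of `c`.
    rw [← hconst (-s / c), abs_mul, abs_of_pos (exp_pos _), mul_div_cancel₀ _ hc]
    exact mul_le_mul_of_nonneg_left (hM _) (exp_pos _).le
  exact abs_nonpos_iff.1 (ge_of_tendsto' hlim hle)

/-! ### The center manifold Hamiltonian -/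

theorem centerHam_zero {W N : ℕ → Poly} (h : IsCenterNormalForm W N) (v : Phase 2) :
    centerHam N 0 v = 1 / 2 * (v (Sum.inr 0) ^ 2 + ω ^ 2 * v (Sum.inl 0) ^ 2)
      + 1 / 2 * (v (Sum.inr 1) ^ 2 + ν ^ 2 * v (Sum.inl 1) ^ 2) := by
  rw [centerHam, h.transformed 0 (by norm_num), lieTransform_zero, K_zero]
  simp [x, y, z, px, py, pz, centerPoint]

theorem decoupling_centerPoint (v : Phase 2) :
    decoupling (centerPoint v) (Sum.inl 0) = 2 * τ⁻¹ * v (Sum.inr 0) ∧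
    decoupling (centerPoint v) (Sum.inl 1) = -((ω ^ 2 + 9) * τ⁻¹ * v (Sum.inl 0)) ∧
    decoupling (centerPoint v) (Sum.inl 2) = v (Sum.inl 1) := by
  obtain ⟨h1, h2, h3⟩ := decoupling_inl (centerPoint v)
  rw [h1, h2, h3]
  refine ⟨?_, ?_, ?_⟩ <;> simp [centerPoint, div_eq_mul_inv]

theorem IsCenterNormalForm.generator_mem {W N : ℕ → Poly} (h : IsCenterNormalForm W N) {n : ℕ}
    (h1 : 1 ≤ n) (h2 : n ≤ 2) : W n ∈ offDiagonal :=
  mem_offDiagonal.2 (h.generator n h1 h2)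

theorem IsCenterNormalForm.eq_one {W N : ℕ → Poly} (h : IsCenterNormalForm W N) :
    N 1 = K 1 + adK (W 1) := by
  rw [h.transformed 1 (by norm_num), lieTransform_one, polyPoisson_K_zero]

theorem centerHam_one {W N : ℕ → Poly} (h : IsCenterNormalForm W N) (v : Phase 2) :
    centerHam N 1 v = (-1 + 4 / 7 * √7) * (ρ ^ 2 * τ⁻¹) * v (Sum.inr 0) ^ 3
      + (-27 / 2 - 54 / 7 * √7) * (ρ ^ 2 * τ⁻¹) * (v (Sum.inl 0) ^ 2 * v (Sum.inr 0))
      - 27 * (ρ ^ 2 * τ⁻¹) * (v (Sum.inr 0) * v (Sum.inl 1) ^ 2) := by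
  obtain ⟨e1, e2, e3⟩ := decoupling_centerPoint v
  rw [centerHam, h.eq_one, map_add,
    eval_centerPoint_adK_eq_zero (h.generator_mem le_rfl (by norm_num)), eval_K, eval_H_one,
    e1, e2, e3]
  have h2 := inv_τ_sq
  have h4 := ω_sq
  have h5 := sqrt_seven_sq
  generalize τ⁻¹ = T at *
  generalize √7 = q at *
  generalize ω = w at *
  generalize v (Sum.inl 0) = y
  generalize v (Sum.inl 1) = z
  generalize v (Sum.inr 0) = Y
  grind

/-! ### Saddle derivatives of the cubic terms and of the first generating function -/

theorem K_one :
    K 1 = MvPolynomial.C (9 * ρ ^ 2) *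
      ((MvPolynomial.C (2 * lam * σ⁻¹) * (x - px) + MvPolynomial.C (2 * τ⁻¹) * py) ^ 3
        - MvPolynomial.C (3 / 2)
          * (MvPolynomial.C (2 * lam * σ⁻¹) * (x - px) + MvPolynomial.C (2 * τ⁻¹) * py)
          * ((MvPolynomial.C ((lam ^ 2 - 9) * σ⁻¹) * (x + px)
            - MvPolynomial.C ((ω ^ 2 + 9) * τ⁻¹) * y) ^ 2 + z ^ 2)) := by
  refine MvPolynomial.funext fun ζ => ?_
  obtain ⟨e1, e2, e3⟩ := decoupling_inl ζ
  rw [eval_K, eval_H_one, e1, e2, e3]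
  simp only [x, y, z, px, py, div_eq_mul_inv, map_add, map_sub, map_mul, map_pow,
    MvPolynomial.eval_X, MvPolynomial.eval_C]

/-- The part of the derivatives of `K₁` along the saddle directions on which they differ in sign, up
to the factor `ρ² λ / σ`. -/
def saddleEven (v : Phase 2) : ℝ :=
  (-3 + 12 / 7 * √7) * v (Sum.inr 0) ^ 2 + (-27 / 2 - 54 / 7 * √7) * v (Sum.inl 0) ^ 2
    - 27 * v (Sum.inl 1) ^ 2

theorem eval_pderiv_K_one (v : Phase 2) :
    MvPolynomial.eval (centerPoint v) (MvPolynomial.pderiv (Sum.inl 0) (K 1))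
      = ρ ^ 2 * σ⁻¹ * (lam * saddleEven v
        + (27 - 108 / 7 * √7) * (v (Sum.inl 0) * v (Sum.inr 0))) ∧
    MvPolynomial.eval (centerPoint v) (MvPolynomial.pderiv (Sum.inr 0) (K 1))
      = ρ ^ 2 * σ⁻¹ * (-(lam * saddleEven v)
        + (27 - 108 / 7 * √7) * (v (Sum.inl 0) * v (Sum.inr 0))) := by
  have h2 := inv_τ_sq
  have h3 := lam_sq
  have h4 := ω_sq
  have h5 := sqrt_seven_sq
  rw [K_one]
  simp only [x, y, z, px, py, map_add, map_sub, map_mul, map_pow, Derivation.leibniz,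
    Derivation.leibniz_pow, MvPolynomial.pderiv_C, MvPolynomial.pderiv_X, MvPolynomial.eval_X,
    MvPolynomial.eval_C, smul_eq_mul]
  simp [centerPoint]
  rw [saddleEven]
  generalize τ⁻¹ = T at *
  generalize σ⁻¹ = S at *
  generalize √7 = q at *
  generalize ω = w at *
  generalize lam = l at *
  generalize v (Sum.inl 0) = y
  generalize v (Sum.inl 1) = z
  generalize v (Sum.inr 0) = Y
  constructor <;> grind

/-- The part of the derivatives of `W₁` along the saddle directions on which they agree, up to the
factor `ρ² / σ`. -/
def generatorEven : Poly :=
  MvPolynomial.C (-1317 / 691 + 1056 / 4837 * √7) * py ^ 2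
    + MvPolynomial.C (11799 / 1382 - 55134 / 4837 * √7) * y ^ 2
    + MvPolynomial.C (-375 / 29 - 48 / 29 * √7) * z ^ 2
    + MvPolynomial.C (-102 / 29 + 12 / 29 * √7) * pz ^ 2

/-- The part of the derivatives of `W₁` along the saddle directions on which they differ in sign, up
to the factor `ρ² / σ`. -/
def generatorOdd : Poly :=
  MvPolynomial.C lam * (MvPolynomial.C (-756 / 691 + 7236 / 4837 * √7) * (y * py)
    + MvPolynomial.C (102 / 29 - 12 / 29 * √7) * (z * pz))

theorem eval_generator (v : Phase 2) :
    MvPolynomial.eval (centerPoint v) generatorEven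
      = (-1317 / 691 + 1056 / 4837 * √7) * v (Sum.inr 0) ^ 2
        + (11799 / 1382 - 55134 / 4837 * √7) * v (Sum.inl 0) ^ 2
        + (-375 / 29 - 48 / 29 * √7) * v (Sum.inl 1) ^ 2
        + (-102 / 29 + 12 / 29 * √7) * v (Sum.inr 1) ^ 2 ∧
    MvPolynomial.eval (centerPoint v) generatorOdd
      = lam * ((-756 / 691 + 7236 / 4837 * √7) * (v (Sum.inl 0) * v (Sum.inr 0))
        + (102 / 29 - 12 / 29 * √7) * (v (Sum.inl 1) * v (Sum.inr 1))) := by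
  simp [generatorEven, generatorOdd, y, z, py, pz, centerPoint]

/-- Half the sum and half the difference of the equations for the two saddle derivatives of `W₁`.
This finite linear system for quadratic polynomials determines the coefficients of `generatorEven`
and `generatorOdd`. -/
theorem eval_adK_generator (v : Phase 2) :
    MvPolynomial.eval (centerPoint v) (adK generatorOdd)
      = lam * (MvPolynomial.eval (centerPoint v) generatorEven - saddleEven v) ∧
    MvPolynomial.eval (centerPoint v) (adK generatorEven)
      = lam * MvPolynomial.eval (centerPoint v) generatorOdd
        - (27 - 108 / 7 * √7) * (v (Sum.inl 0) * v (Sum.inr 0)) := by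
  have h3 := lam_sq
  have h4 := ω_sq
  have h5 := sqrt_seven_sq
  rw [(eval_generator v).1, (eval_generator v).2, eval_centerPoint_adK, eval_centerPoint_adK]
  simp only [generatorEven, generatorOdd, saddleEven, ν, y, z, py, pz,
    map_add, map_sub, map_mul, map_pow, Derivation.leibniz, Derivation.leibniz_pow,
    MvPolynomial.pderiv_C, MvPolynomial.pderiv_X, MvPolynomial.eval_X, MvPolynomial.eval_C,
    smul_eq_mul]
  simp [centerPoint]
  generalize √7 = q at *
  generalize ω = w at *
  generalize lam = l at *
  generalize v (Sum.inl 0) = y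
  generalize v (Sum.inl 1) = z
  generalize v (Sum.inr 0) = Y
  generalize v (Sum.inr 1) = Z
  constructor <;> grind

/-- The saddle derivatives of `N₁ = K₁ + adK W₁` vanish on the center manifold. The difference
between a saddle derivative of `W₁` and the explicit candidate is then an eigenvector with
eigenvalue `±λ` there, hence zero. -/
theorem eval_pderiv_generator {W N : ℕ → Poly} (h : IsCenterNormalForm W N) (v : Phase 2) :
    MvPolynomial.eval (centerPoint v) (MvPolynomial.pderiv (Sum.inl 0) (W 1))
      = ρ ^ 2 * σ⁻¹ * (MvPolynomial.eval (centerPoint v) generatorEven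
        + MvPolynomial.eval (centerPoint v) generatorOdd) ∧
    MvPolynomial.eval (centerPoint v) (MvPolynomial.pderiv (Sum.inr 0) (W 1))
      = ρ ^ 2 * σ⁻¹ * (MvPolynomial.eval (centerPoint v) generatorEven
        - MvPolynomial.eval (centerPoint v) generatorOdd) := by
  have hN := h.normal 1 (by norm_num)
  have hl := fun v => eval_centerPoint_eq_zero
    (pderiv_mem_offDiagonal_of_diagonal hN (i := Sum.inl 0) (Or.inl rfl)) v
  have hr := fun v => eval_centerPoint_eq_zero
    (pderiv_mem_offDiagonal_of_diagonal hN (i := Sum.inr 0) (Or.inr rfl)) v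
  simp only [h.eq_one, map_add, pderiv_adK_inl, pderiv_adK_inr, map_sub, map_mul,
    MvPolynomial.eval_C, (eval_pderiv_K_one _).1, (eval_pderiv_K_one _).2] at hl hr
  constructor
  · have := eval_centerPoint_eq_zero_of_adK (c := lam) lam_pos.ne'
      (h := MvPolynomial.pderiv (Sum.inl 0) (W 1)
        - (ρ ^ 2 * σ⁻¹) • (generatorEven + generatorOdd)) (fun v => ?_) v
    · simp only [map_sub, map_add, MvPolynomial.smul_eval] at this
      linear_combination this
    · simp only [map_sub, map_add, MvPolynomial.smul_eval, Derivation.map_smul]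
      linear_combination hl v - ρ ^ 2 * σ⁻¹ * ((eval_adK_generator v).1 + (eval_adK_generator v).2)
  · have := eval_centerPoint_eq_zero_of_adK (c := -lam) (neg_ne_zero.2 lam_pos.ne')
      (h := MvPolynomial.pderiv (Sum.inr 0) (W 1)
        - (ρ ^ 2 * σ⁻¹) • (generatorEven - generatorOdd)) (fun v => ?_) v
    · simp only [map_sub, MvPolynomial.smul_eval] at this
      linear_combination this
    · simp only [map_sub, MvPolynomial.smul_eval, Derivation.map_smul]
      linear_combination hr v - ρ ^ 2 * σ⁻¹ * ((eval_adK_generator v).2 - (eval_adK_generator v).1)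

/-- On the center manifold `adK W₂` vanishes. So does `{N₁, W₁}`: only saddle derivatives survive in
a bracket with an off-diagonal polynomial, and those of `N₁` are zero. What remains is `K₂` and the
saddle part of `{K₁, W₁}`. -/
theorem centerHam_two {W N : ℕ → Poly} (h : IsCenterNormalForm W N) (v : Phase 2) :
    centerHam N 2 v = ρ * (
      (-51/812 + 3/406 * √7) * (v (Sum.inr 0) ^ 2 * v (Sum.inr 1) ^ 2)
      + (-10775/49752 + 20536/304731 * √7) * v (Sum.inr 0) ^ 4
      + (27/116 + 81/406 * √7) * (v (Sum.inl 1) ^ 2 * v (Sum.inr 1) ^ 2)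
      + (-1740411/561092 + 71883/40078 * √7) * (v (Sum.inl 1) ^ 2 * v (Sum.inr 0) ^ 2)
      + (-999/232 + 459/406 * √7) * v (Sum.inl 1) ^ 4
      + (459/812 - 27/406 * √7)
        * (v (Sum.inl 0) * v (Sum.inl 1) * v (Sum.inr 0) * v (Sum.inr 1))
      + (837/1624 + 135/812 * √7) * (v (Sum.inl 0) ^ 2 * v (Sum.inr 1) ^ 2)
      + (84645/38696 + 17361/135436 * √7) * (v (Sum.inl 0) ^ 2 * v (Sum.inr 0) ^ 2)
      + (218835/160312 - 498987/280546 * √7) * (v (Sum.inl 0) ^ 2 * v (Sum.inl 1) ^ 2)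
      + (-247455/154784 - 53541/270872 * √7) * v (Sum.inl 0) ^ 4) := by
  have hW1 := h.generator_mem (n := 1) le_rfl (by norm_num)
  have hW2 := h.generator_mem (n := 2) (by norm_num) le_rfl
  have hN := h.normal 1 (by norm_num)
  have hN2 : N 2 = K 2 + (polyPoisson (K 1) (W 1) + adK (W 2)) + polyPoisson (N 1) (W 1) := by
    rw [h.transformed 2 le_rfl, lieTransform_two, polyPoisson_K_zero (W 2), h.eq_one,
      polyPoisson_K_zero]
  obtain ⟨e1, e2, e3⟩ := decoupling_centerPoint v
  rw [centerHam, hN2, map_add, map_add, map_add, eval_centerPoint_adK_eq_zero hW2,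
    eval_centerPoint_polyPoisson_offDiagonal _ hW1, eval_centerPoint_polyPoisson_offDiagonal _ hW1,
    eval_centerPoint_eq_zero (pderiv_mem_offDiagonal_of_diagonal hN (i := Sum.inl 0) (Or.inl rfl)),
    eval_centerPoint_eq_zero (pderiv_mem_offDiagonal_of_diagonal hN (i := Sum.inr 0) (Or.inr rfl)),
    (eval_pderiv_generator h v).1, (eval_pderiv_generator h v).2, (eval_pderiv_K_one v).1,
    (eval_pderiv_K_one v).2, eval_K, eval_H_two, e1, e2, e3, (eval_generator v).1,
    (eval_generator v).2, saddleEven]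
  have h0 : ρ ^ 4 = ρ / 3 := by linear_combination ρ * ρ_pow_three
  have h1 := inv_σ_sq
  have h2 := inv_τ_sq
  have h3 := lam_sq
  have h4 := ω_sq
  have h5 := sqrt_seven_sq
  generalize τ⁻¹ = T at *
  generalize σ⁻¹ = S at *
  generalize √7 = q at *
  generalize ω = w at *
  generalize lam = l at *
  generalize ρ = r at *
  generalize v (Sum.inl 0) = y
  generalize v (Sum.inl 1) = z
  generalize v (Sum.inr 0) = Y
  generalize v (Sum.inr 1) = Z
  grind

/-! ### Lissajous variables -/

theorem isOpen_lissajousDomain : IsOpen lissajousDomain :=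
  isOpen_lt (by fun_prop) (by fun_prop)

theorem s_pos {v : Phase 2} (hv : v ∈ lissajousDomain) : 0 < s (v (Sum.inr 0)) (v (Sum.inr 1)) := by
  have h := (abs_lt.1 (show |v (Sum.inr 1)| < v (Sum.inr 0) from hv)).1
  have := ω_pos
  exact Real.sqrt_pos.2 (div_pos (by linarith) (by linarith))

theorem d_pos {v : Phase 2} (hv : v ∈ lissajousDomain) : 0 < d (v (Sum.inr 0)) (v (Sum.inr 1)) := by
  have h := (abs_lt.1 (show |v (Sum.inr 1)| < v (Sum.inr 0) from hv)).2
  have := ω_pos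
  exact Real.sqrt_pos.2 (div_pos (by linarith) (by linarith))

theorem contDiffOn_s :
    ContDiffOn ℝ (⊤ : ℕ∞) (fun v : Phase 2 => s (v (Sum.inr 0)) (v (Sum.inr 1))) lissajousDomain := by
  intro v hv
  refine ContDiffAt.contDiffWithinAt (ContDiffAt.sqrt (by fun_prop) ?_)
  exact (Real.sqrt_pos.1 (s_pos hv)).ne'

theorem contDiffOn_d :
    ContDiffOn ℝ (⊤ : ℕ∞) (fun v : Phase 2 => d (v (Sum.inr 0)) (v (Sum.inr 1))) lissajousDomain := by
  intro v hv
  refine ContDiffAt.contDiffWithinAt (ContDiffAt.sqrt (by fun_prop) ?_)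
  exact (Real.sqrt_pos.1 (d_pos hv)).ne'

theorem contDiffOn_lissajous : ContDiffOn ℝ (⊤ : ℕ∞) lissajous lissajousDomain := by
  have h1 := contDiffOn_s
  have h2 := contDiffOn_d
  rw [contDiffOn_pi]
  rintro (i | i) <;> fin_cases i <;> simp [lissajous] <;> fun_prop

/-- A coordinate of the plane problem as a continuous linear form. -/
def coord (i : Fin 2 ⊕ Fin 2) : Phase 2 →L[ℝ] ℝ := ContinuousLinearMap.proj i

theorem hasFDerivAt_s {v : Phase 2} (hv : v ∈ lissajousDomain) :
    HasFDerivAt (fun v : Phase 2 => s (v (Sum.inr 0)) (v (Sum.inr 1)))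
      ((1 / (4 * ω * s (v (Sum.inr 0)) (v (Sum.inr 1)))) •
        (coord (Sum.inr 0) + coord (Sum.inr 1))) v := by
  have h1 : HasFDerivAt (fun v : Phase 2 => (v (Sum.inr 0) + v (Sum.inr 1)) * (2 * ω)⁻¹)
      ((2 * ω)⁻¹ • (coord (Sum.inr 0) + coord (Sum.inr 1))) v :=
    ((coord (Sum.inr 0)).hasFDerivAt.add
      (coord (Sum.inr 1)).hasFDerivAt).mul_const _
  have h2 := h1.sqrt (Real.sqrt_pos.1 (s_pos hv)).ne'
  refine h2.congr_fderiv ?_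
  have hs := (s_pos hv).ne'
  have hω := ω_pos.ne'
  rw [smul_smul]
  congr 1
  change 1 / (2 * s (v (Sum.inr 0)) (v (Sum.inr 1))) * (2 * ω)⁻¹ = _
  field_simp
  norm_num

theorem hasFDerivAt_d {v : Phase 2} (hv : v ∈ lissajousDomain) :
    HasFDerivAt (fun v : Phase 2 => d (v (Sum.inr 0)) (v (Sum.inr 1)))
      ((1 / (4 * ω * d (v (Sum.inr 0)) (v (Sum.inr 1)))) •
        (coord (Sum.inr 0) - coord (Sum.inr 1))) v := by
  have h1 : HasFDerivAt (fun v : Phase 2 => (v (Sum.inr 0) - v (Sum.inr 1)) * (2 * ω)⁻¹)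
      ((2 * ω)⁻¹ • (coord (Sum.inr 0) - coord (Sum.inr 1))) v :=
    ((coord (Sum.inr 0)).hasFDerivAt.sub
      (coord (Sum.inr 1)).hasFDerivAt).mul_const _
  have h2 := h1.sqrt (Real.sqrt_pos.1 (d_pos hv)).ne'
  refine h2.congr_fderiv ?_
  have hs := (d_pos hv).ne'
  have hω := ω_pos.ne'
  rw [smul_smul]
  congr 1
  change 1 / (2 * d (v (Sum.inr 0)) (v (Sum.inr 1))) * (2 * ω)⁻¹ = _
  field_simp
  norm_num

/-- Partial derivatives of a superposition of waves in `g + ℓ` and `g - ℓ` with the amplitudes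
`s` and `d`. -/
theorem partialD_wave {T T' U U' : ℝ → ℝ} (hT : ∀ t, HasDerivAt T (T' t) t)
    (hU : ∀ t, HasDerivAt U (U' t) t) (a b : ℝ) {v : Phase 2} (hv : v ∈ lissajousDomain)
    {f : Phase 2 → ℝ}
    (hf : f = fun v => a * (s (v (Sum.inr 0)) (v (Sum.inr 1)) * T (v (Sum.inl 1) + v (Sum.inl 0)))
      + b * (d (v (Sum.inr 0)) (v (Sum.inr 1)) * U (v (Sum.inl 1) - v (Sum.inl 0)))) :
    partialD f (Sum.inl 0) v
      = a * s (v (Sum.inr 0)) (v (Sum.inr 1)) * T' (v (Sum.inl 1) + v (Sum.inl 0))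
        - b * d (v (Sum.inr 0)) (v (Sum.inr 1)) * U' (v (Sum.inl 1) - v (Sum.inl 0)) ∧
    partialD f (Sum.inl 1) v
      = a * s (v (Sum.inr 0)) (v (Sum.inr 1)) * T' (v (Sum.inl 1) + v (Sum.inl 0))
        + b * d (v (Sum.inr 0)) (v (Sum.inr 1)) * U' (v (Sum.inl 1) - v (Sum.inl 0)) ∧
    partialD f (Sum.inr 0) v
      = a * T (v (Sum.inl 1) + v (Sum.inl 0)) * (1 / (4 * ω * s (v (Sum.inr 0)) (v (Sum.inr 1))))
        + b * U (v (Sum.inl 1) - v (Sum.inl 0)) * (1 / (4 * ω * d (v (Sum.inr 0)) (v (Sum.inr 1)))) ∧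
    partialD f (Sum.inr 1) v
      = a * T (v (Sum.inl 1) + v (Sum.inl 0)) * (1 / (4 * ω * s (v (Sum.inr 0)) (v (Sum.inr 1))))
        - b * U (v (Sum.inl 1) - v (Sum.inl 0))
          * (1 / (4 * ω * d (v (Sum.inr 0)) (v (Sum.inr 1)))) := by
  have hp : HasFDerivAt (fun v : Phase 2 => v (Sum.inl 1) + v (Sum.inl 0))
      (coord (Sum.inl 1) + coord (Sum.inl 0)) v :=
    (coord (Sum.inl 1)).hasFDerivAt.add
      (coord (Sum.inl 0)).hasFDerivAt
  have hm : HasFDerivAt (fun v : Phase 2 => v (Sum.inl 1) - v (Sum.inl 0))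
      (coord (Sum.inl 1) - coord (Sum.inl 0)) v :=
    (coord (Sum.inl 1)).hasFDerivAt.sub
      (coord (Sum.inl 0)).hasFDerivAt
  have h1 := ((hasFDerivAt_s hv).mul ((hT _).comp_hasFDerivAt v hp)).const_mul a
  have h2 := ((hasFDerivAt_d hv).mul ((hU _).comp_hasFDerivAt v hm)).const_mul b
  have h3 := (h1.add h2).fderiv
  have h4 := (congrArg (fun k => fderiv ℝ k v) hf).trans h3
  simp only [partialD, h4]
  refine ⟨?_, ?_, ?_, ?_⟩ <;> simp [coord] <;> ring

theorem isCanonicalOn_lissajous : IsCanonicalOn lissajous lissajousDomain := by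
  intro v hv
  refine ⟨differentiableAt_of_contDiffOn isOpen_lissajousDomain contDiffOn_lissajous hv, ?_⟩
  obtain ⟨y1, y2, y3, y4⟩ := partialD_wave (f := fun u => lissajous u (Sum.inl 0))
    Real.hasDerivAt_cos Real.hasDerivAt_cos 1 (-1) hv (by ext u; simp [lissajous]; ring)
  obtain ⟨z1, z2, z3, z4⟩ := partialD_wave (f := fun u => lissajous u (Sum.inl 1))
    Real.hasDerivAt_sin Real.hasDerivAt_sin 1 (-1) hv (by ext u; simp [lissajous]; ring)
  obtain ⟨Y1, Y2, Y3, Y4⟩ := partialD_wave (f := fun u => lissajous u (Sum.inr 0))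
    Real.hasDerivAt_sin Real.hasDerivAt_sin (-ω) (-ω) hv (by ext u; simp [lissajous]; ring)
  obtain ⟨Z1, Z2, Z3, Z4⟩ := partialD_wave (f := fun u => lissajous u (Sum.inr 1))
    Real.hasDerivAt_cos Real.hasDerivAt_cos ω ω hv (by ext u; simp [lissajous]; ring)
  have hs := (s_pos hv).ne'
  have hd := (d_pos hv).ne'
  have hω := ω_pos.ne'
  have t1 := Real.sin_sq_add_cos_sq (v (Sum.inl 1) + v (Sum.inl 0))
  have t2 := Real.sin_sq_add_cos_sq (v (Sum.inl 1) - v (Sum.inl 0))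
  intro i j
  fin_cases i <;> fin_cases j <;>
    simp [poisson, Fin.sum_univ_two, y1, y2, y3, y4, z1, z2, z3, z4, Y1, Y2, Y3, Y4, Z1, Z2, Z3, Z4]
  all_goals
    generalize s (v (Sum.inr 0)) (v (Sum.inr 1)) = S at *
    generalize d (v (Sum.inr 0)) (v (Sum.inr 1)) = D at *
    generalize sin (v (Sum.inl 1) + v (Sum.inl 0)) = s1 at *
    generalize cos (v (Sum.inl 1) + v (Sum.inl 0)) = c1 at *
    generalize sin (v (Sum.inl 1) - v (Sum.inl 0)) = s2 at *
    generalize cos (v (Sum.inl 1) - v (Sum.inl 0)) = c2 at *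
    clear y1 y2 y3 y4 z1 z2 z3 z4 Y1 Y2 Y3 Y4 Z1 Z2 Z3 Z4
    grind

/-! ### Averaging in polynomial form -/

/-- Polynomials on the phase space of two degrees of freedom. -/
abbrev PolyTwo : Type := MvPolynomial (Fin 2 ⊕ Fin 2) ℝ

def y₂ : PolyTwo := MvPolynomial.X (Sum.inl 0)
def z₂ : PolyTwo := MvPolynomial.X (Sum.inl 1)
def Y₂ : PolyTwo := MvPolynomial.X (Sum.inr 0)
def Z₂ : PolyTwo := MvPolynomial.X (Sum.inr 1)

/-- The common factor of the coefficients of the cubic terms. -/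
def θ : ℝ := ρ ^ 2 * τ⁻¹

theorem θ_sq : θ ^ 2 = ρ * (4 * √7 - 7) / 1512 := by
  rw [θ, mul_pow, inv_τ_sq]
  linear_combination ρ * (4 * √7 - 7) / 504 * ρ_pow_three

/-- Energies of the in-plane and of the detuned out-of-plane oscillations. -/
def energyY : PolyTwo :=
  MvPolynomial.C (1 / 2) * (Y₂ ^ 2 + MvPolynomial.C (ω ^ 2) * y₂ ^ 2)

def energyZ : PolyTwo :=
  MvPolynomial.C (1 / 2) * (Z₂ ^ 2 + MvPolynomial.C (ω ^ 2) * z₂ ^ 2)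

/-- The detuned Hamiltonian on the center manifold. -/
def detunedPoly : ℕ → PolyTwo
  | 0 => energyY + energyZ
  | 1 => MvPolynomial.C ((-1 + 4 / 7 * √7) * θ) * Y₂ ^ 3
      + MvPolynomial.C ((-27 / 2 - 54 / 7 * √7) * θ) * (y₂ ^ 2 * Y₂)
      + MvPolynomial.C (-27 * θ) * (Y₂ * z₂ ^ 2)
      -- The detuning term: the coefficient is `-ω²δ/2`, as `ω²δ = 2√7 - 5`.
      + MvPolynomial.C (5 / 2 - √7) * z₂ ^ 2
  | _ =>
    MvPolynomial.C ((-247455/154784 - 53541/270872 * √7) * ρ) * (y₂ ^ 4)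
          + MvPolynomial.C ((218835/160312 - 498987/280546 * √7) * ρ) * (y₂ ^ 2 * z₂ ^ 2)
          + MvPolynomial.C ((84645/38696 + 17361/135436 * √7) * ρ) * (y₂ ^ 2 * Y₂ ^ 2)
          + MvPolynomial.C ((837/1624 + 135/812 * √7) * ρ) * (y₂ ^ 2 * Z₂ ^ 2)
          + MvPolynomial.C ((459/812 - 27/406 * √7) * ρ) * (y₂ * z₂ * Y₂ * Z₂)
          + MvPolynomial.C ((-999/232 + 459/406 * √7) * ρ) * (z₂ ^ 4)
          + MvPolynomial.C ((-1740411/561092 + 71883/40078 * √7) * ρ) * (z₂ ^ 2 * Y₂ ^ 2)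
          + MvPolynomial.C ((27/116 + 81/406 * √7) * ρ) * (z₂ ^ 2 * Z₂ ^ 2)
          + MvPolynomial.C ((-10775/49752 + 20536/304731 * √7) * ρ) * (Y₂ ^ 4)
          + MvPolynomial.C ((-51/812 + 3/406 * √7) * ρ) * (Y₂ ^ 2 * Z₂ ^ 2)

/-- Generating function of the first order of the averaging. -/
def generatorOne : PolyTwo :=
  MvPolynomial.C ((3/2 - 30/7 * √7) * θ) * (y₂ ^ 3)
    + MvPolynomial.C ((-9) * θ) * (y₂ * z₂ ^ 2)
    + MvPolynomial.C ((-1 + 4/7 * √7) * θ) * (y₂ * Y₂ ^ 2)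
    + MvPolynomial.C ((-2/3 - 4/3 * √7) * θ) * (y₂ * Z₂ ^ 2)
    + MvPolynomial.C ((2/3 + 4/3 * √7) * θ) * (z₂ * Y₂ * Z₂)
    + MvPolynomial.C (23/108 - 2/27 * √7) * (z₂ * Z₂)

/-- A polynomial whose bracket with the quadratic Hamiltonian is `generatorOne`. -/
def primitiveOne : PolyTwo :=
  MvPolynomial.C ((13/6 + 1/21 * √7) * θ) * (y₂ ^ 2 * Y₂)
    + MvPolynomial.C ((-4/9 - 8/9 * √7) * θ) * (y₂ * z₂ * Z₂)
    + MvPolynomial.C ((7/9 + 14/9 * √7) * θ) * (z₂ ^ 2 * Y₂)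
    + MvPolynomial.C ((-4/243 + 214/1701 * √7) * θ) * (Y₂ ^ 3)
    + MvPolynomial.C ((58/243 + 8/243 * √7) * θ) * (Y₂ * Z₂ ^ 2)
    + MvPolynomial.C (23/216 - 1/27 * √7) * (z₂ ^ 2)

/-- Generating function of the second order of the averaging. -/
def generatorTwo : PolyTwo :=
  MvPolynomial.C ((13557/19348 + 5937/77392 * √7) * ρ) * (y₂ ^ 3 * Y₂)
    + MvPolynomial.C ((64610425/53864832 - 7796339/26932416 * √7) * ρ) * (y₂ ^ 2 * z₂ * Z₂)
    + MvPolynomial.C ((-13555133/17954944 + 4973023/8977472 * √7) * ρ) * (y₂ * z₂ ^ 2 * Y₂)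
    + MvPolynomial.C ((-6677/87066 + 18421/696528 * √7) * ρ) * (y₂ * Y₂ ^ 3)
    + MvPolynomial.C ((201886963/1454350464 - 12676987/363587616 * √7) * ρ) * (y₂ * Y₂ * Z₂ ^ 2)
    + MvPolynomial.C ((-119/928 + 571/3248 * √7) * ρ) * (z₂ ^ 3 * Z₂)
    + MvPolynomial.C ((-109622879/484783488 + 9534407/121195872 * √7) * ρ) * (z₂ * Y₂ ^ 2 * Z₂)
    + MvPolynomial.C ((1609/75168 + 137/131544 * √7) * ρ) * (z₂ * Z₂ ^ 3)
    + MvPolynomial.C ((115/18 - 20/9 * √7) * θ) * (y₂ * z₂ ^ 2)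
    + MvPolynomial.C ((1157/243 - 494/243 * √7) * θ) * (y₂ * Z₂ ^ 2)
    + MvPolynomial.C ((-1424/243 + 608/243 * √7) * θ) * (z₂ * Y₂ * Z₂)
    + MvPolynomial.C (977/2916 - 92/729 * √7) * (z₂ * Z₂)

/-- A polynomial whose bracket with the quadratic Hamiltonian is `generatorTwo`. -/
def primitiveTwo : PolyTwo :=
  MvPolynomial.C ((181005/1238272 + 8691/619136 * √7) * ρ) * (y₂ ^ 4)
    + MvPolynomial.C ((2445881/53864832 + 321023/3847488 * √7) * ρ) * (y₂ ^ 2 * z₂ ^ 2)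
    + MvPolynomial.C ((-41677/5572224 - 6515/1393056 * √7) * ρ) * (y₂ ^ 2 * Y₂ ^ 2)
    + MvPolynomial.C ((-22162285/2908700928 - 3209333/727175232 * √7) * ρ) * (y₂ ^ 2 * Z₂ ^ 2)
    + MvPolynomial.C ((153291065/727175232 - 5126167/90896904 * √7) * ρ) * (y₂ * z₂ * Y₂ * Z₂)
    + MvPolynomial.C ((-127/5568 + 433/9744 * √7) * ρ) * (z₂ ^ 4)
    + MvPolynomial.C ((-552917885/2908700928 + 38070875/727175232 * √7) * ρ) * (z₂ ^ 2 * Y₂ ^ 2)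
    + MvPolynomial.C ((179/150336 + 185/131544 * √7) * ρ) * (z₂ ^ 2 * Z₂ ^ 2)
    + MvPolynomial.C ((-408143/100300032 + 5815/7164288 * √7) * ρ) * (Y₂ ^ 4)
    + MvPolynomial.C ((-267769951/39267462528 + 30229427/19633731264 * √7) * ρ) * (Y₂ ^ 2 * Z₂ ^ 2)
    + MvPolynomial.C ((217/4059072 - 1193/3551688 * √7) * ρ) * (Z₂ ^ 4)
    + MvPolynomial.C ((4183/729 - 1786/729 * √7) * θ) * (y₂ * z₂ * Z₂)
    + MvPolynomial.C ((-7031/1458 + 1501/729 * √7) * θ) * (z₂ ^ 2 * Y₂)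
    + MvPolynomial.C ((-3544/19683 + 1120/19683 * √7) * θ) * (Y₂ * Z₂ ^ 2)
    + MvPolynomial.C (977/7776 - 23/486 * √7) * (z₂ ^ 2)
    + MvPolynomial.C (4175/629856 - 793/314928 * √7) * (Z₂ ^ 2)

/-- The averaged Hamiltonian of the first order. -/
def averagedOne : PolyTwo := MvPolynomial.C (-(δ / 2)) * energyZ

/-- The averaged Hamiltonian of the second order. -/
def averagedTwo : PolyTwo :=
  MvPolynomial.C (-(δ ^ 2 / 4)) * energyZ
    + MvPolynomial.C ((-5356/43533 - 701/174132 * √7) * ρ) * energyY ^ 2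
    + MvPolynomial.C ((-67788107/181793808 + 2517971/45448452 * √7) * ρ) * (energyY * energyZ)
    + MvPolynomial.C ((-1609/18792 - 137/32886 * √7) * ρ) * energyZ ^ 2
    + MvPolynomial.C ((-7414249/4488736 + 1933259/2244368 * √7) * ρ) * (y₂ * Z₂ - z₂ * Y₂) ^ 2

theorem eval_mvPoisson_two (f g : PolyTwo) (v : Phase 2) :
    MvPolynomial.eval v (mvPoisson f g)
      = MvPolynomial.eval v (MvPolynomial.pderiv (Sum.inl 0) f)
          * MvPolynomial.eval v (MvPolynomial.pderiv (Sum.inr 0) g)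
        - MvPolynomial.eval v (MvPolynomial.pderiv (Sum.inr 0) f)
          * MvPolynomial.eval v (MvPolynomial.pderiv (Sum.inl 0) g)
        + (MvPolynomial.eval v (MvPolynomial.pderiv (Sum.inl 1) f)
          * MvPolynomial.eval v (MvPolynomial.pderiv (Sum.inr 1) g)
        - MvPolynomial.eval v (MvPolynomial.pderiv (Sum.inr 1) f)
          * MvPolynomial.eval v (MvPolynomial.pderiv (Sum.inl 1) g)) := by
  simp [mvPoisson, Fin.sum_univ_two]
  ring

/-- The homological equation is checked between Cartesian polynomials, where it is finite algebra,
and carried to Lissajous variables afterwards. -/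
theorem mvPoisson_generatorOne :
    detunedPoly 1 + mvPoisson (detunedPoly 0) generatorOne = averagedOne := by
  refine MvPolynomial.funext fun v => ?_
  have h0 := θ_sq
  have h4 := ω_sq
  have h5 := sqrt_seven_sq
  simp only [map_add, eval_mvPoisson_two]
  simp only [detunedPoly, generatorOne, averagedOne, δ_eq, energyY, energyZ, y₂, z₂, Y₂, Z₂, map_add, map_sub, map_mul, map_pow,
    Derivation.leibniz, Derivation.leibniz_pow, MvPolynomial.pderiv_C, MvPolynomial.pderiv_X,
    MvPolynomial.eval_X, MvPolynomial.eval_C, smul_eq_mul]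
  simp
  generalize √7 = q at *
  generalize ω = w at *
  generalize θ = θ at *
  generalize ρ = r at *
  generalize v (Sum.inl 0) = y
  generalize v (Sum.inl 1) = z
  generalize v (Sum.inr 0) = Y
  generalize v (Sum.inr 1) = Z
  grind

/-- A generator of this form becomes `ω` times an `ℓ`-derivative of a periodic function in Lissajous
variables, which gives it zero mean. -/
theorem mvPoisson_primitiveOne :
    mvPoisson primitiveOne (detunedPoly 0) = generatorOne := by
  refine MvPolynomial.funext fun v => ?_
  have h0 := θ_sq
  have h4 := ω_sq
  have h5 := sqrt_seven_sq
  simp only [eval_mvPoisson_two]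
  simp only [detunedPoly, generatorOne, primitiveOne, energyY, energyZ, y₂, z₂, Y₂, Z₂, map_add, map_sub, map_mul, map_pow,
    Derivation.leibniz, Derivation.leibniz_pow, MvPolynomial.pderiv_C, MvPolynomial.pderiv_X,
    MvPolynomial.eval_X, MvPolynomial.eval_C, smul_eq_mul]
  simp
  generalize √7 = q at *
  generalize ω = w at *
  generalize θ = θ at *
  generalize ρ = r at *
  generalize v (Sum.inl 0) = y
  generalize v (Sum.inl 1) = z
  generalize v (Sum.inr 0) = Y
  generalize v (Sum.inr 1) = Z
  grind

theorem mvPoisson_primitiveTwo :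
    mvPoisson primitiveTwo (detunedPoly 0) = generatorTwo := by
  refine MvPolynomial.funext fun v => ?_
  have h0 := θ_sq
  have h4 := ω_sq
  have h5 := sqrt_seven_sq
  simp only [eval_mvPoisson_two]
  simp only [detunedPoly, generatorTwo, primitiveTwo, energyY, energyZ, y₂, z₂, Y₂, Z₂, map_add, map_sub, map_mul, map_pow,
    Derivation.leibniz, Derivation.leibniz_pow, MvPolynomial.pderiv_C, MvPolynomial.pderiv_X,
    MvPolynomial.eval_X, MvPolynomial.eval_C, smul_eq_mul]
  simp
  generalize √7 = q at *
  generalize ω = w at *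
  generalize θ = θ at *
  generalize ρ = r at *
  generalize v (Sum.inl 0) = y
  generalize v (Sum.inl 1) = z
  generalize v (Sum.inr 0) = Y
  generalize v (Sum.inr 1) = Z
  grind

theorem mvPoisson_generatorTwo :
    detunedPoly 2 + (mvPoisson (detunedPoly 1) generatorOne + mvPoisson (detunedPoly 0) generatorTwo)
      + mvPoisson averagedOne generatorOne = averagedTwo := by
  refine MvPolynomial.funext fun v => ?_
  have h0 := θ_sq
  have h4 := ω_sq
  have h5 := sqrt_seven_sq
  simp only [map_add, eval_mvPoisson_two]
  simp only [detunedPoly, generatorOne, generatorTwo, averagedOne, averagedTwo, δ_eq, energyY, energyZ, y₂, z₂, Y₂, Z₂, map_add, map_sub, map_mul, map_pow,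
    Derivation.leibniz, Derivation.leibniz_pow, MvPolynomial.pderiv_C, MvPolynomial.pderiv_X,
    MvPolynomial.eval_X, MvPolynomial.eval_C, smul_eq_mul]
  simp
  generalize √7 = q at *
  generalize ω = w at *
  generalize θ = θ at *
  generalize ρ = r at *
  generalize v (Sum.inl 0) = y
  generalize v (Sum.inl 1) = z
  generalize v (Sum.inr 0) = Y
  generalize v (Sum.inr 1) = Z
  grind

/-! ### Averaging over the elliptic anomaly -/

/-- A polynomial in Lissajous variables. -/
def pull (p : PolyTwo) (v : Phase 2) : ℝ := MvPolynomial.eval (lissajous v) p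

theorem contDiffOn_pull (p : PolyTwo) : ContDiffOn ℝ (⊤ : ℕ∞) (pull p) lissajousDomain :=
  (contDiff_eval p).comp_contDiffOn contDiffOn_lissajous

theorem poisson_pull (p q : PolyTwo) {v : Phase 2} (hv : v ∈ lissajousDomain) :
    poisson (pull p) (pull q) v = pull (mvPoisson p q) v := by
  have h := poisson_comp (f := fun u => MvPolynomial.eval u p) (g := fun u => MvPolynomial.eval u q)
    isCanonicalOn_lissajous hv (differentiableAt_eval p _) (differentiableAt_eval q _)
  rw [poisson_eval] at h
  exact h

theorem abs_le_of_mem {v : Phase 2} (hv : v ∈ lissajousDomain) : |v (Sum.inr 1)| ≤ v (Sum.inr 0) :=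
  le_of_lt hv

/-- The cross terms of the two waves combine to `cos((g + ℓ) + (g - ℓ)) = cos 2g`, so `ℓ` drops out.
Polynomials in these three quantities are therefore already averaged. -/
theorem pull_energy {v : Phase 2} (hv : v ∈ lissajousDomain) :
    pull energyY v = ω / 2 * (v (Sum.inr 0)
      - 2 * I₁ (v (Sum.inl 1)) (v (Sum.inr 0)) (v (Sum.inr 1))) ∧
    pull energyZ v = ω / 2 * (v (Sum.inr 0)
      + 2 * I₁ (v (Sum.inl 1)) (v (Sum.inr 0)) (v (Sum.inr 1))) ∧
    pull (y₂ * Z₂ - z₂ * Y₂) v = v (Sum.inr 1) := by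
  have hs := s_sq (abs_le_of_mem hv)
  have hd := d_sq (abs_le_of_mem hv)
  have hω := ω_pos.ne'
  have t1 := Real.sin_sq_add_cos_sq (v (Sum.inl 1) + v (Sum.inl 0))
  have t2 := Real.sin_sq_add_cos_sq (v (Sum.inl 1) - v (Sum.inl 0))
  have t3 : cos (2 * v (Sum.inl 1))
      = cos (v (Sum.inl 1) + v (Sum.inl 0)) * cos (v (Sum.inl 1) - v (Sum.inl 0))
        - sin (v (Sum.inl 1) + v (Sum.inl 0)) * sin (v (Sum.inl 1) - v (Sum.inl 0)) := by
    rw [← Real.cos_add]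
    ring_nf
  rw [I₁, t3]
  simp only [pull, energyY, energyZ, y₂, z₂, Y₂, Z₂, map_add, map_sub, map_mul, map_pow,
    MvPolynomial.eval_X, MvPolynomial.eval_C, lissajous]
  simp only [Sum.elim_inl, Sum.elim_inr, Matrix.cons_val_zero, Matrix.cons_val_one]
  generalize s (v (Sum.inr 0)) (v (Sum.inr 1)) = S at *
  generalize d (v (Sum.inr 0)) (v (Sum.inr 1)) = D at *
  generalize sin (v (Sum.inl 1) + v (Sum.inl 0)) = s1 at *
  generalize cos (v (Sum.inl 1) + v (Sum.inl 0)) = c1 at *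
  generalize sin (v (Sum.inl 1) - v (Sum.inl 0)) = s2 at *
  generalize cos (v (Sum.inl 1) - v (Sum.inl 0)) = c2 at *
  generalize v (Sum.inr 0) = L at *
  generalize v (Sum.inr 1) = G at *
  clear hv t3
  refine ⟨?_, ?_, ?_⟩ <;> grind

theorem pull_detunedPoly_zero {v : Phase 2} (hv : v ∈ lissajousDomain) :
    pull (detunedPoly 0) v = ω * v (Sum.inr 0) := by
  obtain ⟨h1, h2, -⟩ := pull_energy hv
  have h : pull (detunedPoly 0) v = pull energyY v + pull energyZ v := map_add _ _ _
  rw [h, h1, h2]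
  ring

theorem pull_averagedOne {v : Phase 2} (hv : v ∈ lissajousDomain) :
    pull averagedOne v = B₁ (v (Sum.inl 1)) (v (Sum.inr 0)) (v (Sum.inr 1)) := by
  obtain ⟨-, h2, -⟩ := pull_energy hv
  have h : pull averagedOne v = -(δ / 2) * pull energyZ v := by simp [pull, averagedOne]
  rw [h, h2, B₁, I₁]
  ring

/-- The energies and the angular momentum do not involve `I₂`; the term `I₂²` of `B₂` is matched
through the equation of the sphere. -/
theorem pull_averagedTwo {v : Phase 2} (hv : v ∈ lissajousDomain) :
    pull averagedTwo v = B₂ (v (Sum.inl 1)) (v (Sum.inr 0)) (v (Sum.inr 1)) := by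
  obtain ⟨h1, h2, h3⟩ := pull_energy hv
  have h : pull averagedTwo v = -(δ ^ 2 / 4) * pull energyZ v
      + (-5356/43533 - 701/174132 * √7) * ρ * pull energyY v ^ 2
      + (-67788107/181793808 + 2517971/45448452 * √7) * ρ * (pull energyY v * pull energyZ v)
      + (-1609/18792 - 137/32886 * √7) * ρ * pull energyZ v ^ 2
      + (-7414249/4488736 + 1933259/2244368 * √7) * ρ * pull (y₂ * Z₂ - z₂ * Y₂) v ^ 2 := by
    simp [pull, averagedTwo]
  have hI := hopf_sphere (g := v (Sum.inl 1)) (abs_le_of_mem hv)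
  have hB : B₁ (v (Sum.inl 1)) (v (Sum.inr 0)) (v (Sum.inr 1))
      = -(δ / 2) * (ω / 2 * (v (Sum.inr 0)
        + 2 * I₁ (v (Sum.inl 1)) (v (Sum.inr 0)) (v (Sum.inr 1)))) := by
    rw [B₁, I₁]; ring
  rw [h, h1, h2, h3, B₂_eq, hB, k₁_eq, k₂_eq, k₃_eq, k₄_eq]
  rw [I₃] at hI
  have h4 := ω_sq
  have h5 := sqrt_seven_sq
  generalize I₁ (v (Sum.inl 1)) (v (Sum.inr 0)) (v (Sum.inr 1)) = a at *
  generalize I₂ (v (Sum.inl 1)) (v (Sum.inr 0)) (v (Sum.inr 1)) = b at *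
  generalize v (Sum.inr 0) = L at *
  generalize v (Sum.inr 1) = G at *
  generalize √7 = q at *
  generalize ω = w at *
  generalize ρ = r at *
  generalize δ = e at *
  clear hv h1 h2 h3 h hB
  grind

/-- The right side does not mention `N`: every admissible normal form leads to the same averaging
problem. -/
theorem lissajousHam_eq {W N : ℕ → Poly} (h : IsCenterNormalForm W N) {n : ℕ} (hn : n ≤ 2) :
    lissajousHam N n = pull (detunedPoly n) := by
  have hδ : ω ^ 2 * δ = 2 * √7 - 5 := by
    rw [δ_eq, ω_sq]
    linear_combination -16 / 27 * sqrt_seven_sq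
  ext v
  interval_cases n
  · simp only [lissajousHam, detunedHam]
    rw [centerHam_zero h, hδ]
    simp only [pull, detunedPoly, energyY, energyZ, y₂, z₂, Y₂, Z₂, ν, map_add, map_mul, map_pow,
      MvPolynomial.eval_X, MvPolynomial.eval_C]
    linear_combination -1 / 2 * lissajous v (Sum.inl 1) ^ 2 * ω_sq
  · simp only [lissajousHam, detunedHam]
    rw [centerHam_one h, hδ]
    simp only [pull, detunedPoly, y₂, z₂, Y₂, map_add, map_mul, map_pow,
      MvPolynomial.eval_X, MvPolynomial.eval_C, θ]
    ring
  · simp only [lissajousHam, detunedHam]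
    rw [centerHam_two h]
    simp only [pull, detunedPoly, y₂, z₂, Y₂, Z₂, map_add, map_mul, map_pow,
      MvPolynomial.eval_X, MvPolynomial.eval_C]
    ring

/-! #### Lines of constant `(g, L, G)` -/

theorem update_mem {v : Phase 2} (hv : v ∈ lissajousDomain) (t : ℝ) :
    Function.update v (Sum.inl 0) t ∈ lissajousDomain := by
  simpa [lissajousDomain] using hv

/-- Near `v` the zeroth order is `ωL`, and `L` is conjugate to `ℓ`. No differentiability of `f` is
required. -/
theorem poisson_pull_zero (f : Phase 2 → ℝ) {v : Phase 2} (hv : v ∈ lissajousDomain) :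
    poisson f (pull (detunedPoly 0)) v = ω * partialD f (Sum.inl 0) v := by
  have h : pull (detunedPoly 0) =ᶠ[𝓝 v] fun u => ω * u (Sum.inr 0) :=
    Filter.eventuallyEq_of_mem (isOpen_lissajousDomain.mem_nhds hv)
      fun u hu => pull_detunedPoly_zero hu
  have hp : ∀ i, partialD (fun u : Phase 2 => ω * u (Sum.inr 0)) i v
      = ω * (Pi.single i 1 : Phase 2) (Sum.inr 0) := by
    intro i
    have : HasFDerivAt (fun u : Phase 2 => ω * u (Sum.inr 0)) (ω • coord (Sum.inr 0)) v :=
      (coord (Sum.inr 0)).hasFDerivAt.const_mul ω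
    rw [partialD, this.fderiv]
    rfl
  rw [poisson_congr (EventuallyEq.refl _ f) h, poisson]
  simp [Fin.sum_univ_two, hp, mul_comm]

theorem poisson_zero_pull (f : Phase 2 → ℝ) {v : Phase 2} (hv : v ∈ lissajousDomain) :
    poisson (pull (detunedPoly 0)) f v = -(ω * partialD f (Sum.inl 0) v) := by
  rw [poisson_antisymm, poisson_pull_zero f hv]

theorem hasDerivAt_ell {f : Phase 2 → ℝ} (hf : ContDiffOn ℝ (⊤ : ℕ∞) f lissajousDomain)
    {v : Phase 2} (hv : v ∈ lissajousDomain) (t : ℝ) :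
    HasDerivAt (fun τ => f (Function.update v (Sum.inl 0) τ))
      (partialD f (Sum.inl 0) (Function.update v (Sum.inl 0) t)) t :=
  hasDerivAt_coord_line (Sum.inl 0) t
    (differentiableAt_of_contDiffOn isOpen_lissajousDomain hf (update_mem hv t))

theorem pull_periodic (p : PolyTwo) (v : Phase 2) :
    pull p (Function.update v (Sum.inl 0) (v (Sum.inl 0) + 2 * π)) = pull p v := by
  have : lissajous (Function.update v (Sum.inl 0) (v (Sum.inl 0) + 2 * π)) = lissajous v := by
    have h1 : v (Sum.inl 1) + (v (Sum.inl 0) + 2 * π) = v (Sum.inl 1) + v (Sum.inl 0) + 2 * π := by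
      ring
    have h2 : v (Sum.inl 1) - (v (Sum.inl 0) + 2 * π) = v (Sum.inl 1) - v (Sum.inl 0) - 2 * π := by
      ring
    simp only [lissajous, Function.update_self, ne_eq, reduceCtorEq, not_false_eq_true,
      Function.update_of_ne, Sum.inl.injEq, one_ne_zero, h1, h2, Real.cos_add_two_pi,
      Real.sin_add_two_pi, Real.cos_sub_two_pi, Real.sin_sub_two_pi]
  rw [pull, this, pull]

theorem update_zero_two_pi {f : Phase 2 → ℝ}
    (hf : ∀ v ∈ lissajousDomain,
      f (Function.update v (Sum.inl 0) (v (Sum.inl 0) + 2 * π)) = f v)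
    {v : Phase 2} (hv : v ∈ lissajousDomain) :
    f (Function.update v (Sum.inl 0) (2 * π)) = f (Function.update v (Sum.inl 0) 0) := by
  have := hf _ (update_mem hv 0)
  simpa using this

/-- The integrand is the `ℓ`-derivative of a periodic function. -/
theorem integral_pull_mvPoisson (p : PolyTwo) {v : Phase 2} (hv : v ∈ lissajousDomain) :
    ∫ t in (0 : ℝ)..(2 * π),
      pull (mvPoisson p (detunedPoly 0)) (Function.update v (Sum.inl 0) t) = 0 := by
  have hd : ∀ t, HasDerivAt (fun τ => ω * pull p (Function.update v (Sum.inl 0) τ))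
      (pull (mvPoisson p (detunedPoly 0)) (Function.update v (Sum.inl 0) t)) t := by
    intro t
    refine ((hasDerivAt_ell (contDiffOn_pull p) hv t).const_mul ω).congr_deriv ?_
    rw [← poisson_pull _ _ (update_mem hv t), poisson_pull_zero _ (update_mem hv t)]
  have hc : Continuous fun t => pull (mvPoisson p (detunedPoly 0))
      (Function.update v (Sum.inl 0) t) :=
    continuous_iff_continuousAt.2 fun t =>
      (hasDerivAt_ell (contDiffOn_pull _) hv t).continuousAt
  rw [intervalIntegral.integral_eq_sub_of_hasDerivAt (fun t _ => hd t) (hc.intervalIntegrable _ _),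
    update_zero_two_pi (fun v _ => pull_periodic p v) hv, sub_self]

theorem eq_zero_of_periodic {φ : ℝ → ℝ} {c : ℝ} (hd : ∀ t, HasDerivAt φ c t)
    (hp : φ (2 * π) = φ 0) : c = 0 ∧ ∀ t, φ t = φ 0 := by
  have hlin : ∀ t, φ t - c * t = φ 0 := by
    intro t
    have hd' : ∀ t, HasDerivAt (fun t => φ t - c * t) 0 t := fun t =>
      ((hd t).sub ((hasDerivAt_id t).const_mul c)).congr_deriv (by simp)
    have := is_const_of_deriv_eq_zero (fun t => (hd' t).differentiableAt)
      (fun t => (hd' t).deriv) t 0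
    simpa using this
  have hc : c = 0 := by
    have := hlin (2 * π)
    rw [hp] at this
    have h2 : c * (2 * π) = 0 := by linarith
    simpa [Real.pi_ne_zero] using h2
  refine ⟨hc, fun t => ?_⟩
  have := hlin t
  rw [hc] at this
  linarith

theorem pull_add (p q : PolyTwo) (v : Phase 2) : pull (p + q) v = pull p v + pull q v :=
  map_add _ _ _

theorem integral_generatorOne {v : Phase 2} (hv : v ∈ lissajousDomain) :
    ∫ t in (0 : ℝ)..(2 * π), pull generatorOne (Function.update v (Sum.inl 0) t) = 0 := by
  rw [← mvPoisson_primitiveOne]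
  exact integral_pull_mvPoisson _ hv

theorem integral_generatorTwo {v : Phase 2} (hv : v ∈ lissajousDomain) :
    ∫ t in (0 : ℝ)..(2 * π), pull generatorTwo (Function.update v (Sum.inl 0) t) = 0 := by
  rw [← mvPoisson_primitiveTwo]
  exact integral_pull_mvPoisson _ hv

theorem continuous_ell {f : Phase 2 → ℝ} (hf : ContDiffOn ℝ (⊤ : ℕ∞) f lissajousDomain)
    {v : Phase 2} (hv : v ∈ lissajousDomain) :
    Continuous fun t => f (Function.update v (Sum.inl 0) t) :=
  continuous_iff_continuousAt.2 fun t => (hasDerivAt_ell hf hv t).continuousAt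

/-- The homological equation has at most one solution that is periodic with zero mean. -/
theorem homological_unique {V : Phase 2 → ℝ} {p : PolyTwo}
    (hV : ContDiffOn ℝ (⊤ : ℕ∞) V lissajousDomain)
    (hper : ∀ v ∈ lissajousDomain,
      V (Function.update v (Sum.inl 0) (v (Sum.inl 0) + 2 * π)) = V v)
    {v : Phase 2} (hv : v ∈ lissajousDomain)
    (hmean : ∫ t in (0 : ℝ)..(2 * π), V (Function.update v (Sum.inl 0) t) = 0)
    (hp : ∫ t in (0 : ℝ)..(2 * π), pull p (Function.update v (Sum.inl 0) t) = 0) {c : ℝ}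
    (h : ∀ t, ω * partialD (pull p) (Sum.inl 0) (Function.update v (Sum.inl 0) t)
      - ω * partialD V (Sum.inl 0) (Function.update v (Sum.inl 0) t) = c) :
    c = 0 ∧ V v = pull p v := by
  have hω := ω_pos.ne'
  have hd : ∀ t, HasDerivAt (fun τ => ω * pull p (Function.update v (Sum.inl 0) τ)
      - ω * V (Function.update v (Sum.inl 0) τ)) c t := fun t =>
    (((hasDerivAt_ell (contDiffOn_pull p) hv t).const_mul ω).sub
      ((hasDerivAt_ell hV hv t).const_mul ω)).congr_deriv (h t)
  -- The function `ω (p - V)` has constant slope `c` in `ℓ` and is periodic, so it is constant; its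
  -- zero mean then makes it vanish.
  obtain ⟨hc, hφ⟩ := eq_zero_of_periodic hd (by
    rw [update_zero_two_pi (fun v _ => pull_periodic p v) hv, update_zero_two_pi hper hv])
  refine ⟨hc, ?_⟩
  have hint : ∫ t in (0 : ℝ)..(2 * π), (ω * pull p (Function.update v (Sum.inl 0) t)
      - ω * V (Function.update v (Sum.inl 0) t)) = 0 := by
    rw [intervalIntegral.integral_sub, intervalIntegral.integral_const_mul,
      intervalIntegral.integral_const_mul, hmean, hp, sub_self]
    · exact ((continuous_ell (contDiffOn_pull p) hv).const_mul ω).intervalIntegrable _ _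
    · exact ((continuous_ell hV hv).const_mul ω).intervalIntegrable _ _
  rw [intervalIntegral.integral_congr (fun t _ => hφ t), intervalIntegral.integral_const] at hint
  have h0 : ω * pull p (Function.update v (Sum.inl 0) 0)
      - ω * V (Function.update v (Sum.inl 0) 0) = 0 := by
    simpa [Real.pi_ne_zero] using hint
  have h1 := hφ (v (Sum.inl 0))
  rw [h0] at h1
  simp only [Function.update_eq_self] at h1
  exact (mul_left_cancel₀ hω (by linarith : ω * pull p v = ω * V v)).symm

theorem update_snd (v : Phase 2) (t : ℝ) :
    Function.update v (Sum.inl 0) t (Sum.inl 1) = v (Sum.inl 1) ∧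
    Function.update v (Sum.inl 0) t (Sum.inr 0) = v (Sum.inr 0) ∧
    Function.update v (Sum.inl 0) t (Sum.inr 1) = v (Sum.inr 1) := by
  simp

/-! ### Existence and uniqueness of the averaged Hamiltonian -/

section Averaged

variable {F V B : ℕ → Phase 2 → ℝ}

theorem poisson_generatorOne {v : Phase 2} (hv : v ∈ lissajousDomain) :
    pull (detunedPoly 1) v + poisson (pull (detunedPoly 0)) (pull generatorOne) v
      = pull averagedOne v := by
  rw [poisson_pull _ _ hv, ← pull_add, mvPoisson_generatorOne]

theorem poisson_generatorTwo {v : Phase 2} (hv : v ∈ lissajousDomain) :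
    pull (detunedPoly 2) v + (poisson (pull (detunedPoly 1)) (pull generatorOne) v
      + poisson (pull (detunedPoly 0)) (pull generatorTwo) v)
      + poisson (pull averagedOne) (pull generatorOne) v = pull averagedTwo v := by
  rw [poisson_pull _ _ hv, poisson_pull _ _ hv, poisson_pull _ _ hv, ← pull_add, ← pull_add,
    ← pull_add, mvPoisson_generatorTwo]

/-- The explicit solution serves as reference, so that an arbitrary `V 2` is compared with it only
through `ω ∂/∂ℓ`. The equality for `V 1` is assumed on the whole open domain because brackets
differentiate it. -/
theorem lieTransform_two_pull (hF : ∀ n ≤ 2, F n = pull (detunedPoly n))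
    (hV : ∀ v ∈ lissajousDomain, V 1 v = pull generatorOne v) {v : Phase 2}
    (hv : v ∈ lissajousDomain) :
    lieTransform poisson V F 2 v = pull averagedTwo v
      + ω * partialD (pull generatorTwo) (Sum.inl 0) v - ω * partialD (V 2) (Sum.inl 0) v := by
  have hev : ∀ {u}, u ∈ lissajousDomain → V 1 =ᶠ[𝓝 u] pull generatorOne := fun hu =>
    Filter.eventuallyEq_of_mem (isOpen_lissajousDomain.mem_nhds hu) hV
  have hav : pull (detunedPoly 1) + poisson (pull (detunedPoly 0)) (V 1)
      =ᶠ[𝓝 v] pull averagedOne := by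
    refine Filter.eventuallyEq_of_mem (isOpen_lissajousDomain.mem_nhds hv) fun u hu => ?_
    rw [Pi.add_apply, poisson_congr (EventuallyEq.refl _ _) (hev hu), poisson_generatorOne hu]
  rw [lieTransform_two, hF 0 (by norm_num), hF 1 (by norm_num), hF 2 le_rfl]
  simp only [Pi.add_apply]
  rw [poisson_congr hav (hev hv), poisson_congr (EventuallyEq.refl _ (pull (detunedPoly 1))) (hev hv),
    poisson_zero_pull _ hv, ← poisson_generatorTwo hv, poisson_zero_pull _ hv]
  ring

theorem lieTransform_one_pull (hF : ∀ n ≤ 2, F n = pull (detunedPoly n)) {v : Phase 2}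
    (hv : v ∈ lissajousDomain) :
    lieTransform poisson V F 1 v = pull averagedOne v
      + ω * partialD (pull generatorOne) (Sum.inl 0) v - ω * partialD (V 1) (Sum.inl 0) v := by
  rw [lieTransform_one, hF 0 (by norm_num), hF 1 (by norm_num), Pi.add_apply,
    poisson_zero_pull _ hv, ← poisson_generatorOne hv, poisson_zero_pull _ hv]
  ring

theorem pull_averagedOne_update {v : Phase 2} (hv : v ∈ lissajousDomain) (t : ℝ) :
    pull averagedOne (Function.update v (Sum.inl 0) t) = pull averagedOne v := by
  rw [pull_averagedOne hv, pull_averagedOne (update_mem hv t), (update_snd v t).1,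
    (update_snd v t).2.1, (update_snd v t).2.2]

theorem pull_averagedTwo_update {v : Phase 2} (hv : v ∈ lissajousDomain) (t : ℝ) :
    pull averagedTwo (Function.update v (Sum.inl 0) t) = pull averagedTwo v := by
  rw [pull_averagedTwo hv, pull_averagedTwo (update_mem hv t), (update_snd v t).1,
    (update_snd v t).2.1, (update_snd v t).2.2]

theorem pull_detunedPoly_zero_update {v : Phase 2} (hv : v ∈ lissajousDomain) (t : ℝ) :
    pull (detunedPoly 0) (Function.update v (Sum.inl 0) t) = pull (detunedPoly 0) v := by
  rw [pull_detunedPoly_zero hv, pull_detunedPoly_zero (update_mem hv t), (update_snd v t).2.1]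

/-- Both averages are constant along the `ℓ`-line, so their difference is the constant of
`homological_unique`. The identification of `V 1` is needed for the second order. -/
theorem IsAveraged.one (hF : ∀ n ≤ 2, F n = pull (detunedPoly n)) (h : IsAveraged F V B)
    {v : Phase 2} (hv : v ∈ lissajousDomain) :
    B 1 v = pull averagedOne v ∧ V 1 v = pull generatorOne v := by
  obtain ⟨h1, h2⟩ := homological_unique (p := generatorOne) (c := B 1 v - pull averagedOne v)
    (h.smooth 1 le_rfl (by norm_num)) (h.periodic 1 le_rfl (by norm_num)) hv
    (h.mean_zero 1 le_rfl (by norm_num) v hv) (integral_generatorOne hv) fun t => by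
      have := h.transformed 1 (by norm_num) _ (update_mem hv t)
      rw [h.averaged 1 (by norm_num) v hv, lieTransform_one_pull hF (update_mem hv t),
        pull_averagedOne_update hv] at this
      linarith
  exact ⟨by linarith, h2⟩

theorem IsAveraged.two (hF : ∀ n ≤ 2, F n = pull (detunedPoly n)) (h : IsAveraged F V B)
    {v : Phase 2} (hv : v ∈ lissajousDomain) : B 2 v = pull averagedTwo v := by
  have h1 := (homological_unique (p := generatorTwo) (c := B 2 v - pull averagedTwo v)
    (h.smooth 2 (by norm_num) le_rfl) (h.periodic 2 (by norm_num) le_rfl) hv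
    (h.mean_zero 2 (by norm_num) le_rfl v hv) (integral_generatorTwo hv) fun t => by
      have := h.transformed 2 le_rfl _ (update_mem hv t)
      rw [h.averaged 2 le_rfl v hv,
        lieTransform_two_pull hF (fun u hu => (h.one hF hu).2) (update_mem hv t),
        pull_averagedTwo_update hv] at this
      linarith).1
  linarith

theorem IsAveraged.zero (hF : ∀ n ≤ 2, F n = pull (detunedPoly n)) (h : IsAveraged F V B)
    {v : Phase 2} (hv : v ∈ lissajousDomain) : B 0 v = pull (detunedPoly 0) v := by
  rw [h.transformed 0 (by norm_num) v hv, lieTransform_zero, hF 0 (by norm_num)]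

theorem IsAveraged.exists_pull (hF : ∀ n ≤ 2, F n = pull (detunedPoly n)) (h : IsAveraged F V B)
    {n : ℕ} (hn : n ≤ 2) : ∃ p, ∀ v ∈ lissajousDomain, B n v = pull p v := by
  interval_cases n
  · exact ⟨_, fun _ hv => h.zero hF hv⟩
  · exact ⟨_, fun _ hv => (h.one hF hv).1⟩
  · exact ⟨_, fun _ hv => h.two hF hv⟩

/-- The bracket is `-∂B/∂ℓ`. Smoothness is not part of the data for `B`; it comes from the
polynomial with which `B` agrees on the domain. -/
theorem IsAveraged.poisson_eq_zero (hF : ∀ n ≤ 2, F n = pull (detunedPoly n))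
    (h : IsAveraged F V B) {n : ℕ} (hn : n ≤ 2) {v : Phase 2} (hv : v ∈ lissajousDomain) :
    poisson (fun u => u (Sum.inr 0)) (B n) v = 0 := by
  obtain ⟨p, hp⟩ := h.exists_pull hF hn
  have hB : B n =ᶠ[𝓝 v] pull p :=
    Filter.eventuallyEq_of_mem (isOpen_lissajousDomain.mem_nhds hv) hp
  have hℓ : partialD (pull p) (Sum.inl 0) v = 0 := by
    have h1 := hasDerivAt_ell (contDiffOn_pull p) hv (v (Sum.inl 0))
    have h2 : ∀ t, pull p (Function.update v (Sum.inl 0) t) = B n v := fun t => by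
      rw [← hp _ (update_mem hv t), h.averaged n hn v hv]
    simp only [h2, Function.update_eq_self] at h1
    exact h1.unique (hasDerivAt_const _ _)
  have hL : ∀ i, partialD (fun u : Phase 2 => u (Sum.inr 0)) i v
      = (Pi.single i 1 : Phase 2) (Sum.inr 0) := by
    intro i
    have : HasFDerivAt (fun u : Phase 2 => u (Sum.inr 0)) (coord (Sum.inr 0)) v :=
      (coord (Sum.inr 0)).hasFDerivAt
    rw [partialD, this.fderiv]
    rfl
  rw [poisson_congr (EventuallyEq.refl _ _) hB, poisson]
  simp [Fin.sum_univ_two, hL, hℓ]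

theorem exists_isAveraged (hF : ∀ n ≤ 2, F n = pull (detunedPoly n)) :
    ∃ V B : ℕ → Phase 2 → ℝ, IsAveraged F V B := by
  obtain ⟨V, hV1, hV2⟩ : ∃ V : ℕ → Phase 2 → ℝ, V 1 = pull generatorOne ∧ V 2 = pull generatorTwo :=
    ⟨fun n => pull (if n = 1 then generatorOne else generatorTwo), by simp, by simp⟩
  have h0 : ∀ {v}, v ∈ lissajousDomain → lieTransform poisson V F 0 v = pull (detunedPoly 0) v :=
    fun _ => by rw [lieTransform_zero, hF 0 (by norm_num)]
  have h1 : ∀ {v}, v ∈ lissajousDomain → lieTransform poisson V F 1 v = pull averagedOne v :=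
    fun hv => by rw [lieTransform_one_pull hF hv, hV1, add_sub_cancel_right]
  have h2 : ∀ {v}, v ∈ lissajousDomain → lieTransform poisson V F 2 v = pull averagedTwo v :=
    fun hv => by
      rw [lieTransform_two_pull hF (fun u _ => by rw [hV1]) hv, hV2, add_sub_cancel_right]
  have hV : ∀ n, 1 ≤ n → n ≤ 2 → V n = pull generatorOne ∨ V n = pull generatorTwo := by
    intro n hn hn2
    interval_cases n
    · exact Or.inl hV1
    · exact Or.inr hV2
  refine ⟨V, lieTransform poisson V F, fun n hn hn2 => ?_, fun n hn hn2 v hv => ?_,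
    fun n hn hn2 v hv => ?_, fun _ _ _ _ => rfl, ?_⟩
  · rcases hV n hn hn2 with h | h <;> rw [h] <;> exact contDiffOn_pull _
  · rcases hV n hn hn2 with h | h <;> rw [h] <;> exact pull_periodic _ v
  · rcases hV n hn hn2 with h | h <;> rw [h]
    · exact integral_generatorOne hv
    · exact integral_generatorTwo hv
  · intro n hn v hv t
    interval_cases n
    · rw [h0 hv, h0 (update_mem hv t), pull_detunedPoly_zero_update hv]
    · rw [h1 hv, h1 (update_mem hv t), pull_averagedOne_update hv]
    · rw [h2 hv, h2 (update_mem hv t), pull_averagedTwo_update hv]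

theorem IsAveraged.exists_orbit (hF : ∀ n ≤ 2, F n = pull (detunedPoly n))
    (h : IsAveraged F V B) {v : Phase 2} (hv : v ∈ lissajousDomain) :
    ∃ γ : ℝ → Phase 2, IsLieOrbit V v γ ∧
      (fun ε : ℝ => truncated (fun n => F n (γ ε)) ε - truncated (fun n => B n v) ε)
        =O[𝓝 0] fun ε : ℝ => ε ^ 3 := by
  have hV1 := h.smooth 1 le_rfl (by norm_num)
  have hV2 := h.smooth 2 (by norm_num) le_rfl
  obtain ⟨γ, hγ⟩ := exists_isLieOrbit isOpen_lissajousDomain hv hV1 hV2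
  refine ⟨γ, hγ, ?_⟩
  have := hγ.isBigO_truncated (F := F) isOpen_lissajousDomain hv hV1 hV2 fun m hm => by
    rw [hF m hm]
    exact contDiffOn_pull _
  have hB : ∀ ε, truncated (fun n => B n v) ε
      = truncated (fun n => lieTransform poisson V F n v) ε := fun ε => by
    simp only [truncated_eq]
    rw [h.transformed 0 (by norm_num) v hv, h.transformed 1 (by norm_num) v hv,
      h.transformed 2 le_rfl v hv]
  simpa only [hB] using this

theorem IsAveraged.formulas (hF : ∀ n ≤ 2, F n = pull (detunedPoly n)) (h : IsAveraged F V B)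
    {ℓ g L G : ℝ} (hG : |G| < L) :
    B 0 (Sum.elim ![ℓ, g] ![L, G]) = B₀ L ∧ B 1 (Sum.elim ![ℓ, g] ![L, G]) = B₁ g L G ∧
      B 2 (Sum.elim ![ℓ, g] ![L, G]) = B₂ g L G ∧
      truncated (fun n => B n (Sum.elim ![ℓ, g] ![L, G])) 1
        = hopfHam L (I₁ g L G) (I₂ g L G) (I₃ G) := by
  have hv : (Sum.elim ![ℓ, g] ![L, G] : Phase 2) ∈ lissajousDomain := by
    simpa [lissajousDomain] using hG
  have h0 : B 0 (Sum.elim ![ℓ, g] ![L, G]) = B₀ L := by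
    rw [h.zero hF hv, pull_detunedPoly_zero hv]; simp [B₀]
  have h1 : B 1 (Sum.elim ![ℓ, g] ![L, G]) = B₁ g L G := by
    rw [(h.one hF hv).1, pull_averagedOne hv]; simp
  have h2 : B 2 (Sum.elim ![ℓ, g] ![L, G]) = B₂ g L G := by
    rw [h.two hF hv, pull_averagedTwo hv]; simp
  refine ⟨h0, h1, h2, ?_⟩
  rw [truncated_eq, h0, h1, h2, ← hopfHam_eq]
  ring

end Averaged

/-! ### The center normal form along orbits of its generating function -/

theorem eval_lieTransform (W F : ℕ → Poly) {n : ℕ} (hn : n ≤ 2) (ζ : Phase 3) :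
    lieTransform poisson (fun n v => MvPolynomial.eval v (W n))
      (fun n v => MvPolynomial.eval v (F n)) n ζ
      = MvPolynomial.eval ζ (lieTransform polyPoisson W F n) := by
  have hadd : ∀ f g : Poly, (fun v => MvPolynomial.eval v f) + (fun v => MvPolynomial.eval v g)
      = fun v => MvPolynomial.eval v (f + g) := fun f g => by
    ext v
    simp
  have hbr : ∀ f g : Poly, poisson (fun v => MvPolynomial.eval v f)
      (fun v => MvPolynomial.eval v g) = fun v => MvPolynomial.eval v (polyPoisson f g) :=
    fun f g => poisson_eval f g
  interval_cases n
  · rfl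
  · rw [lieTransform_one, lieTransform_one, hbr, hadd]
  · rw [lieTransform_two, lieTransform_two]
    simp only [hbr, hadd]

/-- Two errors add up: that of the Hill expansion at the decoupled orbit, and `ε²` times the `O(ε³)`
error of the Lie transform. Linearity of the decoupling lets it commute with the scaling by `ε`. -/
theorem exists_center_orbit {W N : ℕ → Poly} (h : IsCenterNormalForm W N) (ζ : Phase 3) :
    ∃ γ : ℝ → Phase 3, IsLieOrbit (fun n v => MvPolynomial.eval v (W n)) ζ γ ∧
      (fun ε : ℝ => hillHam (translation (decoupling (ε • γ ε)))
          - (-(9 / 2) * ρ ^ 2 + ε ^ 2 * truncated (fun n => MvPolynomial.eval ζ (N n)) ε))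
        =O[𝓝 0] fun ε : ℝ => ε ^ 5 := by
  have hs : ∀ p : Poly, ContDiffOn ℝ (⊤ : ℕ∞) (fun v => MvPolynomial.eval v p) Set.univ :=
    fun p => (contDiff_eval p).contDiffOn
  obtain ⟨γ, hγ⟩ := exists_isLieOrbit (W := fun n v => MvPolynomial.eval v (W n)) (ζ := ζ)
    isOpen_univ (Set.mem_univ ζ) (hs _) (hs _)
  refine ⟨γ, hγ, ?_⟩
  have h1 := hγ.isBigO_truncated (F := fun n v => MvPolynomial.eval v (K n)) isOpen_univ
    (Set.mem_univ ζ) (hs _) (hs _) fun m _ => hs _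
  have hN : ∀ ε, truncated (fun n => lieTransform poisson (fun n v => MvPolynomial.eval v (W n))
      (fun n v => MvPolynomial.eval v (K n)) n ζ) ε
      = truncated (fun n => MvPolynomial.eval ζ (N n)) ε := fun ε => by
    simp only [truncated_eq]
    rw [eval_lieTransform W K (by norm_num), eval_lieTransform W K (by norm_num),
      eval_lieTransform W K le_rfl, h.transformed 0 (by norm_num), h.transformed 1 (by norm_num),
      h.transformed 2 le_rfl]
  simp only [hN] at h1
  simp only [eval_K] at h1
  have hc : ContinuousAt (fun ε => decoupling (γ ε)) 0 := by
    have : Continuous decoupling := (Matrix.mulVecLin A).continuous_of_finiteDimensional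
    exact this.continuousAt.comp hγ.differentiableAt.continuousAt
  have h2 := isBigO_hillHam hc
  have h3 := (isBigO_refl (fun ε : ℝ => ε ^ 2) (𝓝 0)).mul h1
  simp only [← pow_add] at h3
  refine (h2.add h3).congr_left fun ε => ?_
  rw [show decoupling (ε • γ ε) = ε • decoupling (γ ε) from Matrix.mulVec_smul _ _ _]
  ring

end Hill

end

/-! ### Assembly of the result -/

theorem mainTheorem1 :
    -- translation to the libration point and expansion of the Hill Hamiltonian
    Hill.IsCanonicalOn Hill.translation Set.univ ∧
    Hill.hamField Hill.hillHam (Hill.translation 0) = 0 ∧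
    (∀ ζ : Hill.Phase 3,
      (fun ε : ℝ => Hill.hillHam (Hill.translation (ε • ζ))
          - (-(9 / 2) * Hill.ρ ^ 2
              + ε ^ 2 * Hill.truncated (fun n => MvPolynomial.eval ζ (Hill.H n)) ε))
        =O[𝓝 0] fun ε : ℝ => ε ^ 5) ∧
    -- linear decoupling
    Hill.IsCanonicalOn Hill.decoupling Set.univ ∧
    Hill.K 0 = MvPolynomial.C Hill.lam * Hill.x * Hill.px
        + MvPolynomial.C (1 / 2) * (Hill.py ^ 2 + MvPolynomial.C (Hill.ω ^ 2) * Hill.y ^ 2)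
        + MvPolynomial.C (1 / 2) * (Hill.pz ^ 2 + MvPolynomial.C (Hill.ν ^ 2) * Hill.z ^ 2) ∧
    -- detuning parameter and Lissajous transformation
    Hill.δ = (23 - 8 * √7) / 27 ∧
    Hill.IsCanonicalOn Hill.lissajous Hill.lissajousDomain ∧
    -- center manifold normal form and averaging over the elliptic anomaly
    (∃ W N : ℕ → Hill.Poly, Hill.IsCenterNormalForm W N) ∧
    (∀ W N : ℕ → Hill.Poly, Hill.IsCenterNormalForm W N →
      (∀ n ≤ 2, Hill.polyPoisson (Hill.x * Hill.px) (N n) = 0) ∧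
      (∀ ζ : Hill.Phase 3, ∃ γ : ℝ → Hill.Phase 3,
        Hill.IsLieOrbit (fun n v => MvPolynomial.eval v (W n)) ζ γ ∧
        (fun ε : ℝ => Hill.hillHam (Hill.translation (Hill.decoupling (ε • γ ε)))
            - (-(9 / 2) * Hill.ρ ^ 2
                + ε ^ 2 * Hill.truncated (fun n => MvPolynomial.eval ζ (N n)) ε))
          =O[𝓝 0] fun ε : ℝ => ε ^ 5) ∧
      (∃ V B : ℕ → Hill.Phase 2 → ℝ, Hill.IsAveraged (Hill.lissajousHam N) V B) ∧
      (∀ V B : ℕ → Hill.Phase 2 → ℝ, Hill.IsAveraged (Hill.lissajousHam N) V B →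
        (∀ v ∈ Hill.lissajousDomain, ∃ γ : ℝ → Hill.Phase 2,
          Hill.IsLieOrbit V v γ ∧
          (fun ε : ℝ => Hill.truncated (fun n => Hill.lissajousHam N n (γ ε)) ε
              - Hill.truncated (fun n => B n v) ε)
            =O[𝓝 0] fun ε : ℝ => ε ^ 3) ∧
        (∀ n ≤ 2, ∀ v ∈ Hill.lissajousDomain,
          Hill.poisson (fun u => u (Sum.inr 0)) (B n) v = 0) ∧
        (∀ ℓ g L G : ℝ, |G| < L →
          B 0 (Sum.elim ![ℓ, g] ![L, G]) = Hill.B₀ L ∧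
          B 1 (Sum.elim ![ℓ, g] ![L, G]) = Hill.B₁ g L G ∧
          B 2 (Sum.elim ![ℓ, g] ![L, G]) = Hill.B₂ g L G ∧
          Hill.truncated (fun n => B n (Sum.elim ![ℓ, g] ![L, G])) 1
            = Hill.hopfHam L (Hill.I₁ g L G) (Hill.I₂ g L G) (Hill.I₃ G)))) ∧
    (0 < Hill.k₀ ∧ 0 < Hill.k₁ ∧ 0 < Hill.k₂ ∧ 0 < Hill.k₃ ∧ 0 < Hill.k₄) ∧
    (Irrational Hill.k₀ ∧ Irrational Hill.k₁ ∧ Irrational Hill.k₂ ∧ Irrational Hill.k₃ ∧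
      Irrational Hill.k₄) ∧
    -- Hopf variables on the sphere, circular orbits included
    (∀ g L G : ℝ, |G| ≤ L →
      Hill.I₁ g L G ^ 2 + Hill.I₂ g L G ^ 2 + Hill.I₃ G ^ 2 = L ^ 2 / 4 ∧
      Hill.B₀ L + Hill.B₁ g L G + Hill.B₂ g L G / 2
        = Hill.hopfHam L (Hill.I₁ g L G) (Hill.I₂ g L G) (Hill.I₃ G)) ∧
    (∀ L a b c : ℝ, 0 ≤ L → a ^ 2 + b ^ 2 + c ^ 2 = L ^ 2 / 4 →
      ∃ g G : ℝ, |G| ≤ L ∧ Hill.I₁ g L G = a ∧ Hill.I₂ g L G = b ∧ Hill.I₃ G = c) := by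
  refine ⟨Hill.isCanonicalOn_translation, Hill.hamField_hillHam_libration,
    fun ζ => Hill.isBigO_hillHam (γ := fun _ => ζ) continuousAt_const,
    Hill.isCanonicalOn_decoupling, Hill.K_zero, Hill.δ_eq, Hill.isCanonicalOn_lissajous,
    Hill.exists_isCenterNormalForm, fun W N h => ?_, Hill.k_pos, Hill.k_irrational,
    fun g L G hG => ⟨Hill.hopf_sphere hG, Hill.hopfHam_eq g L G⟩,
    fun L a b c hL hs => Hill.exists_hopf hL hs⟩
  -- The averaging statements depend on `N` only through these explicit polynomials.
  have hF : ∀ n ≤ 2, Hill.lissajousHam N n = Hill.pull (Hill.detunedPoly n) :=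
    fun n hn => Hill.lissajousHam_eq h hn
  exact ⟨fun n hn => Hill.polyPoisson_x_mul_px (h.normal n hn), Hill.exists_center_orbit h,
    Hill.exists_isAveraged hF, fun V B hB => ⟨fun v hv => hB.exists_orbit hF hv,
      fun n hn v hv => hB.poisson_eq_zero hF hn hv,
      fun ℓ g L G hG => hB.formulas hF hG⟩⟩
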